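/- Let $\Omega$ be the set of paths $\omega:\mathbb N\to\mathbb Z$ with $|\omega(n+1)-\omega(n)|=1$ for all $n$, $X=(X_n)_{n\ge 0}$ the coordinate process, $\mathcal F_n=\sigma(X_0,\dots,X_n)$, $\mathcal F_\infty=\bigvee_n\mathcal F_n$, and $\mathbb P$ (with expectation $E$) the law on $(\Omega,\mathcal F_\infty)$ of the simple symmetric random walk started from $0$. Put $S^*_n=\sup_{k\le n}|X_k|$, $S^*_\infty=\sup_n S^*_n$, $g_p=\sup\{k\le p: X_k=0\}$, $g=\sup\{k\ge 0: X_k=0\}$, $\gamma_n=\sum_{k=0}^n \mathbf 1_{\{X_k=0\}}$ and $\tau_a=\inf\{n\ge 0:\gamma_n=a\}$. Let $\varphi:\mathbb N\to[0,\infty)$ satisfy $\sum_{k\ge0}\varphi(k)=1$ and $\sum_{k\ge 0}k^2\varphi(k)<\infty$, and put $\bar\varphi(x)=\sum_{k\ge x}\varphi(k)$. The 3-Bessel* walk is the Markov chain on $\{1,2,\dots\}$ with transition probabilities $\pi^*(x,x+1)=\frac{x+1}{2x}$, $\pi^*(x,x-1)=\frac{x-1}{2x}$. **Theorem.** 1.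 (a) For every $n\ge 0$ and every $\Lambda_n\in\mathcal F_n$, $$\lim_{p\to\infty}\frac{E[\mathbf 1_{\Lambda_n}\varphi(S^*_{g_p})]}{E[\varphi(S^*_{g_p})]}=E[\mathbf 1_{\Lambda_n}M^*_n],\qquad M^*_n=\varphi(S^*_{g_n})|X_n|+\varphi(S^*_n)\,(S^*_n-|X_n|)+\bar\varphi(S^*_n).$$ (b) $(M^*_n)_{n\ge0}$ is a nonnegative $(\mathcal F_n)$-martingale under $\mathbb P$, and it is not uniformly integrable. 2. There is a unique probability $Q^*$ on $(\Omega,\mathcal F_\infty)$ with $Q^*(\Lambda_n)=E[\mathbf 1_{\Lambda_n}M^*_n]$ for all $n\ge0$, $\Lambda_n\in\mathcal F_n$. Under $Q^*$: (a) $g<\infty$ a.s. and $S^*_\infty=\infty$ a.s. (b) For all $a,k\in\mathbb N$, $$Q^*(\gamma_g=a,\ S^*_g=k)=\begin{cases}\varphi(0)&\text{if }a=1,\ k=0,\\ \left\{\left(1-\frac1{k+1}\right)^{a-1}-\left(1-\frac1k\right)^{a-1}\right\}\varphi(k)&\text{if }a>1,\ k>0,\\ 0&\text{otherwise,}\end{cases}$$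 and $Q^*(S^*_g=k)=\varphi(k)$ for all $k\in\mathbb N$. 3. Under $Q^*$: (a) the path up to $g$, $(X_n,\ n\le g)$ (including its length $g$), and the path after $g$, $(X_{g+n},\ n\ge1)$, are independent; (b) the events $\{X_{g+n}>0\ \forall n\ge1\}$ and $\{X_{g+n}<0\ \forall n\ge1\}$ both have probability $\frac12$; conditionally on the first, $(X_{g+n},\ n\ge 1)$ is a 3-Bessel* walk started from $1$, and conditionally on the second, $(-X_{g+n},\ n\ge1)$ is a 3-Bessel* walk started from $1$; (c) for all $a,b\in\mathbb N$ with $Q^*(\gamma_g=a,\ S^*_g=b)>0$, the conditional law under $Q^*$ of $(X_n,\ n\le g)$ given $\gamma_g=a$ and $S^*_g=b$ is the law under $\mathbb P$ of the walk stopped at $\tau_a$, $(X_n,\ n\le\tau_a)$, given $\tau_a<\infty$ and $S^*_{\tau_a}=b$. -/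

import Mathlib

open MeasureTheory ProbabilityTheory Filter Topology
open scoped ENNReal

noncomputable section

namespace WalkPenalisation

/-- The canonical space `Ω`: integer-valued sequences all of whose steps are `±1`. It carries
the trace of the product `σ`-field, that is, the `σ`-field generated by the coordinates. -/
abbrev Path : Type := {ω : ℕ → ℤ // ∀ n, |ω (n + 1) - ω n| = 1}

/-- The coordinate process. -/
def X (n : ℕ) (ω : Path) : ℤ := ω.1 n

lemma measurable_X (n : ℕ) : Measurable (X n) :=
  (measurable_pi_apply n).comp measurable_subtype_coe

/-- The canonical filtration `ℱ_n = σ(X_0, …, X_n)`. -/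
def canonFiltration : Filtration ℕ (Subtype.instMeasurableSpace : MeasurableSpace Path) :=
  Filtration.natural X (fun n => (measurable_X n).stronglyMeasurable)

/-- One step of the walk, read off a coin toss. -/
def coinStep (b : Bool) : ℤ := if b then 1 else -1

/-- The path started from `0` whose successive steps are given by a sequence of coin tosses. -/
def pathOfCoins (c : ℕ → Bool) : Path :=
  ⟨fun n => ∑ i ∈ Finset.range n, coinStep (c i), fun n => by
    simp only [Finset.sum_range_succ, add_sub_cancel_left]
    unfold coinStep
    split <;> simp⟩

lemma measurable_pathOfCoins : Measurable pathOfCoins := by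
  refine Measurable.subtype_mk (measurable_pi_lambda _ fun n => ?_)
  exact Finset.measurable_sum _ fun i _ =>
    (measurable_of_countable coinStep).comp (measurable_pi_apply i)

/-- The law `ℙ = ℙ_0` of the standard random walk started from `0`: the image of the law of a
sequence of independent fair coin tosses. -/
def walkLaw : Measure Path :=
  (Measure.infinitePi fun _ : ℕ => (PMF.uniformOfFintype Bool).toMeasure).map pathOfCoins

instance : IsProbabilityMeasure walkLaw :=
  Measure.isProbabilityMeasure_map measurable_pathOfCoins.aemeasurable

/-- The bilateral supremum `S*_n = sup_{k ≤ n} |X_k|`. -/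
def Sstar (n : ℕ) (ω : Path) : ℕ := (Finset.range (n + 1)).sup fun k => (X k ω).natAbs

/-- `S*_∞ = sup_k |X_k|`. -/
def SstarInfty (ω : Path) : ℕ∞ := ⨆ n : ℕ, (Sstar n ω : ℕ∞)

/-- `g_p`, the last zero of the path in `[0, p]`. -/
def lastZeroBefore (p : ℕ) (ω : Path) : ℕ :=
  ((Finset.range (p + 1)).filter fun k => X k ω = 0).sup id

/-- `γ_n = ∑_{k=0}^n 1_{X_k = 0}`, the number of zeros in `[0, n]` (time `0` included). -/
def zeroCount (n : ℕ) (ω : Path) : ℕ :=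
  ((Finset.range (n + 1)).filter fun k => X k ω = 0).card

/-- `τ_a = inf {n : γ_n = a}`, infinite if there is no such `n`. -/
def tau (a : ℕ) (ω : Path) : ℕ∞ := ⨅ n ∈ {n : ℕ | zeroCount n ω = a}, (n : ℕ∞)

/-- `g = sup {k : X_k = 0}`, the last zero of the whole path. -/
def lastZero (ω : Path) : ℕ∞ := ⨆ k ∈ {k : ℕ | X k ω = 0}, (k : ℕ∞)

/-- `g` as a natural number (only meaningful where `g < ∞`). -/
def g (ω : Path) : ℕ := (lastZero ω).toNat

/-- The trajectory `(X_n, n ≤ T)`, recorded as the time `T` together with the path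
stopped at `T`. -/
def pathUpTo (T : ℕ) (ω : Path) : ℕ × (ℕ → ℤ) := (T, fun n => X (min n T) ω)

/-- The trajectory after the last zero, `(X_{g+1}, X_{g+2}, …)`. -/
def postG (n : ℕ) (ω : Path) : ℤ := X (g ω + 1 + n) ω

/-- `φ̄(x) = ∑_{k ≥ x} φ(k)`. -/
def tailSum (φ : ℕ → ℝ) (x : ℕ) : ℝ := ∑' k : ℕ, φ (x + k)

/-- `M*_n = φ(S*_{g_n}) |X_n| + φ(S*_n) (S*_n - |X_n|) + φ̄(S*_n)`. -/
def Mstar (φ : ℕ → ℝ) (n : ℕ) (ω : Path) : ℝ :=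
  φ (Sstar (lastZeroBefore n ω) ω) * |(X n ω : ℝ)|
    + φ (Sstar n ω) * ((Sstar n ω : ℝ) - |(X n ω : ℝ)|)
    + tailSum φ (Sstar n ω)

/-- `Q(Λ) = 𝔼[1_Λ M*_n]` for all `n` and all `Λ ∈ ℱ_n`. -/
def IsInducedBy (φ : ℕ → ℝ) (Q : Measure Path) : Prop :=
  ∀ (n : ℕ) (Λ : Set Path), MeasurableSet[canonFiltration n] Λ →
    Q.real Λ = ∫ ω in Λ, Mstar φ n ω ∂walkLaw

/-- The law of `(γ_g, S*_g)` under `Q*`. -/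
def jointLaw (φ : ℕ → ℝ) (a k : ℕ) : ℝ :=
  if a = 1 ∧ k = 0 then φ 0
  else if 1 < a ∧ 0 < k then
    ((1 - 1 / ((k : ℝ) + 1)) ^ (a - 1) - (1 - 1 / (k : ℝ)) ^ (a - 1)) * φ k
  else 0

/-- The transition probabilities of the 3-Bessel* walk on `{1, 2, …}`:
`π*(x, x+1) = (x+1)/(2x)` and `π*(x, x-1) = (x-1)/(2x)`. -/
def besselStarTrans (x y : ℤ) : ℝ :=
  if 1 ≤ x then
    if y = x + 1 then ((x : ℝ) + 1) / (2 * x)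
    else if y = x - 1 then ((x : ℝ) - 1) / (2 * x)
    else 0
  else 0

/-- Under `μ`, the process `Y` is a 3-Bessel* walk started from `x`: it takes its values in
`{1, 2, …}`, starts from `x`, and is a Markov chain with transition probabilities `π*`. -/
def IsBesselStarWalk {Ω : Type*} [MeasurableSpace Ω] (Y : ℕ → Ω → ℤ) (μ : Measure Ω)
    (x : ℤ) : Prop :=
  (∀ᵐ ω ∂μ, ∀ n, 1 ≤ Y n ω) ∧
  (∀ᵐ ω ∂μ, Y 0 ω = x) ∧
  ∀ (n : ℕ) (y : ℕ → ℤ),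
    μ.real {ω | ∀ i ≤ n + 1, Y i ω = y i} =
      μ.real {ω | ∀ i ≤ n, Y i ω = y i} * besselStarTrans (y n) (y (n + 1))

end WalkPenalisation

end

noncomputable section

namespace WalkPenalisation

/-! ### Functionals of the first steps of a path -/

/-! Conditioning on the past enters only through `flip n`, which reverses the step after time `n`.
It preserves the law of the walk and fixes every functional of the first `n` steps, so a one-step
conditional expectation is the average of the values at `ω` and at `flip n ω` (`setIntegral_step`).
Martingale identities thereby become case checks on the values of `|X_n|`, `S*_n`, `S*_{g_n}` and
`γ_n`.

Penalisation. Let `s_q = survive q 1`. A binomial formula gives `s_{q+1}/s_q → 1`, and the one-step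
recurrence then gives `survive q y ~ y s_q`. The event `S*_{g_p} ≤ k` says that the walk does not
return to `0` once it has left `[-k, k]`. Divided by `s_p`, its probability tends to the harmonic
function on `[-k, k]` with boundary value `k + 1`, that is, to the constant `k + 1`
(`tendsto_confine_div`). The conditional law of `S*_{g_p}` given `ℱ_n`, divided by `s_p`, therefore
converges to `weight · n`, and integrating `φ` against this limit gives `M*_n`. The uniform bound `6
(k+1)² s_p` (`confine_le`) and the second moment of `φ` allow the exchange of limit and sum.

The measure. `Q*` comes from the Ionescu-Tulcea theorem, with the ratios `M*_{n+1} / (2 M*_n)` as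
coin probabilities. In `M*_n` only the term `φ(S*_{g_n}) |X_n|` is unbounded, and under `ℙ` the
probability of having no zero in `(N, m]` tends to `0` as `m → ∞`. Hence the central formula
(`measureReal_noZeroAfter`): `Q*(Λ, no zero after N) = E[1_Λ φ(S*_{g_N}) max(|X_N|, 1)]` for `Λ ∈
ℱ_N`. At a zero it reads `Q*(Λ, g = n) = E[1_Λ φ(S*_n) 1_{X_n = 0}]`.

Each excursion of the walk stays in `[-k, k]` with probability `k/(k+1)`. Summing the formula over
`n` therefore gives the law of `(γ_g, S*_g)`; its total mass is one, so `g < ∞` almost surely. Once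
`γ_g = a` and `S*_g = b` are fixed, the density `φ(b)` is constant and the path up to `g` is the
walk stopped at `τ_a`. After `g`, the path is the `h`-transform by `max(|x|, 1)`, whatever happened
before, which gives the independence and the 3-Bessel* transitions. Finally, `ℙ(S*_{g_n} ≤ K) → 0`:
since `M*_n ≤ K + C` on `{S*_n ≤ K}`, this forces `S*_∞ = ∞`, and since `Q*(S*_{g_n} ≤ K)` stays
away from `0` for large `K`, it rules out uniform integrability. -/

/-- Two paths agree up to time `n`. -/
def AgreeUpTo (n : ℕ) (ω ω' : Path) : Prop := ∀ k ≤ n, X k ω = X k ω'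

/-- `f` is a functional of `X_0, …, X_n`. -/
def DependsUpTo {β : Type*} (n : ℕ) (f : Path → β) : Prop :=
  ∀ ω ω', AgreeUpTo n ω ω' → f ω = f ω'

lemma AgreeUpTo.mono {m n : ℕ} (h : m ≤ n) {ω ω' : Path} (hω : AgreeUpTo n ω ω') :
    AgreeUpTo m ω ω' := fun k hk => hω k (hk.trans h)

lemma DependsUpTo.mono {β : Type*} {m n : ℕ} (h : m ≤ n) {f : Path → β} (hf : DependsUpTo m f) :
    DependsUpTo n f := fun ω ω' hω => hf ω ω' (hω.mono h)

lemma DependsUpTo.comp {β γ : Type*} {n : ℕ} {f : Path → β} (hf : DependsUpTo n f) (u : β → γ) :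
    DependsUpTo n (fun ω => u (f ω)) := fun ω ω' hω => congrArg u (hf ω ω' hω)

lemma DependsUpTo.comp₂ {β γ δ : Type*} {n : ℕ} {f : Path → β} {f' : Path → γ}
    (hf : DependsUpTo n f) (hf' : DependsUpTo n f') (u : β → γ → δ) :
    DependsUpTo n (fun ω => u (f ω) (f' ω)) := fun ω ω' hω => by
  simp only [hf ω ω' hω, hf' ω ω' hω]

lemma dependsUpTo_const {β : Type*} (n : ℕ) (b : β) : DependsUpTo n (fun _ => b) :=
  fun _ _ _ => rfl

lemma dependsUpTo_X {k n : ℕ} (h : k ≤ n) : DependsUpTo n (X k) := fun _ _ hω => hω k h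

lemma canonFiltration_eq_comap (n : ℕ) :
    canonFiltration n = MeasurableSpace.comap (fun ω (j : Set.Iic n) => X j ω) inferInstance :=
  Filtration.natural_eq_comap X (fun n => (measurable_X n).stronglyMeasurable) n

lemma agreeUpTo_iff (n : ℕ) (ω ω' : Path) :
    AgreeUpTo n ω ω' ↔
      (fun j : Set.Iic n => X j ω) = fun j : Set.Iic n => X j ω' := by
  rw [funext_iff]
  exact ⟨fun h j => h j j.2, fun h k hk => h ⟨k, hk⟩⟩

/-- There are only countably many beginnings of length `n`, so every set of beginnings is
measurable. Measurability with respect to `ℱ_n` becomes a purely combinatorial condition, checked by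
rewriting. -/
lemma measurableSet_canonFiltration_iff {n : ℕ} {Λ : Set Path} :
    MeasurableSet[canonFiltration n] Λ ↔ DependsUpTo n (fun ω => ω ∈ Λ) := by
  rw [canonFiltration_eq_comap]
  constructor
  · rintro ⟨U, -, rfl⟩ ω ω' h
    simp only [Set.mem_preimage, (agreeUpTo_iff n ω ω').1 h]
  · intro h
    refine ⟨(fun ω (j : Set.Iic n) => X j ω) '' Λ, (Set.to_countable _).measurableSet, ?_⟩
    ext ω
    constructor
    · rintro ⟨ω', hω', he⟩
      exact (h ω' ω ((agreeUpTo_iff n ω' ω).2 he)).mp hω'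
    · exact fun hω => ⟨ω, hω, rfl⟩

lemma DependsUpTo.measurable_canonFiltration {β : Type*} [MeasurableSpace β] {n : ℕ}
    {f : Path → β} (hf : DependsUpTo n f) : Measurable[canonFiltration n] f := fun s _ =>
  measurableSet_canonFiltration_iff.2 (hf.comp (· ∈ s))

lemma DependsUpTo.measurable {β : Type*} [MeasurableSpace β] {n : ℕ}
    {f : Path → β} (hf : DependsUpTo n f) : Measurable f :=
  hf.measurable_canonFiltration.mono (canonFiltration.le n) le_rfl

lemma DependsUpTo.measurableSet_canonFiltration {n : ℕ} {p : Path → Prop}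
    (hp : DependsUpTo n p) : MeasurableSet[canonFiltration n] {ω | p ω} :=
  measurableSet_canonFiltration_iff.2 hp

lemma DependsUpTo.indicator {n : ℕ} {f : Path → ℝ} (hf : DependsUpTo n f) {Λ : Set Path}
    (hΛ : MeasurableSet[canonFiltration n] Λ) : DependsUpTo n (Λ.indicator f) := by
  classical
  intro ω ω' h
  simp only [Set.indicator_apply, hf ω ω' h, measurableSet_canonFiltration_iff.1 hΛ ω ω' h]

/-! ### The running maximum and the last zero -/

lemma dependsUpTo_Sstar (n : ℕ) : DependsUpTo n (Sstar n) := fun ω ω' h =>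
  Finset.sup_congr rfl fun k hk => by rw [h k (Nat.lt_succ_iff.1 (Finset.mem_range.1 hk))]

lemma dependsUpTo_lastZeroBefore (n : ℕ) : DependsUpTo n (lastZeroBefore n) := fun ω ω' h => by
  unfold lastZeroBefore
  congr 1
  exact Finset.filter_congr fun k hk => by rw [h k (Nat.lt_succ_iff.1 (Finset.mem_range.1 hk))]

lemma dependsUpTo_zeroCount (n : ℕ) : DependsUpTo n (zeroCount n) := fun ω ω' h => by
  unfold zeroCount
  congr 1
  exact Finset.filter_congr fun k hk => by rw [h k (Nat.lt_succ_iff.1 (Finset.mem_range.1 hk))]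

/-- The maximum `S*_{g_n}` at the last zero before `n`. -/
def Rstar (n : ℕ) (ω : Path) : ℕ := Sstar (lastZeroBefore n ω) ω

lemma lastZeroBefore_le (n : ℕ) (ω : Path) : lastZeroBefore n ω ≤ n :=
  Finset.sup_le fun k hk => by
    simpa [Nat.lt_succ_iff] using (Finset.mem_filter.1 hk).1

lemma dependsUpTo_Rstar (n : ℕ) : DependsUpTo n (Rstar n) := fun ω ω' h => by
  unfold Rstar
  rw [← dependsUpTo_lastZeroBefore n ω ω' h]
  exact dependsUpTo_Sstar _ ω ω' (h.mono (lastZeroBefore_le n ω))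

lemma Sstar_zero (ω : Path) : Sstar 0 ω = (X 0 ω).natAbs := by simp [Sstar]

lemma Sstar_succ (n : ℕ) (ω : Path) :
    Sstar (n + 1) ω = max (Sstar n ω) (X (n + 1) ω).natAbs := by
  unfold Sstar
  rw [Finset.range_add_one (n := n + 1), Finset.sup_insert, max_comm]

lemma Sstar_mono (ω : Path) : Monotone fun n => Sstar n ω :=
  monotone_nat_of_le_succ fun n => by rw [Sstar_succ]; exact le_max_left _ _

lemma natAbs_X_le_Sstar (n : ℕ) (ω : Path) : (X n ω).natAbs ≤ Sstar n ω :=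
  Finset.le_sup (f := fun k => (X k ω).natAbs) (Finset.self_mem_range_succ n)

lemma lastZeroBefore_succ (n : ℕ) (ω : Path) :
    lastZeroBefore (n + 1) ω = if X (n + 1) ω = 0 then n + 1 else lastZeroBefore n ω := by
  unfold lastZeroBefore
  rw [Finset.range_add_one (n := n + 1), Finset.filter_insert]
  split_ifs with h
  · rw [Finset.sup_insert]
    exact max_eq_left ((lastZeroBefore_le n ω).trans n.le_succ)
  · rfl

lemma lastZeroBefore_zero (ω : Path) : lastZeroBefore 0 ω = 0 :=
  Nat.le_zero.1 (lastZeroBefore_le 0 ω)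

lemma Rstar_zero (ω : Path) : Rstar 0 ω = Sstar 0 ω := by rw [Rstar, lastZeroBefore_zero]

lemma Rstar_succ (n : ℕ) (ω : Path) :
    Rstar (n + 1) ω = if X (n + 1) ω = 0 then Sstar (n + 1) ω else Rstar n ω := by
  unfold Rstar
  rw [lastZeroBefore_succ]
  split_ifs <;> rfl

lemma Rstar_le_Sstar (n : ℕ) (ω : Path) : Rstar n ω ≤ Sstar n ω :=
  Sstar_mono ω (lastZeroBefore_le n ω)

lemma Rstar_eq_Sstar {n : ℕ} {ω : Path} (h : X n ω = 0) : Rstar n ω = Sstar n ω := by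
  cases n with
  | zero => exact Rstar_zero ω
  | succ n => rw [Rstar_succ, if_pos h]

lemma zeroCount_succ (n : ℕ) (ω : Path) :
    zeroCount (n + 1) ω = zeroCount n ω + if X (n + 1) ω = 0 then 1 else 0 := by
  unfold zeroCount
  rw [Finset.range_add_one (n := n + 1), Finset.filter_insert]
  split_ifs with h
  · rw [Finset.card_insert_of_notMem (by simp)]
  · rfl

lemma zeroCount_zero (ω : Path) : zeroCount 0 ω = if X 0 ω = 0 then 1 else 0 := by
  simp only [zeroCount, zero_add, Finset.range_one, Finset.filter_singleton]
  split_ifs <;> rfl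

lemma zeroCount_mono (ω : Path) : Monotone fun n => zeroCount n ω :=
  monotone_nat_of_le_succ fun n => by rw [zeroCount_succ]; exact Nat.le_add_right _ _

/-! ### Reversing one step of a path -/

lemma X_succ_cases (n : ℕ) (ω : Path) :
    X (n + 1) ω = X n ω + 1 ∨ X (n + 1) ω = X n ω - 1 := by
  have h : |X (n + 1) ω - X n ω| = 1 := ω.2 n
  rcases (abs_eq zero_le_one).1 h with h | h <;> omega

/-- The path obtained by reversing the step from time `n` to time `n + 1`. -/
def flip (n : ℕ) (ω : Path) : Path :=
  ⟨fun k => if k ≤ n then X k ω else X k ω - 2 * (X (n + 1) ω - X n ω), fun k => by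
    have h : |X (k + 1) ω - X k ω| = 1 := ω.2 k
    beta_reduce
    rcases lt_trichotomy k n with hk | rfl | hk
    · rw [if_pos (by omega), if_pos (by omega), h]
    · rw [if_neg (by omega), if_pos le_rfl, ← abs_neg, ← h]
      congr 1; ring
    · rw [if_neg (by omega), if_neg (by omega), ← h]
      congr 1; ring⟩

lemma X_flip_of_le {k n : ℕ} (h : k ≤ n) (ω : Path) : X k (flip n ω) = X k ω := if_pos h

lemma X_succ_flip (n : ℕ) (ω : Path) : X (n + 1) (flip n ω) = 2 * X n ω - X (n + 1) ω := by
  have : X (n + 1) (flip n ω) = X (n + 1) ω - 2 * (X (n + 1) ω - X n ω) := if_neg (by omega)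
  rw [this]; ring

lemma DependsUpTo.flip {β : Type*} {n : ℕ} {f : Path → β} (hf : DependsUpTo n f) (ω : Path) :
    f (flip n ω) = f ω := hf _ _ fun _ hk => X_flip_of_le hk ω

/-- The law of a fair coin. -/
abbrev coinLaw : Measure Bool := (PMF.uniformOfFintype Bool).toMeasure

lemma coinLaw_singleton (b : Bool) : coinLaw {b} = 2⁻¹ := by
  rw [PMF.toMeasure_apply_singleton _ _ (measurableSet_singleton b)]
  simp

lemma map_not_coinLaw : coinLaw.map Bool.not = coinLaw := by
  refine Measure.ext_of_singleton fun b => ?_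
  rw [Measure.map_apply (measurable_of_countable _) (measurableSet_singleton b),
    coinLaw_singleton]
  have : Bool.not ⁻¹' {b} = {!b} := by ext c; cases b <;> cases c <;> simp
  rw [this, coinLaw_singleton]

lemma X_pathOfCoins (n : ℕ) (c : ℕ → Bool) :
    X n (pathOfCoins c) = ∑ i ∈ Finset.range n, coinStep (c i) := rfl

lemma coinStep_not (b : Bool) : coinStep (!b) = -coinStep b := by cases b <;> simp [coinStep]

lemma flip_pathOfCoins (n : ℕ) (c : ℕ → Bool) :
    flip n (pathOfCoins c) = pathOfCoins fun i => (if i = n then Bool.not else id) (c i) := by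
  refine Subtype.ext (funext fun k => ?_)
  change (if k ≤ n then X k (pathOfCoins c) else X k (pathOfCoins c) -
    2 * (X (n + 1) (pathOfCoins c) - X n (pathOfCoins c))) =
      ∑ i ∈ Finset.range k, coinStep ((if i = n then Bool.not else id) (c i))
  rw [X_pathOfCoins, X_pathOfCoins, X_pathOfCoins, Finset.sum_range_succ, add_sub_cancel_left]
  have key : ∀ i, coinStep ((if i = n then Bool.not else id) (c i)) =
      coinStep (c i) - if i = n then 2 * coinStep (c n) else 0 := by
    intro i
    by_cases h : i = n
    · subst h; simp only [if_true, coinStep_not]; ring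
    · simp [h]
  simp only [key, Finset.sum_sub_distrib, Finset.sum_ite_eq', Finset.mem_range]
  split_ifs <;> omega

/-- On coin sequences the map negates the coin number `n`, and a fair coin is invariant under
negation. This symmetry takes the place of the Markov property. -/
lemma measurePreserving_flip (n : ℕ) : MeasurePreserving (flip n) walkLaw walkLaw := by
  have hm : Measurable (flip n) := by
    refine Measurable.subtype_mk (measurable_pi_lambda _ fun k => ?_)
    by_cases hk : k ≤ n
    · simpa only [hk, if_true] using measurable_X k
    · simp only [hk, if_false]
      exact (measurable_X k).sub (measurable_const.mul ((measurable_X _).sub (measurable_X _)))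
  refine ⟨hm, ?_⟩
  have hf : ∀ i : ℕ, Measurable (if i = n then Bool.not else id) :=
    fun i => measurable_of_countable _
  rw [walkLaw, Measure.map_map hm measurable_pathOfCoins]
  have : flip n ∘ pathOfCoins =
      pathOfCoins ∘ fun c i => (if i = n then Bool.not else id) (c i) :=
    funext fun c => flip_pathOfCoins n c
  have hg : Measurable fun (c : ℕ → Bool) i => (if i = n then Bool.not else id) (c i) :=
    measurable_pi_lambda _ fun i => (hf i).comp (measurable_pi_apply i)
  rw [this, ← Measure.map_map measurable_pathOfCoins hg, Measure.infinitePi_map_pi (μ := fun _ => coinLaw) hf]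
  congr 2
  funext i
  split_ifs
  · exact map_not_coinLaw
  · exact Measure.map_id

/-! ### Integrals of functionals of finitely many steps -/

/-- Extend finitely many coin tosses to a sequence. -/
def extendCoins (s : Finset ℕ) (d : s → Bool) (i : ℕ) : Bool :=
  if h : i ∈ s then d ⟨i, h⟩ else false

lemma DependsUpTo.pathOfCoins_eq {β : Type*} {n : ℕ} {f : Path → β} (hf : DependsUpTo n f)
    {s : Finset ℕ} (hs : Finset.range n ⊆ s) (c : ℕ → Bool) :
    f (pathOfCoins (extendCoins s (s.restrict c))) = f (pathOfCoins c) := by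
  refine hf _ _ fun k hk => ?_
  rw [X_pathOfCoins, X_pathOfCoins]
  refine Finset.sum_congr rfl fun i hi => ?_
  have : i ∈ s := hs (Finset.mem_range.2 ((Finset.mem_range.1 hi).trans_le hk))
  simp [extendCoins, this]

/-- The starting point of a path is free, so `f` itself may be unbounded; along paths built from
coins it takes finitely many values. -/
lemma DependsUpTo.integrable {n : ℕ} {f : Path → ℝ} (hf : DependsUpTo n f) :
    Integrable f walkLaw := by
  have hm : Measurable f := hf.measurable
  rw [walkLaw, integrable_map_measure hm.aestronglyMeasurable measurable_pathOfCoins.aemeasurable]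
  obtain ⟨C, hC⟩ := (Set.finite_range fun d =>
    ‖f (pathOfCoins (extendCoins (Finset.range n) d))‖).bddAbove
  refine Integrable.of_bound (hm.comp measurable_pathOfCoins).aestronglyMeasurable C
    (ae_of_all _ fun c => ?_)
  rw [Function.comp_apply, ← hf.pathOfCoins_eq subset_rfl c]
  exact hC ⟨_, rfl⟩

lemma DependsUpTo.integral_eq_sum {n : ℕ} {f : Path → ℝ} (hf : DependsUpTo n f) {s : Finset ℕ}
    (hs : Finset.range n ⊆ s) :
    ∫ ω, f ω ∂walkLaw = ∑ d, (2⁻¹ : ℝ) ^ s.card * f (pathOfCoins (extendCoins s d)) := by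
  have hm : Measurable f := hf.measurable
  rw [walkLaw, integral_map measurable_pathOfCoins.aemeasurable hm.aestronglyMeasurable]
  have h1 := integral_restrict_infinitePi (μ := fun _ : ℕ => coinLaw) (s := s)
    (f := fun d => f (pathOfCoins (extendCoins s d)))
    (measurable_of_countable _).aestronglyMeasurable
  simp only [hf.pathOfCoins_eq hs] at h1
  rw [h1, integral_fintype Integrable.of_finite]
  refine Finset.sum_congr rfl fun d _ => ?_
  rw [smul_eq_mul, measureReal_def, Measure.pi_singleton]
  simp

/-- All the integrals are finite sums over the same coin sequences, so pointwise convergence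
suffices and no domination is needed. -/
lemma tendsto_setIntegral_of_dependsUpTo {n : ℕ} {Λ : Set Path}
    (hΛ : MeasurableSet[canonFiltration n] Λ) {f : ℕ → Path → ℝ} {f' : Path → ℝ}
    (hf : ∀ p, DependsUpTo n (f p)) (hf' : DependsUpTo n f')
    (h : ∀ ω, Tendsto (fun p => f p ω) atTop (𝓝 (f' ω))) :
    Tendsto (fun p => ∫ ω in Λ, f p ω ∂walkLaw) atTop (𝓝 (∫ ω in Λ, f' ω ∂walkLaw)) := by
  classical
  have hm := canonFiltration.le n Λ hΛ
  simp only [← integral_indicator hm]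
  rw [(hf'.indicator hΛ).integral_eq_sum subset_rfl]
  simp only [fun p => ((hf p).indicator hΛ).integral_eq_sum subset_rfl]
  refine tendsto_finsetSum _ fun d _ => Tendsto.const_mul _ ?_
  simp only [Set.indicator_apply]
  split_ifs
  · exact h _
  · exact tendsto_const_nhds

/-- One step of the walk, given the past up to time `n`. -/
lemma setIntegral_step {n : ℕ} {Λ : Set Path} (hΛ : MeasurableSet[canonFiltration n] Λ)
    {Y Y' : Path → ℝ} (hY' : DependsUpTo (n + 1) Y')
    (h : ∀ ω ∈ Λ, Y' ω + Y' (flip n ω) = 2 * Y ω) :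
    ∫ ω in Λ, Y' ω ∂walkLaw = ∫ ω in Λ, Y ω ∂walkLaw := by
  classical
  have hm := canonFiltration.le n Λ hΛ
  have hΛ' : MeasurableSet[canonFiltration (n + 1)] Λ := canonFiltration.mono n.le_succ Λ hΛ
  have hd := hY'.indicator hΛ'
  have hmp := measurePreserving_flip n
  have h1 : ∫ ω, Λ.indicator Y' (flip n ω) ∂walkLaw = ∫ ω, Λ.indicator Y' ω ∂walkLaw := by
    conv_rhs => rw [← hmp.map_eq]
    rw [integral_map hmp.measurable.aemeasurable]
    exact hd.measurable.aestronglyMeasurable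
  have hi : Integrable (fun ω => Λ.indicator Y' (flip n ω)) walkLaw :=
    hmp.integrable_comp_of_integrable hd.integrable
  have h2 := integral_add hd.integrable hi
  -- `Λ` belongs to `ℱ_n`, so `ω` and `flip n ω` lie in it together.
  have h3 : ∀ ω, Λ.indicator Y' ω + Λ.indicator Y' (flip n ω) = 2 * Λ.indicator Y ω := by
    intro ω
    have hmem : (flip n ω ∈ Λ) = (ω ∈ Λ) := (measurableSet_canonFiltration_iff.1 hΛ).flip ω
    simp only [Set.indicator_apply, hmem]
    split_ifs with hω
    · exact h ω hω
    · simp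
  simp only [h3, h1, integral_const_mul] at h2
  rw [← integral_indicator hm, ← integral_indicator hm]
  linarith

lemma ae_X_zero : ∀ᵐ ω ∂walkLaw, X 0 ω = 0 := by
  rw [walkLaw, ae_map_iff measurable_pathOfCoins.aemeasurable
    (p := fun ω => X 0 ω = 0) (measurable_X 0 (measurableSet_singleton 0))]
  exact ae_of_all _ fun c => by simp [X_pathOfCoins]

/-! ### The probability of avoiding zero -/

/-- The probability that the walk started from `y` does not visit `0` in `[0, q]`. -/
def survive : ℕ → ℕ → ℝ
  | _, 0 => 0
  | 0, _ + 1 => 1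
  | q + 1, y + 1 => (survive q y + survive q (y + 2)) / 2

@[simp] lemma survive_zero_right (q : ℕ) : survive q 0 = 0 := by cases q <;> rfl

@[simp] lemma survive_zero_succ (y : ℕ) : survive 0 (y + 1) = 1 := rfl

lemma survive_succ_succ (q y : ℕ) :
    survive (q + 1) (y + 1) = (survive q y + survive q (y + 2)) / 2 := rfl

lemma survive_nonneg (q y : ℕ) : 0 ≤ survive q y := by
  induction q generalizing y with
  | zero => cases y <;> simp
  | succ q ih =>
    cases y with
    | zero => simp
    | succ y => rw [survive_succ_succ]; linarith [ih y, ih (y + 2)]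

lemma survive_le_one (q y : ℕ) : survive q y ≤ 1 := by
  induction q generalizing y with
  | zero => cases y <;> simp
  | succ q ih =>
    cases y with
    | zero => simp
    | succ y => rw [survive_succ_succ]; linarith [ih y, ih (y + 2)]

lemma survive_succ_le (q y : ℕ) : survive (q + 1) y ≤ survive q y := by
  induction q generalizing y with
  | zero => cases y with
    | zero => simp
    | succ y => simpa using survive_le_one 1 (y + 1)
  | succ q ih =>
    cases y with
    | zero => simp
    | succ y => rw [survive_succ_succ (q + 1) y, survive_succ_succ q y]; linarith [ih y, ih (y + 2)]

lemma survive_antitone (y : ℕ) : Antitone fun q => survive q y :=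
  antitone_nat_of_succ_le fun q => survive_succ_le q y

/-- Monotonicity in `q` combined with the recurrence says that `survive q` is concave in the
starting point, so no increment exceeds the first one. -/
lemma survive_le_mul (q y : ℕ) : survive q y ≤ y * survive q 1 := by
  have hinc : ∀ y, survive q (y + 1) - survive q y ≤ survive q 1 := by
    intro y
    induction y with
    | zero => simp
    | succ y ih =>
      have h := survive_succ_le q (y + 1)
      rw [survive_succ_succ] at h
      linarith
  induction y with
  | zero => simp
  | succ y ih => push_cast; linarith [hinc y]

/-- Partial sums of a row of Pascal's triangle. -/
def rowSum (q : ℕ) (t : ℤ) : ℝ := ∑ j ∈ Finset.range t.toNat, (q.choose j : ℝ)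

lemma rowSum_succ (q : ℕ) (t : ℤ) : rowSum (q + 1) t = rowSum q t + rowSum q (t - 1) := by
  unfold rowSum
  rcases le_or_gt t 0 with ht | ht
  · rw [Int.toNat_of_nonpos ht, Int.toNat_of_nonpos (by omega)]; simp
  · obtain ⟨m, rfl⟩ : ∃ m : ℕ, t = m + 1 := ⟨(t - 1).toNat, by omega⟩
    have h1 : ((m : ℤ) + 1).toNat = m + 1 := by omega
    have h2 : ((m : ℤ) + 1 - 1).toNat = m := by omega
    rw [h1, h2, Finset.sum_range_succ', Finset.sum_range_succ' (fun j => (q.choose j : ℝ)) m]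
    simp only [Nat.choose_succ_succ, Nat.cast_add, Finset.sum_add_distrib, Nat.choose_zero_right]
    ring

/-- The reflection principle: avoiding `0` for `q` steps from `y` has the probability that the free
walk from `0` ends in `(-y, y]`. Both sides obey the same recurrence, by Pascal's rule. -/
lemma two_pow_mul_survive (q y : ℕ) :
    2 ^ q * survive q y =
      rowSum q (((q : ℤ) + y) / 2 + 1) - rowSum q (((q : ℤ) - y) / 2 + 1) := by
  induction q generalizing y with
  | zero =>
    cases y with
    | zero => simp
    | succ y =>
      have h1 : rowSum 0 ((((0 : ℕ) : ℤ) + (y + 1 : ℕ)) / 2 + 1) = 1 := by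
        obtain ⟨m, hm⟩ : ∃ m : ℕ, (((0 : ℕ) : ℤ) + (y + 1 : ℕ)) / 2 = m :=
          ⟨((((0 : ℕ) : ℤ) + (y + 1 : ℕ)) / 2).toNat, by omega⟩
        have h : ((m : ℤ) + 1).toNat = m + 1 := by omega
        rw [hm, rowSum, h, Finset.sum_range_succ']
        simp
      have h2 : rowSum 0 ((((0 : ℕ) : ℤ) - (y + 1 : ℕ)) / 2 + 1) = 0 := by
        rw [rowSum, Int.toNat_of_nonpos (by omega)]; simp
      rw [h1, h2]; simp
  | succ q ih =>
    cases y with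
    | zero => simp
    | succ y =>
      rw [survive_succ_succ, rowSum_succ, rowSum_succ]
      have h1 := ih y
      have h2 := ih (y + 2)
      have e1 : (((q + 1 : ℕ) : ℤ) + (y + 1 : ℕ)) / 2 + 1 = ((q : ℤ) + (y + 2 : ℕ)) / 2 + 1 := by
        push_cast; omega
      have e2 : (((q + 1 : ℕ) : ℤ) + (y + 1 : ℕ)) / 2 + 1 - 1 = ((q : ℤ) + y) / 2 + 1 := by
        push_cast; omega
      have e3 : (((q + 1 : ℕ) : ℤ) - (y + 1 : ℕ)) / 2 + 1 = ((q : ℤ) - y) / 2 + 1 := by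
        push_cast; omega
      have e4 : (((q + 1 : ℕ) : ℤ) - (y + 1 : ℕ)) / 2 + 1 - 1
          = ((q : ℤ) - (y + 2 : ℕ)) / 2 + 1 := by
        push_cast; omega
      rw [e2, e4, e1, e3, pow_succ]
      linarith

lemma two_pow_mul_survive_one (q : ℕ) : 2 ^ q * survive q 1 = q.choose ((q + 1) / 2) := by
  rw [two_pow_mul_survive]
  have h1 : (((q : ℤ) + (1 : ℕ)) / 2 + 1).toNat = (q + 1) / 2 + 1 := by omega
  have h2 : (((q : ℤ) - (1 : ℕ)) / 2 + 1).toNat = (q + 1) / 2 := by omega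
  rw [rowSum, rowSum, h1, h2, Finset.sum_range_succ]
  ring

/-- Ratio of neighbouring central binomial coefficients: there is equality for even `q`, and
`survive` does not change from `q` to `q + 1` when `q` is odd. This bound gives the slow variation
`s_{q+1}/s_q → 1` and drives the comparison argument for `confine`. -/
lemma le_survive_succ_one (q : ℕ) :
    ((q : ℝ) + 1) * survive q 1 ≤ ((q : ℝ) + 2) * survive (q + 1) 1 := by
  have h1 := two_pow_mul_survive_one q
  have h2 := two_pow_mul_survive_one (q + 1)
  have key : 2 * (q + 1) * q.choose ((q + 1) / 2) ≤
      (q + 2) * (q + 1).choose ((q + 1 + 1) / 2) := by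
    rcases Nat.even_or_odd' q with ⟨m, rfl | rfl⟩
    · have e1 : (2 * m + 1) / 2 = m := by omega
      have e2 : (2 * m + 1 + 1) / 2 = m + 1 := by omega
      rw [e1, e2]
      have := Nat.add_one_mul_choose_eq (2 * m) m
      nlinarith
    · have e1 : (2 * m + 1 + 1) / 2 = m + 1 := by omega
      have e2 : (2 * m + 1 + 1 + 1) / 2 = m + 1 := by omega
      rw [e1, e2, Nat.choose_succ_succ (2 * m + 1) m]
      have := Nat.choose_symm_half m
      rw [Nat.succ_eq_add_one]
      nlinarith
  have key' : 2 * ((q : ℝ) + 1) * (2 ^ q * survive q 1) ≤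
      (q + 2) * (2 ^ (q + 1) * survive (q + 1) 1) := by
    rw [h1, h2]; exact_mod_cast key
  rw [pow_succ] at key'
  have hp : (0 : ℝ) < 2 ^ q * 2 := by positivity
  refine le_of_mul_le_mul_left ?_ hp
  linarith

lemma inv_le_survive_one (q : ℕ) : 1 ≤ ((q : ℝ) + 1) * survive q 1 := by
  induction q with
  | zero => simp
  | succ q ih => have := le_survive_succ_one q; push_cast; linarith

lemma survive_one_pos (q : ℕ) : 0 < survive q 1 := by
  have h := inv_le_survive_one q
  by_contra hn
  have : ((q : ℝ) + 1) * survive q 1 ≤ 0 :=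
    mul_nonpos_of_nonneg_of_nonpos (by positivity) (not_lt.1 hn)
  linarith

lemma tendsto_survive_ratio :
    Tendsto (fun q => survive (q + 1) 1 / survive q 1) atTop (𝓝 1) := by
  have h : Tendsto (fun q : ℕ => 1 - 1 / ((q : ℝ) + 2)) atTop (𝓝 1) := by
    have := (tendsto_const_div_atTop_nhds_zero_nat (1 : ℝ)).comp (tendsto_add_atTop_nat 2)
    simpa using this.const_sub 1
  refine tendsto_of_tendsto_of_tendsto_of_le_of_le h tendsto_const_nhds (fun q => ?_) fun q => ?_
  · have hq := survive_one_pos q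
    have h2 : (0 : ℝ) < (q : ℝ) + 2 := by positivity
    rw [le_div_iff₀ hq]
    refine le_of_mul_le_mul_left ?_ h2
    have := le_survive_succ_one q
    field_simp
    linarith
  · exact div_le_one_of_le₀ (survive_succ_le q 1) (survive_one_pos q).le

lemma tendsto_survive_ratio_add (n : ℕ) :
    Tendsto (fun q => survive (q + n) 1 / survive q 1) atTop (𝓝 1) := by
  induction n with
  | zero => simp [div_self (survive_one_pos _).ne']
  | succ n ih =>
    have := (tendsto_survive_ratio.comp (tendsto_add_atTop_nat n)).mul ih
    simp only [mul_one] at this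
    refine this.congr fun q => ?_
    have h1 := (survive_one_pos q).ne'
    have h2 := (survive_one_pos (q + n)).ne'
    simp only [Function.comp_apply]
    rw [← add_assoc]
    field_simp

lemma tendsto_survive_ratio_inv :
    Tendsto (fun q => survive q 1 / survive (q + 1) 1) atTop (𝓝 1) := by
  simpa using tendsto_survive_ratio.inv₀ one_ne_zero

/-- Since `s_{q+1}/s_q → 1`, the recurrence passes to the limit and the limit is affine in `y`. It
is a second-order recurrence, hence the induction on two consecutive values. -/
lemma tendsto_survive_div (y : ℕ) :
    Tendsto (fun q => survive q y / survive q 1) atTop (𝓝 y) := by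
  suffices h : Tendsto (fun q => survive q y / survive q 1) atTop (𝓝 y) ∧
      Tendsto (fun q => survive q (y + 1) / survive q 1) atTop (𝓝 (y + 1 : ℕ)) from h.1
  induction y with
  | zero =>
    constructor
    · simp
    · simp [div_self (survive_one_pos _).ne']
  | succ y ih =>
    refine ⟨ih.2, ?_⟩
    have h1 := ((ih.2.comp (tendsto_add_atTop_nat 1)).mul tendsto_survive_ratio).const_mul 2
    have h2 := h1.sub ih.1
    have e : (2 * (((y + 1 : ℕ) : ℝ) * 1) - y) = ((y + 1 + 1 : ℕ) : ℝ) := by push_cast; ring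
    rw [e] at h2
    refine h2.congr fun q => ?_
    have h3 := (survive_one_pos q).ne'
    have h4 := (survive_one_pos (q + 1)).ne'
    simp only [Function.comp_apply]
    rw [survive_succ_succ q y]
    field_simp
    ring

/-! ### The probability of staying confined up to the last zero -/

/-- The probability that the walk started from `±x`, `x ≤ k + 1`, does not visit `0` in `[0, q]`
after having left `[-k, k]`. -/
def confine (k : ℕ) : ℕ → ℕ → ℝ
  | 0, _ => 1
  | q + 1, x =>
    if k < x then survive (q + 1) x
    else if x = 0 then confine k q 1
    else (confine k q (x - 1) + confine k q (x + 1)) / 2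

@[simp] lemma confine_zero (k x : ℕ) : confine k 0 x = 1 := rfl

lemma confine_of_lt {k x : ℕ} (h : k < x) (q : ℕ) : confine k q x = survive q x := by
  cases q with
  | zero => obtain ⟨x, rfl⟩ := Nat.exists_eq_succ_of_ne_zero (Nat.ne_zero_of_lt h); simp
  | succ q => rw [confine, if_pos h]

lemma confine_succ_zero (k q : ℕ) : confine k (q + 1) 0 = confine k q 1 := by
  rw [confine, if_neg (by omega), if_pos rfl]

lemma confine_succ_succ {k x : ℕ} (h : x < k) (q : ℕ) :
    confine k (q + 1) (x + 1) = (confine k q x + confine k q (x + 2)) / 2 := by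
  rw [confine, if_neg (by omega), if_neg (by omega)]; rfl

lemma confine_nonneg (k q x : ℕ) : 0 ≤ confine k q x := by
  induction q generalizing x with
  | zero => simp
  | succ q ih =>
    rw [confine]
    split_ifs
    · exact survive_nonneg _ _
    · exact ih 1
    · linarith [ih (x - 1), ih (x + 1)]

lemma confine_le_one (k q x : ℕ) : confine k q x ≤ 1 := by
  induction q generalizing x with
  | zero => simp
  | succ q ih =>
    rw [confine]
    split_ifs
    · exact survive_le_one _ _
    · exact ih 1
    · linarith [ih (x - 1), ih (x + 1)]

/-- Comparison with a supersolution. The function `ρ(x) = 2(k+1)² - x²` loses exactly `1` when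
averaged over the neighbours of `x`, which pays for replacing `s_q` by `s_{q+1}` as soon as `ρ ≤ q +
2`. For smaller `q` the bound `1 ≤ (q+1) s_q` is enough, and the factor `3` makes the two ranges of
`q` cover everything. -/
lemma confine_le_aux (k q x : ℕ) (hx : x ≤ k + 1) :
    confine k q x ≤ 3 * (2 * ((k : ℝ) + 1) ^ 2 - (x : ℝ) ^ 2) * survive q 1 := by
  have hx2 : ∀ x : ℕ, x ≤ k + 1 → (x : ℝ) ^ 2 ≤ ((k : ℝ) + 1) ^ 2 := fun x hx =>
    pow_le_pow_left₀ (by positivity) (by exact_mod_cast hx) 2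
  have hk : (1 : ℝ) ≤ (k : ℝ) + 1 := by linarith [(Nat.cast_nonneg k : (0 : ℝ) ≤ k)]
  have hk2 : (1 : ℝ) ≤ ((k : ℝ) + 1) ^ 2 := one_le_pow₀ hk
  have trivial_bound : ∀ q x : ℕ, x ≤ k + 1 → (q : ℝ) + 1 ≤ 3 * ((k : ℝ) + 1) ^ 2 →
      confine k q x ≤ 3 * (2 * ((k : ℝ) + 1) ^ 2 - (x : ℝ) ^ 2) * survive q 1 := by
    intro q x hx hq
    refine (confine_le_one k q x).trans ((inv_le_survive_one q).trans ?_)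
    exact mul_le_mul_of_nonneg_right (by linarith [hx2 x hx]) (survive_nonneg q 1)
  induction q generalizing x with
  | zero => exact trivial_bound 0 x hx (by push_cast; linarith)
  | succ q ih =>
    by_cases hq : ((q + 1 : ℕ) : ℝ) + 1 ≤ 3 * ((k : ℝ) + 1) ^ 2
    · exact trivial_bound _ x hx hq
    · push_cast at hq
      have hstep := le_survive_succ_one q
      have hle := survive_succ_le q 1
      have hpos := survive_nonneg (q + 1) 1
      -- the supersolution inequality
      have hsup : ∀ x : ℕ, x ≤ k + 1 → (2 * ((k : ℝ) + 1) ^ 2 - (x : ℝ) ^ 2 - 1) * survive q 1 ≤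
          (2 * ((k : ℝ) + 1) ^ 2 - (x : ℝ) ^ 2) * survive (q + 1) 1 := by
        intro x hx
        set ρ := 2 * ((k : ℝ) + 1) ^ 2 - (x : ℝ) ^ 2 with hρ
        have h1 : ρ ≤ (q : ℝ) + 2 := by
          have : (0 : ℝ) ≤ (x : ℝ) ^ 2 := by positivity
          linarith
        have h2 : 0 ≤ ρ := by have := hx2 x hx; linarith
        have h3 : ((q : ℝ) + 2) * (survive q 1 - survive (q + 1) 1) ≤ survive q 1 := by linarith
        have h4 := mul_le_mul_of_nonneg_right h1 (sub_nonneg.2 hle)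
        linarith
      rcases Nat.lt_or_ge k x with hkx | hkx
      · have : x = k + 1 := by omega
        subst this
        rw [confine_of_lt hkx]
        refine (survive_le_mul _ _).trans (mul_le_mul_of_nonneg_right ?_ hpos)
        push_cast
        nlinarith
      · cases x with
        | zero =>
          rw [confine_succ_zero]
          have h1 := ih 1 (by omega)
          have h2 := hsup 0 (by omega)
          push_cast at h1 h2 ⊢
          linarith
        | succ x =>
          rw [confine_succ_succ (by omega)]
          have h1 := ih x (by omega)
          have h2 := ih (x + 2) (by omega)
          have h3 := hsup (x + 1) hx
          push_cast at h1 h2 h3 ⊢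
          linarith

lemma confine_le (k q x : ℕ) (hx : x ≤ k + 1) :
    confine k q x ≤ 6 * ((k : ℝ) + 1) ^ 2 * survive q 1 := by
  refine (confine_le_aux k q x hx).trans (mul_le_mul_of_nonneg_right ?_ (survive_nonneg q 1))
  linarith [sq_nonneg (x : ℝ)]

lemma limsup_le_average {a b c d : ℕ → ℝ} {C : ℝ} (ha : ∀ q, 0 ≤ a q)
    (hb : ∀ q, b q ≤ C) (hc : ∀ q, c q ≤ C) (hd : Tendsto d atTop (𝓝 0))
    (h : ∀ q, a (q + 1) ≤ (b q + c q) / 2 + d q) :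
    limsup a atTop ≤ (limsup b atTop + limsup c atTop) / 2 := by
  refine le_of_forall_pos_le_add fun ε hε => ?_
  have hb' := eventually_lt_of_limsup_lt (lt_add_of_pos_right (limsup b atTop) (half_pos hε))
    (isBoundedUnder_of ⟨C, hb⟩)
  have hc' := eventually_lt_of_limsup_lt (lt_add_of_pos_right (limsup c atTop) (half_pos hε))
    (isBoundedUnder_of ⟨C, hc⟩)
  have hd' := hd.eventually_lt_const (half_pos hε)
  refine limsup_le_of_le
    (isBoundedUnder_of ⟨0, ha⟩ : IsBoundedUnder (· ≥ ·) atTop a).isCoboundedUnder_le ?_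
  have : ∀ᶠ q in atTop, a (q + 1) ≤ (limsup b atTop + limsup c atTop) / 2 + ε := by
    filter_upwards [hb', hc', hd'] with q h1 h2 h3
    linarith [h q]
  have h' : ∀ᶠ q in map (· + 1) atTop, a q ≤ (limsup b atTop + limsup c atTop) / 2 + ε := this
  rwa [map_add_atTop_eq_nat] at h'

/-- A maximum principle for the limsup of the error `e x`: it is convex in `x`, does not exceed its
neighbour at the reflecting end `x = 0`, and vanishes at `x = k + 1`. -/
lemma tendsto_confine_div {k x : ℕ} (hx : x ≤ k + 1) :
    Tendsto (fun q => confine k q x / survive q 1) atTop (𝓝 (k + 1)) := by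
  set ρ : ℕ → ℕ → ℝ := fun x q => confine k q x / survive q 1 with hρ
  set C : ℝ := 6 * ((k : ℝ) + 1) ^ 2 with hC
  have hup : ∀ x ≤ k + 1, ∀ q, ρ x q ≤ C := fun x hx q =>
    div_le_of_le_mul₀ (survive_nonneg q 1) (by positivity) (confine_le k q x hx)
  have hlow : ∀ x q, 0 ≤ ρ x q := fun x q =>
    div_nonneg (confine_nonneg k q x) (survive_nonneg q 1)
  set e : ℕ → ℕ → ℝ := fun x q => |ρ x q - (k + 1)| with he
  have he0 : ∀ x q, 0 ≤ e x q := fun x q => abs_nonneg _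
  have heC : ∀ x ≤ k + 1, ∀ q, e x q ≤ C + (k + 1) := fun x hx q => by
    have := hup x hx q
    have := hlow x q
    exact abs_le.2 ⟨by linarith [(by positivity : (0 : ℝ) ≤ C)], by
      linarith [(Nat.cast_nonneg k : (0 : ℝ) ≤ k)]⟩
  -- The recurrence brings values at time `q` over the normalisation at time `q + 1`; correcting
  -- this costs at most `C * δ q`, which tends to `0`.
  set δ : ℕ → ℝ := fun q => survive q 1 / survive (q + 1) 1 - 1 with hδ
  have hδ0 : Tendsto δ atTop (𝓝 0) := by simpa using tendsto_survive_ratio_inv.sub_const 1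
  have hCδ : Tendsto (fun q => C * δ q) atTop (𝓝 0) := by simpa using hδ0.const_mul C
  have hδnn : ∀ q, 0 ≤ δ q := fun q =>
    sub_nonneg.2 ((one_le_div (survive_one_pos _)).2 (survive_succ_le q 1))
  have hdiv : ∀ x q, confine k q x / survive (q + 1) 1 = ρ x q + ρ x q * δ q := fun x q => by
    have h3 := (survive_one_pos q).ne'
    have h4 := (survive_one_pos (q + 1)).ne'
    simp only [hρ, hδ]
    field_simp
    ring
  have hdiv' : ∀ x ≤ k + 1, ∀ q,
      |confine k q x / survive (q + 1) 1 - (k + 1)| ≤ e x q + C * δ q := fun x hx q => by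
    rw [hdiv, add_sub_right_comm]
    refine (abs_add_le _ _).trans (add_le_add le_rfl ?_)
    rw [abs_of_nonneg (mul_nonneg (hlow x q) (hδnn q))]
    exact mul_le_mul_of_nonneg_right (hup x hx q) (hδnn q)
  have step0 : ∀ q, e 0 (q + 1) ≤ (e 1 q + e 1 q) / 2 + C * δ q := fun q => by
    have := hdiv' 1 (by omega) q
    rw [← confine_succ_zero] at this
    linarith
  have step1 : ∀ x < k, ∀ q, e (x + 1) (q + 1) ≤ (e x q + e (x + 2) q) / 2 + C * δ q :=
    fun x hx q => by
      have h1 := abs_le.1 (hdiv' x (by omega) q)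
      have h2 := abs_le.1 (hdiv' (x + 2) (by omega) q)
      have e1 : ρ (x + 1) (q + 1) = (confine k q x / survive (q + 1) 1 +
          confine k q (x + 2) / survive (q + 1) 1) / 2 := by
        simp only [hρ]
        rw [confine_succ_succ hx]
        ring
      refine abs_le.2 ⟨?_, ?_⟩ <;> rw [e1] <;> linarith [h1.1, h1.2, h2.1, h2.2]
  have hend : Tendsto (e (k + 1)) atTop (𝓝 0) := by
    have := tendsto_survive_div (k + 1)
    push_cast at this
    have h2 := (this.sub_const ((k : ℝ) + 1)).abs
    rw [sub_self, abs_zero] at h2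
    refine h2.congr fun q => ?_
    simp only [he, hρ, confine_of_lt (Nat.lt_succ_self k)]
  -- Convexity propagates the inequality at `0` to every `x`, so the errors are nondecreasing up to
  -- the boundary point `k + 1`.
  have hmono : ∀ x ≤ k, limsup (e x) atTop ≤ limsup (e (x + 1)) atTop := by
    intro x
    induction x with
    | zero =>
      intro _
      have := limsup_le_average (he0 0) (heC 1 (by omega)) (heC 1 (by omega)) hCδ step0
      rw [zero_add]
      linarith
    | succ x ih =>
      intro hx
      have := limsup_le_average (he0 (x + 1)) (heC x (by omega)) (heC (x + 2) (by omega)) hCδ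
        (step1 x hx)
      have := ih (by omega)
      rw [add_assoc]
      norm_num
      linarith
  have hle : ∀ j ≤ k + 1, limsup (e (k + 1 - j)) atTop ≤ 0 := by
    intro j
    induction j with
    | zero => intro _; exact hend.limsup_eq.le
    | succ j ih =>
      intro hj
      refine (hmono _ (by omega)).trans ?_
      have : k + 1 - (j + 1) + 1 = k + 1 - j := by omega
      rw [this]
      exact ih (by omega)
  have hx0 : limsup (e x) atTop ≤ 0 := by
    have := hle (k + 1 - x) (by omega)
    rwa [Nat.sub_sub_self hx] at this
  have he_tendsto : Tendsto (e x) atTop (𝓝 0) :=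
    tendsto_of_le_liminf_of_limsup_le
      (le_liminf_of_le (isBoundedUnder_of ⟨_, heC x hx⟩ :
        IsBoundedUnder (· ≤ ·) atTop (e x)).isCoboundedUnder_ge
        (Eventually.of_forall (he0 x))) hx0
      (isBoundedUnder_of ⟨_, heC x hx⟩) (isBoundedUnder_of ⟨0, he0 x⟩)
  have := (tendsto_zero_iff_abs_tendsto_zero _).2 he_tendsto
  simpa using this.add_const ((k : ℝ) + 1)

/-- A limit `L > 0` would give `y L = lim survive q y ≤ 1` for every `y`. -/
lemma tendsto_survive_zero : Tendsto (fun q => survive q 1) atTop (𝓝 0) := by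
  have hbdd : BddBelow (Set.range fun q => survive q 1) :=
    ⟨0, by rintro _ ⟨q, rfl⟩; exact survive_nonneg q 1⟩
  have hL := tendsto_atTop_ciInf (survive_antitone 1) hbdd
  set L := ⨅ q, survive q 1
  have hle : ∀ y : ℕ, y * L ≤ 1 := fun y => by
    refine le_of_tendsto ((tendsto_survive_div y).mul hL) (Eventually.of_forall fun q => ?_)
    rw [div_mul_cancel₀ _ (survive_one_pos q).ne']
    exact survive_le_one q y
  have hL0 : 0 ≤ L := le_ciInf fun q => survive_nonneg q 1
  rcases hL0.eq_or_lt with h | h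
  · rwa [← h] at hL
  · obtain ⟨y, hy⟩ := exists_nat_gt (1 / L)
    have := (div_lt_iff₀ h).1 hy
    linarith [hle y]

lemma tendsto_confine_zero (k : ℕ) : Tendsto (fun q => confine k q 0) atTop (𝓝 0) := by
  have h := (tendsto_confine_div (k := k) (Nat.zero_le _)).mul tendsto_survive_zero
  rw [mul_zero] at h
  exact h.congr fun q => div_mul_cancel₀ _ (survive_one_pos q).ne'

/-! ### The law of the maximum at the last zero -/

/-- The conditional probability of `{S*_{g_{n+q}} ≤ k}` given that `|X_n| = x`, `S*_n = s` and
`S*_{g_n} = r`. -/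
def confineFrom (k q x s r : ℕ) : ℝ :=
  if r ≤ k then if s ≤ k then confine k q x else survive q x else 0

lemma natAbs_X_succ (n : ℕ) (ω : Path) :
    (X n ω = 0 ∧ (X (n + 1) ω).natAbs = 1 ∧ (X (n + 1) (flip n ω)).natAbs = 1) ∨
    ∃ y, (X n ω).natAbs = y + 1 ∧
      (((X (n + 1) ω).natAbs = y ∧ (X (n + 1) (flip n ω)).natAbs = y + 2) ∨
       ((X (n + 1) ω).natAbs = y + 2 ∧ (X (n + 1) (flip n ω)).natAbs = y)) := by
  rw [X_succ_flip]
  by_cases h0 : X n ω = 0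
  · left
    rcases X_succ_cases n ω with h | h <;> rw [h, h0] <;> simp
  · right
    refine ⟨(X n ω).natAbs - 1, by omega, ?_⟩
    rcases X_succ_cases n ω with h | h <;> rw [h] <;> omega

/-- Two boundary effects have to match. On leaving `[-k, k]`, `confine` agrees with `survive`; on
returning to `0` after an exit, `S*_{g}` jumps above `k`, and both sides of `key` are `0`. -/
lemma confineFrom_step (k q n : ℕ) (ω : Path) :
    confineFrom k q (X (n + 1) ω).natAbs (Sstar (n + 1) ω) (Rstar (n + 1) ω) +
      confineFrom k q (X (n + 1) (flip n ω)).natAbs (Sstar (n + 1) (flip n ω))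
        (Rstar (n + 1) (flip n ω)) =
      2 * confineFrom k (q + 1) (X n ω).natAbs (Sstar n ω) (Rstar n ω) := by
  have hxs := natAbs_X_le_Sstar n ω
  have hrs := Rstar_le_Sstar n ω
  have hr0 := Rstar_eq_Sstar (n := n) (ω := ω)
  rw [Rstar_succ, Rstar_succ, Sstar_succ, Sstar_succ, (dependsUpTo_Sstar n).flip,
    (dependsUpTo_Rstar n).flip]
  simp only [← Int.natAbs_eq_zero (a := X n ω), ← Int.natAbs_eq_zero (a := X (n + 1) ω),
    ← Int.natAbs_eq_zero (a := X (n + 1) (flip n ω))] at *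
  have hc := natAbs_X_succ n ω
  rw [← Int.natAbs_eq_zero] at hc
  generalize (X n ω).natAbs = x at *
  generalize (X (n + 1) ω).natAbs = x' at *
  generalize (X (n + 1) (flip n ω)).natAbs = x'' at *
  generalize Sstar n ω = s at *
  generalize Rstar n ω = r at *
  -- the value at a state one step later
  have key : ∀ z, z ≤ s + 1 → confineFrom k q z (max s z) (if z = 0 then max s z else r) =
      if r ≤ k then if s ≤ k then confine k q z else survive q z else 0 := by
    intro z hz
    unfold confineFrom
    by_cases hz0 : z = 0
    · subst hz0
      simp only [if_true, Nat.max_zero, survive_zero_right]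
      by_cases hsk : s ≤ k
      · rw [if_pos hsk, if_pos (hrs.trans hsk)]
      · simp [hsk]
    · rw [if_neg hz0]
      by_cases hsk : s ≤ k
      · by_cases hzk : z ≤ k
        · rw [if_pos (max_le hsk hzk), if_pos hsk]
        · have hm : ¬ max s z ≤ k := fun h => hzk ((le_max_right _ _).trans h)
          rw [if_neg hm, if_pos hsk, confine_of_lt (not_le.1 hzk)]
      · have hm : ¬ max s z ≤ k := fun h => hsk ((le_max_left _ _).trans h)
        rw [if_neg hm, if_neg hsk]
  have hz : x' ≤ s + 1 ∧ x'' ≤ s + 1 := by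
    rcases hc with h | ⟨y, h⟩ <;> omega
  rw [key x' hz.1, key x'' hz.2]
  unfold confineFrom
  by_cases hrk : r ≤ k
  · simp only [if_pos hrk]
    by_cases hsk : s ≤ k
    · simp only [if_pos hsk]
      rcases hc with ⟨rfl, rfl, rfl⟩ | ⟨y, rfl, ⟨rfl, rfl⟩ | ⟨rfl, rfl⟩⟩
      · rw [confine_succ_zero]; ring
      · rw [confine_succ_succ (by omega)]; ring
      · rw [confine_succ_succ (by omega)]; ring
    · simp only [if_neg hsk]
      rcases hc with ⟨rfl, rfl, rfl⟩ | ⟨y, rfl, ⟨rfl, rfl⟩ | ⟨rfl, rfl⟩⟩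
      · exact absurd (hr0 rfl ▸ hrk) hsk
      · rw [survive_succ_succ]; ring
      · rw [survive_succ_succ]; ring
  · simp [if_neg hrk]

lemma confineFrom_zero (k n : ℕ) (ω : Path) :
    confineFrom k 0 (X n ω).natAbs (Sstar n ω) (Rstar n ω) = if Rstar n ω ≤ k then 1 else 0 := by
  unfold confineFrom
  by_cases hr : Rstar n ω ≤ k
  · rw [if_pos hr, if_pos hr]
    by_cases hs : Sstar n ω ≤ k
    · rw [if_pos hs, confine_zero]
    · rw [if_neg hs]
      have hx : X n ω ≠ 0 := fun h => hs (Rstar_eq_Sstar h ▸ hr)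
      obtain ⟨y, hy⟩ := Nat.exists_eq_succ_of_ne_zero (Int.natAbs_ne_zero.2 hx)
      rw [hy, survive_zero_succ]
  · rw [if_neg hr, if_neg hr]

lemma dependsUpTo_confineFrom (k q n : ℕ) : DependsUpTo n fun ω =>
    confineFrom k q (X n ω).natAbs (Sstar n ω) (Rstar n ω) := fun ω ω' h => by
  simp only [dependsUpTo_X le_rfl ω ω' h, dependsUpTo_Sstar n ω ω' h, dependsUpTo_Rstar n ω ω' h]

/-- The Markov property in integrated form: `Λ` also lies in `ℱ_{n+1}`, so one unit of horizon can
be traded for one unit of time until the horizon is `0`. -/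
lemma setIntegral_confineFrom {n : ℕ} {Λ : Set Path} (hΛ : MeasurableSet[canonFiltration n] Λ)
    (k q : ℕ) :
    ∫ ω in Λ, confineFrom k q (X n ω).natAbs (Sstar n ω) (Rstar n ω) ∂walkLaw =
      walkLaw.real (Λ ∩ {ω | Rstar (n + q) ω ≤ k}) := by
  induction q generalizing n with
  | zero =>
    simp only [confineFrom_zero, add_zero]
    have hm : MeasurableSet {ω | Rstar n ω ≤ k} :=
      (dependsUpTo_Rstar n).measurable (Set.to_countable {r | r ≤ k}).measurableSet
    have : (fun ω => if Rstar n ω ≤ k then (1 : ℝ) else 0) =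
        {ω | Rstar n ω ≤ k}.indicator 1 := by
      ext ω; simp [Set.indicator_apply]
    rw [this, integral_indicator_one hm, measureReal_restrict_apply hm, Set.inter_comm]
  | succ q ih =>
    rw [← setIntegral_step hΛ (dependsUpTo_confineFrom k q (n + 1))
      fun ω _ => confineFrom_step k q n ω, ih (canonFiltration.mono n.le_succ Λ hΛ)]
    have : n + (q + 1) = n + 1 + q := by ring
    rw [this]

lemma measureReal_Rstar_le (k p : ℕ) : walkLaw.real {ω | Rstar p ω ≤ k} = confine k p 0 := by
  have h := setIntegral_confineFrom (n := 0) (Λ := Set.univ) MeasurableSet.univ k p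
  rw [Set.univ_inter, zero_add, setIntegral_univ] at h
  rw [← h]
  have : (fun ω => confineFrom k p (X 0 ω).natAbs (Sstar 0 ω) (Rstar 0 ω)) =ᵐ[walkLaw]
      fun _ => confine k p 0 := by
    filter_upwards [ae_X_zero] with ω hω
    simp [Rstar_zero, Sstar_zero, hω, confineFrom]
  rw [integral_congr_ae this]
  simp

lemma tendsto_measureReal_Rstar_le (k : ℕ) :
    Tendsto (fun p => walkLaw.real {ω | Rstar p ω ≤ k}) atTop (𝓝 0) := by
  simpa only [measureReal_Rstar_le] using tendsto_confine_zero k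

/-! ### The penalisation limit -/

/-- The limit of `P(S*_{g_p} ≤ k | ℱ_n) / P_1(T_0 > p)` as `p → ∞`. -/
def confineLimit (k n : ℕ) (ω : Path) : ℝ :=
  if Rstar n ω ≤ k then if Sstar n ω ≤ k then (k : ℝ) + 1 else |(X n ω : ℝ)| else 0

/-- The limit of `P(S*_{g_p} = k | ℱ_n) / P_1(T_0 > p)` as `p → ∞`. -/
def weight (k n : ℕ) (ω : Path) : ℝ :=
  (if k = Rstar n ω then |(X n ω : ℝ)| else 0)
    + (if k = Sstar n ω then (Sstar n ω : ℝ) - |(X n ω : ℝ)| else 0)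
    + if Sstar n ω ≤ k then 1 else 0

lemma abs_X_eq (n : ℕ) (ω : Path) : |(X n ω : ℝ)| = ((X n ω).natAbs : ℝ) := by
  rw [Nat.cast_natAbs, Int.cast_abs]

lemma abs_X_le_Sstar (n : ℕ) (ω : Path) : |(X n ω : ℝ)| ≤ Sstar n ω := by
  rw [abs_X_eq]; exact_mod_cast natAbs_X_le_Sstar n ω

lemma dependsUpTo_abs_X (n : ℕ) : DependsUpTo n fun ω => |(X n ω : ℝ)| :=
  (dependsUpTo_X le_rfl).comp fun x : ℤ => |(x : ℝ)|

lemma dependsUpTo_confineLimit (k n : ℕ) : DependsUpTo n (confineLimit k n) := fun ω ω' h => by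
  simp only [confineLimit, dependsUpTo_X le_rfl ω ω' h, dependsUpTo_Sstar n ω ω' h,
    dependsUpTo_Rstar n ω ω' h]

lemma dependsUpTo_weight (k n : ℕ) : DependsUpTo n (weight k n) := fun ω ω' h => by
  simp only [weight, dependsUpTo_X le_rfl ω ω' h, dependsUpTo_Sstar n ω ω' h,
    dependsUpTo_Rstar n ω ω' h]

lemma dependsUpTo_Mstar (φ : ℕ → ℝ) (n : ℕ) : DependsUpTo n (Mstar φ n) := fun ω ω' h => by
  change φ (Rstar n ω) * |(X n ω : ℝ)| + φ (Sstar n ω) * ((Sstar n ω : ℝ) - |(X n ω : ℝ)|)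
    + tailSum φ (Sstar n ω) = φ (Rstar n ω') * |(X n ω' : ℝ)|
    + φ (Sstar n ω') * ((Sstar n ω' : ℝ) - |(X n ω' : ℝ)|) + tailSum φ (Sstar n ω')
  simp only [dependsUpTo_X le_rfl ω ω' h, dependsUpTo_Sstar n ω ω' h,
    dependsUpTo_Rstar n ω ω' h]

lemma weight_zero (n : ℕ) (ω : Path) : weight 0 n ω = confineLimit 0 n ω := by
  have h1 := Rstar_le_Sstar n ω
  have h2 := abs_X_le_Sstar n ω
  unfold weight confineLimit
  by_cases hs : Sstar n ω = 0
  · have hr : Rstar n ω = 0 := by omega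
    simp [hs, hr]
  · simp [hs, Ne.symm hs, eq_comm]

/-- With `weight_zero`, this turns limits for `{S*_{g_p} ≤ k}` into limits for `{S*_{g_p} = k}`. -/
lemma weight_succ (k n : ℕ) (ω : Path) :
    weight (k + 1) n ω = confineLimit (k + 1) n ω - confineLimit k n ω := by
  have h1 := Rstar_le_Sstar n ω
  unfold weight confineLimit
  generalize Rstar n ω = r at *
  generalize Sstar n ω = s at *
  rcases Nat.lt_trichotomy (k + 1) r with hr | hr | hr
  · simp [show ¬ k + 1 = r by omega, show ¬ k + 1 = s by omega, show ¬ s ≤ k + 1 by omega,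
      show ¬ r ≤ k + 1 by omega, show ¬ r ≤ k by omega]
  · subst hr
    rcases h1.lt_or_eq with hs | rfl
    · simp [show ¬ k + 1 = s by omega, show ¬ s ≤ k + 1 by omega]
    · simp
  · rcases Nat.lt_trichotomy (k + 1) s with hs | rfl | hs
    · simp [show ¬ k + 1 = r by omega, show ¬ k + 1 = s by omega, show ¬ s ≤ k + 1 by omega,
        show ¬ s ≤ k by omega, show r ≤ k + 1 by omega, show r ≤ k by omega]
    · simp [show ¬ k + 1 = r by omega, show r ≤ k + 1 by omega, show r ≤ k by omega]
      ring
    · simp [show ¬ k + 1 = r by omega, show ¬ k + 1 = s by omega, show s ≤ k + 1 by omega,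
        show s ≤ k by omega, show r ≤ k + 1 by omega, show r ≤ k by omega]

lemma weight_nonneg (k n : ℕ) (ω : Path) : 0 ≤ weight k n ω := by
  have h2 := abs_X_le_Sstar n ω
  have h3 := abs_nonneg (X n ω : ℝ)
  unfold weight
  split_ifs <;> linarith

lemma weight_le (k n : ℕ) (ω : Path) : weight k n ω ≤ Sstar n ω + k + 1 := by
  have h2 := abs_X_le_Sstar n ω
  have h3 := abs_nonneg (X n ω : ℝ)
  have h4 : (0 : ℝ) ≤ k := Nat.cast_nonneg k
  unfold weight
  split_ifs <;> linarith

lemma hasSum_weight {φ : ℕ → ℝ} (hφ : Summable φ) (n : ℕ) (ω : Path) :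
    HasSum (fun k => φ k * weight k n ω) (Mstar φ n ω) := by
  have e : (fun k => φ k * weight k n ω) = fun k =>
      (if k = Rstar n ω then φ (Rstar n ω) * |(X n ω : ℝ)| else 0)
      + (if k = Sstar n ω then φ (Sstar n ω) * ((Sstar n ω : ℝ) - |(X n ω : ℝ)|) else 0)
      + if Sstar n ω ≤ k then φ k else 0 := by
    funext k
    unfold weight
    rw [mul_add, mul_add]
    congr 1
    · congr 1
      · split_ifs with h
        · rw [h]
        · simp
      · split_ifs with h
        · rw [h]
        · simp
    · split_ifs <;> simp
  rw [e]
  refine ((hasSum_ite_eq (Rstar n ω) _).add (hasSum_ite_eq (Sstar n ω) _)).add ?_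
  have h1 : HasSum (fun k => φ (Sstar n ω + k)) (tailSum φ (Sstar n ω)) := by
    refine Summable.hasSum ?_
    simpa only [add_comm] using (summable_nat_add_iff (Sstar n ω)).2 hφ
  rw [← (add_right_injective (Sstar n ω)).hasSum_iff]
  · refine h1.congr_fun fun k => ?_
    simp
  · intro k hk
    rw [if_neg]
    exact fun h => hk ⟨k - Sstar n ω, by simp [h]⟩

/-- The remaining horizon is `q` but the normalisation is taken at the absolute time `q + n`; slow
variation makes the difference invisible in the limit. -/
lemma tendsto_confineFrom (k n : ℕ) (ω : Path) :
    Tendsto (fun q => confineFrom k q (X n ω).natAbs (Sstar n ω) (Rstar n ω) /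
      survive (q + n) 1) atTop (𝓝 (confineLimit k n ω)) := by
  have hx := natAbs_X_le_Sstar n ω
  have h : Tendsto (fun q => confineFrom k q (X n ω).natAbs (Sstar n ω) (Rstar n ω) /
      survive q 1) atTop (𝓝 (confineLimit k n ω)) := by
    unfold confineFrom confineLimit
    split_ifs with h1 h2
    · exact tendsto_confine_div (by omega)
    · rw [abs_X_eq]; exact tendsto_survive_div _
    · simp
  have h2 := h.div (tendsto_survive_ratio_add n) one_ne_zero
  rw [div_one] at h2
  refine h2.congr fun q => ?_
  have h3 := (survive_one_pos q).ne'
  have h4 := (survive_one_pos (q + n)).ne'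
  simp only [Pi.div_apply]
  field_simp

lemma measurableSet_Rstar_le (p k : ℕ) : MeasurableSet {ω | Rstar p ω ≤ k} :=
  (dependsUpTo_Rstar p).measurable (Set.to_countable {r | r ≤ k}).measurableSet

lemma measurableSet_Rstar_eq (p k : ℕ) : MeasurableSet {ω | Rstar p ω = k} :=
  (dependsUpTo_Rstar p).measurable (measurableSet_singleton k)

lemma tendsto_Rstar_le {n : ℕ} {Λ : Set Path} (hΛ : MeasurableSet[canonFiltration n] Λ) (k : ℕ) :
    Tendsto (fun p => walkLaw.real (Λ ∩ {ω | Rstar p ω ≤ k}) / survive p 1) atTop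
      (𝓝 (∫ ω in Λ, confineLimit k n ω ∂walkLaw)) := by
  rw [← tendsto_add_atTop_iff_nat n]
  have h := tendsto_setIntegral_of_dependsUpTo hΛ
    (f := fun q ω => confineFrom k q (X n ω).natAbs (Sstar n ω) (Rstar n ω) / survive (q + n) 1)
    (fun q => (dependsUpTo_confineFrom k q n).comp (· / survive (q + n) 1))
    (dependsUpTo_confineLimit k n) (fun ω => tendsto_confineFrom k n ω)
  refine h.congr fun q => ?_
  rw [integral_div, setIntegral_confineFrom hΛ, add_comm]

lemma tendsto_Rstar_eq {n : ℕ} {Λ : Set Path} (hΛ : MeasurableSet[canonFiltration n] Λ) (k : ℕ) :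
    Tendsto (fun p => walkLaw.real (Λ ∩ {ω | Rstar p ω = k}) / survive p 1) atTop
      (𝓝 (∫ ω in Λ, weight k n ω ∂walkLaw)) := by
  cases k with
  | zero =>
    simpa only [weight_zero, Nat.le_zero] using tendsto_Rstar_le hΛ 0
  | succ k =>
    have h := (tendsto_Rstar_le hΛ (k + 1)).sub (tendsto_Rstar_le hΛ k)
    rw [← integral_sub (dependsUpTo_confineLimit _ n).integrable.integrableOn
      (dependsUpTo_confineLimit _ n).integrable.integrableOn] at h
    simp only [← weight_succ] at h
    refine h.congr fun p => ?_
    rw [← sub_div]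
    congr 1
    have hu : Λ ∩ {ω | Rstar p ω ≤ k + 1} =
        (Λ ∩ {ω | Rstar p ω ≤ k}) ∪ (Λ ∩ {ω | Rstar p ω = k + 1}) := by
      ext ω
      simp only [Set.mem_inter_iff, Set.mem_ofPred_eq, Set.mem_union, Nat.le_succ_iff]
      tauto
    rw [hu, measureReal_union (Set.disjoint_left.2 fun ω h1 h2 => ?_)
      ((canonFiltration.le n Λ hΛ).inter (measurableSet_Rstar_eq p (k + 1)))]
    · ring
    · have := h1.2; have := h2.2; simp only [Set.mem_ofPred_eq] at *; omega

lemma summable_mul_succ_sq {φ : ℕ → ℝ} (hφ_nonneg : ∀ k, 0 ≤ φ k) (hφ : Summable φ)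
    (hφ_sq : Summable fun k : ℕ => (k : ℝ) ^ 2 * φ k) :
    Summable fun k : ℕ => φ k * ((k : ℝ) + 1) ^ 2 := by
  refine Summable.of_nonneg_of_le (fun k => mul_nonneg (hφ_nonneg k) (sq_nonneg _)) (fun k => ?_)
    ((hφ_sq.mul_left 2).add (hφ.mul_left 2))
  have : ((k : ℝ) + 1) ^ 2 ≤ 2 * (k : ℝ) ^ 2 + 2 := by nlinarith [sq_nonneg ((k : ℝ) - 1)]
  have := mul_le_mul_of_nonneg_left this (hφ_nonneg k)
  linarith

lemma hasSum_setIntegral_Rstar {φ : ℕ → ℝ} (hφ_nonneg : ∀ k, 0 ≤ φ k) (hφ : Summable φ)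
    (Λ : Set Path) (p : ℕ) :
    HasSum (fun k => φ k * walkLaw.real (Λ ∩ {ω | Rstar p ω = k}))
      (∫ ω in Λ, φ (Rstar p ω) ∂walkLaw) := by
  have hm : ∀ k : ℕ, MeasurableSet {ω | Rstar p ω = k} := fun k => measurableSet_Rstar_eq p k
  have hint : ∀ k : ℕ, ∫ ω in Λ, φ k * ({ω | Rstar p ω = k}.indicator 1 ω : ℝ) ∂walkLaw =
      φ k * walkLaw.real (Λ ∩ {ω | Rstar p ω = k}) := fun k => by
    rw [integral_const_mul, integral_indicator_one (hm k), measureReal_restrict_apply (hm k),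
      Set.inter_comm]
  have h := hasSum_integral_of_summable_integral_norm (μ := walkLaw.restrict Λ)
    (F := fun (k : ℕ) ω => φ k * ({ω | Rstar p ω = k}.indicator 1 ω : ℝ))
    (fun k => ((integrable_indicator_iff (hm k)).2 (integrable_const 1).integrableOn).const_mul _)
    (by
      refine Summable.of_nonneg_of_le (fun k => integral_nonneg fun _ => norm_nonneg _)
        (fun k => ?_) hφ
      have : ∀ ω, ‖φ k * ({ω | Rstar p ω = k}.indicator 1 ω : ℝ)‖ =
          φ k * ({ω | Rstar p ω = k}.indicator 1 ω : ℝ) := fun ω =>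
        Real.norm_of_nonneg (mul_nonneg (hφ_nonneg k)
          (Set.indicator_nonneg (fun _ _ => zero_le_one) _))
      simp only [this]
      rw [hint]
      exact mul_le_of_le_one_right (hφ_nonneg k) measureReal_le_one)
  have he : ∀ ω, ∑' k : ℕ, φ k * ({ω | Rstar p ω = k}.indicator 1 ω : ℝ) = φ (Rstar p ω) := by
    intro ω
    rw [tsum_eq_single (Rstar p ω)]
    · simp
    · intro k hk
      simp [hk.symm]
  simpa only [hint, he] using h

lemma hasSum_setIntegral_weight {φ : ℕ → ℝ} (hφ_nonneg : ∀ k, 0 ≤ φ k) (hφ : Summable φ)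
    (hφ_sq : Summable fun k : ℕ => (k : ℝ) ^ 2 * φ k) {n : ℕ} (Λ : Set Path) :
    HasSum (fun k => φ k * ∫ ω in Λ, weight k n ω ∂walkLaw) (∫ ω in Λ, Mstar φ n ω ∂walkLaw) := by
  have hS : Integrable (fun ω => (Sstar n ω : ℝ)) walkLaw :=
    ((dependsUpTo_Sstar n).comp fun s : ℕ => (s : ℝ)).integrable
  have h := hasSum_integral_of_summable_integral_norm (μ := walkLaw.restrict Λ)
    (F := fun (k : ℕ) ω => φ k * weight k n ω)
    (fun k => ((dependsUpTo_weight k n).integrable.const_mul _).integrableOn)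
    (by
      have hs : Summable fun k : ℕ => φ k * ((∫ ω in Λ, (Sstar n ω : ℝ) ∂walkLaw) + (k + 1)) := by
        have := (hφ.mul_right (∫ ω in Λ, (Sstar n ω : ℝ) ∂walkLaw)).add
          (summable_mul_succ_sq hφ_nonneg hφ hφ_sq)
        refine Summable.of_nonneg_of_le (fun k => mul_nonneg (hφ_nonneg k) ?_) (fun k => ?_) this
        · have : 0 ≤ ∫ ω in Λ, (Sstar n ω : ℝ) ∂walkLaw := integral_nonneg fun _ => by positivity
          positivity
        · rw [mul_add]
          have h1 : (k : ℝ) + 1 ≤ ((k : ℝ) + 1) ^ 2 := by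
            nlinarith [(Nat.cast_nonneg k : (0 : ℝ) ≤ k)]
          linarith [mul_le_mul_of_nonneg_left h1 (hφ_nonneg k)]
      refine Summable.of_nonneg_of_le (fun k => integral_nonneg fun _ => norm_nonneg _)
        (fun k => ?_) hs
      have : ∀ ω, ‖φ k * weight k n ω‖ = φ k * weight k n ω := fun ω =>
        Real.norm_of_nonneg (mul_nonneg (hφ_nonneg k) (weight_nonneg k n ω))
      simp only [this]
      rw [integral_const_mul]
      refine mul_le_mul_of_nonneg_left ?_ (hφ_nonneg k)
      calc ∫ ω in Λ, weight k n ω ∂walkLaw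
          ≤ ∫ ω in Λ, ((Sstar n ω : ℝ) + (k + 1)) ∂walkLaw :=
            integral_mono (dependsUpTo_weight k n).integrable.integrableOn
              (hS.add (integrable_const _)).integrableOn fun ω => by
                have := weight_le k n ω
                simp only; linarith
        _ = (∫ ω in Λ, (Sstar n ω : ℝ) ∂walkLaw) + walkLaw.real Λ * (k + 1) := by
            rw [integral_add hS.integrableOn (integrable_const _)]
            simp
        _ ≤ _ := by
            have : walkLaw.real Λ * ((k : ℝ) + 1) ≤ 1 * (k + 1) :=
              mul_le_mul_of_nonneg_right measureReal_le_one (by positivity)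
            linarith)
  simp only [integral_const_mul, fun ω => (hasSum_weight hφ n ω).tsum_eq] at h
  exact h

/-- The asymptotics of `E[1_Λ φ(S*_{g_p})]`. -/
lemma tendsto_setIntegral_Rstar {φ : ℕ → ℝ} (hφ_nonneg : ∀ k, 0 ≤ φ k) (hφ : Summable φ)
    (hφ_sq : Summable fun k : ℕ => (k : ℝ) ^ 2 * φ k) {n : ℕ} {Λ : Set Path}
    (hΛ : MeasurableSet[canonFiltration n] Λ) :
    Tendsto (fun p => (∫ ω in Λ, φ (Rstar p ω) ∂walkLaw) / survive p 1) atTop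
      (𝓝 (∫ ω in Λ, Mstar φ n ω ∂walkLaw)) := by
  rw [← (hasSum_setIntegral_weight hφ_nonneg hφ hφ_sq Λ).tsum_eq]
  simp only [← fun p => (hasSum_setIntegral_Rstar hφ_nonneg hφ Λ p).tsum_eq, ← tsum_div_const]
  -- The bound is `confine_le` at `x = 0`, uniform in `p`; its summability is where the second
  -- moment of `φ` is needed.
  refine tendsto_tsum_of_dominated_convergence (bound := fun k : ℕ => 6 * (φ k * ((k : ℝ) + 1) ^ 2))
    ((summable_mul_succ_sq hφ_nonneg hφ hφ_sq).mul_left 6) (fun k => ?_)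
    (Eventually.of_forall fun p k => ?_)
  · simp only [mul_div_assoc]
    exact (tendsto_Rstar_eq hΛ k).const_mul _
  · have hp := survive_one_pos p
    rw [Real.norm_of_nonneg (div_nonneg (mul_nonneg (hφ_nonneg k) measureReal_nonneg) hp.le),
      div_le_iff₀ hp]
    have h1 : walkLaw.real (Λ ∩ {ω | Rstar p ω = k}) ≤ walkLaw.real {ω | Rstar p ω ≤ k} :=
      measureReal_mono fun ω h => h.2.le
    rw [measureReal_Rstar_le] at h1
    have h2 := mul_le_mul_of_nonneg_left (h1.trans (confine_le k p 0 (Nat.zero_le _)))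
      (hφ_nonneg k)
    linarith

/-! ### The martingale -/

lemma tailSum_zero {φ : ℕ → ℝ} (hφ_sum : HasSum φ 1) : tailSum φ 0 = 1 := by
  simp only [tailSum, zero_add, hφ_sum.tsum_eq]

lemma tailSum_eq {φ : ℕ → ℝ} (hφ : Summable φ) (s : ℕ) :
    tailSum φ s = φ s + tailSum φ (s + 1) := by
  have h : Summable fun k => φ (s + k) := by
    simpa only [add_comm] using (summable_nat_add_iff s).2 hφ
  unfold tailSum
  rw [h.tsum_eq_zero_add]
  simp only [add_zero, add_assoc, add_comm 1]

lemma tailSum_nonneg {φ : ℕ → ℝ} (hφ_nonneg : ∀ k, 0 ≤ φ k) (s : ℕ) : 0 ≤ tailSum φ s :=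
  tsum_nonneg fun _ => hφ_nonneg _

lemma Mstar_eq (φ : ℕ → ℝ) (n : ℕ) (ω : Path) :
    Mstar φ n ω = φ (Rstar n ω) * (X n ω).natAbs
      + φ (Sstar n ω) * ((Sstar n ω : ℝ) - (X n ω).natAbs) + tailSum φ (Sstar n ω) := by
  rw [← abs_X_eq]; rfl

lemma Mstar_nonneg {φ : ℕ → ℝ} (hφ_nonneg : ∀ k, 0 ≤ φ k) (n : ℕ) (ω : Path) :
    0 ≤ Mstar φ n ω :=
  add_nonneg (add_nonneg (mul_nonneg (hφ_nonneg _) (abs_nonneg _))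
    (mul_nonneg (hφ_nonneg _) (sub_nonneg.2 (abs_X_le_Sstar n ω)))) (tailSum_nonneg hφ_nonneg _)

/-- Away from `0` and from the maximum, `M*` is affine in `|X|`. At `0` the two terms in `|X|`
cancel because `S*_{g_n} = S*_n`. At a new maximum the tail sum loses exactly the `φ(s)` gained on
the downward step. -/
lemma Mstar_step {φ : ℕ → ℝ} (hφ : Summable φ) (n : ℕ) (ω : Path) :
    Mstar φ (n + 1) ω + Mstar φ (n + 1) (flip n ω) = 2 * Mstar φ n ω := by
  have hxs := natAbs_X_le_Sstar n ω
  have hr0 := Rstar_eq_Sstar (n := n) (ω := ω)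
  rw [Mstar_eq, Mstar_eq, Mstar_eq, Rstar_succ, Rstar_succ, Sstar_succ, Sstar_succ,
    (dependsUpTo_Sstar n).flip, (dependsUpTo_Rstar n).flip]
  simp only [← Int.natAbs_eq_zero (a := X n ω), ← Int.natAbs_eq_zero (a := X (n + 1) ω),
    ← Int.natAbs_eq_zero (a := X (n + 1) (flip n ω))] at *
  have hc := natAbs_X_succ n ω
  rw [← Int.natAbs_eq_zero] at hc
  generalize (X n ω).natAbs = x at *
  generalize (X (n + 1) ω).natAbs = x' at *
  generalize (X (n + 1) (flip n ω)).natAbs = x'' at *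
  generalize Sstar n ω = s at *
  generalize Rstar n ω = r at *
  -- The update of `S*_{g}` occurs only at a zero, where the factor `|X|` hides it.
  have key : ∀ z, φ (if z = 0 then max s z else r) * (z : ℝ) = φ r * z := by
    intro z
    split_ifs with h
    · simp [h]
    · rfl
  rw [key, key]
  have ht := tailSum_eq hφ s
  have below : ∀ z ≤ s, max s z = s := fun z hz => max_eq_left hz
  have above : max s (s + 1) = s + 1 := max_eq_right (Nat.le_succ s)
  rcases hc with ⟨rfl, rfl, rfl⟩ | ⟨y, rfl, hc⟩
  · rw [hr0 rfl]
    rcases Nat.eq_zero_or_pos s with rfl | hs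
    · simp [ht]; ring
    · rw [below 1 hs]; push_cast; ring
  · rcases hxs.lt_or_eq with hlt | rfl
    · rcases hc with ⟨h1, h2⟩ | ⟨h1, h2⟩ <;> rw [h1, h2, below y (by omega), below (y + 2) (by omega)] <;>
        push_cast <;> ring
    · rcases hc with ⟨rfl, rfl⟩ | ⟨rfl, rfl⟩ <;>
        rw [below _ (Nat.le_succ _), above, ht] <;> push_cast <;> ring

lemma setIntegral_Mstar_succ {φ : ℕ → ℝ} (hφ : Summable φ) {n : ℕ} {Λ : Set Path}
    (hΛ : MeasurableSet[canonFiltration n] Λ) :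
    ∫ ω in Λ, Mstar φ (n + 1) ω ∂walkLaw = ∫ ω in Λ, Mstar φ n ω ∂walkLaw :=
  setIntegral_step hΛ (dependsUpTo_Mstar φ (n + 1)) fun ω _ => Mstar_step hφ n ω

lemma Mstar_zero {φ : ℕ → ℝ} (hφ_sum : HasSum φ 1) {ω : Path} (h : X 0 ω = 0) :
    Mstar φ 0 ω = 1 := by
  rw [Mstar_eq, Rstar_zero, Sstar_zero, h]
  simp [tailSum_zero hφ_sum]

lemma integral_Mstar {φ : ℕ → ℝ} (hφ_sum : HasSum φ 1) (n : ℕ) :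
    ∫ ω, Mstar φ n ω ∂walkLaw = 1 := by
  induction n with
  | zero =>
    have : Mstar φ 0 =ᵐ[walkLaw] fun _ => 1 := by
      filter_upwards [ae_X_zero] with ω hω using Mstar_zero hφ_sum hω
    rw [integral_congr_ae this]
    simp
  | succ n ih =>
    have := setIntegral_Mstar_succ hφ_sum.summable (n := n) (Λ := Set.univ) MeasurableSet.univ
    rwa [setIntegral_univ, setIntegral_univ, ih] at this

lemma martingale_Mstar {φ : ℕ → ℝ} (hφ : Summable φ) :
    Martingale (Mstar φ) canonFiltration walkLaw := by
  refine martingale_of_setIntegral_eq_succ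
    (fun n => (dependsUpTo_Mstar φ n).measurable_canonFiltration.stronglyMeasurable)
    (fun n => (dependsUpTo_Mstar φ n).integrable) fun n s hs => (setIntegral_Mstar_succ hφ hs).symm

lemma penalisation_limit {φ : ℕ → ℝ} (hφ_nonneg : ∀ k, 0 ≤ φ k) (hφ_sum : HasSum φ 1)
    (hφ_sq : Summable fun k : ℕ => (k : ℝ) ^ 2 * φ k) {n : ℕ} {Λ : Set Path}
    (hΛ : MeasurableSet[canonFiltration n] Λ) :
    Tendsto (fun p => (∫ ω in Λ, φ (Rstar p ω) ∂walkLaw) / ∫ ω, φ (Rstar p ω) ∂walkLaw) atTop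
      (𝓝 (∫ ω in Λ, Mstar φ n ω ∂walkLaw)) := by
  have h1 := tendsto_setIntegral_Rstar hφ_nonneg hφ_sum.summable hφ_sq hΛ
  have h2 := tendsto_setIntegral_Rstar hφ_nonneg hφ_sum.summable hφ_sq (n := n) (Λ := Set.univ)
    MeasurableSet.univ
  simp only [setIntegral_univ, integral_Mstar hφ_sum] at h2
  have h := h1.div h2 one_ne_zero
  rw [div_one] at h
  exact h.congr fun p => div_div_div_cancel_right₀ (survive_one_pos p).ne' _ _

/-! ### The probability induced by the martingale -/

/-- The conditional probability, under the law induced by `M*`, that the coin number `n` is `b`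
given the previous ones. -/
def stepProb (φ : ℕ → ℝ) (n : ℕ) (c : ℕ → Bool) (b : Bool) : ℝ :=
  if Mstar φ n (pathOfCoins c) = 0 then 1 / 2
  else Mstar φ (n + 1) (pathOfCoins (Function.update c n b)) / (2 * Mstar φ n (pathOfCoins c))

lemma pathOfCoins_update_agree (n : ℕ) (c : ℕ → Bool) (b : Bool) :
    AgreeUpTo n (pathOfCoins (Function.update c n b)) (pathOfCoins c) := fun k hk => by
  rw [X_pathOfCoins, X_pathOfCoins]
  refine Finset.sum_congr rfl fun i hi => ?_
  rw [Function.update_of_ne]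
  have := Finset.mem_range.1 hi
  omega

lemma Mstar_update_add {φ : ℕ → ℝ} (hφ : Summable φ) (n : ℕ) (c : ℕ → Bool) :
    Mstar φ (n + 1) (pathOfCoins (Function.update c n true)) +
      Mstar φ (n + 1) (pathOfCoins (Function.update c n false)) =
      2 * Mstar φ n (pathOfCoins c) := by
  have h := Mstar_step hφ n (pathOfCoins (Function.update c n true))
  rw [dependsUpTo_Mstar φ n _ _ (pathOfCoins_update_agree n c true), flip_pathOfCoins] at h
  rw [← h]
  congr 3
  funext i
  by_cases hi : i = n
  · subst hi; simp
  · simp [hi]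

lemma stepProb_nonneg {φ : ℕ → ℝ} (hφ_nonneg : ∀ k, 0 ≤ φ k) (n : ℕ) (c : ℕ → Bool) (b : Bool) :
    0 ≤ stepProb φ n c b := by
  unfold stepProb
  split_ifs
  · norm_num
  · exact div_nonneg (Mstar_nonneg hφ_nonneg _ _)
      (mul_nonneg zero_le_two (Mstar_nonneg hφ_nonneg _ _))

lemma stepProb_add {φ : ℕ → ℝ} (hφ : Summable φ) (n : ℕ) (c : ℕ → Bool) :
    stepProb φ n c true + stepProb φ n c false = 1 := by
  unfold stepProb
  split_ifs with h
  · norm_num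
  · rw [← add_div, Mstar_update_add hφ]
    exact div_self (mul_ne_zero two_ne_zero h)

/-- If `M*_n = 0` then nonnegativity makes both successors vanish, so the default value `1/2` in
`stepProb` is harmless. -/
lemma Mstar_mul_stepProb {φ : ℕ → ℝ} (hφ_nonneg : ∀ k, 0 ≤ φ k) (hφ : Summable φ) (n : ℕ)
    (c : ℕ → Bool) (b : Bool) :
    Mstar φ n (pathOfCoins c) * stepProb φ n c b =
      2⁻¹ * Mstar φ (n + 1) (pathOfCoins (Function.update c n b)) := by
  unfold stepProb
  split_ifs with h
  · have h1 := Mstar_update_add hφ n c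
    have h2 := Mstar_nonneg hφ_nonneg (n + 1) (pathOfCoins (Function.update c n true))
    have h3 := Mstar_nonneg hφ_nonneg (n + 1) (pathOfCoins (Function.update c n false))
    rw [h] at h1 ⊢
    cases b <;> linarith
  · field_simp

/-- The transition kernel of the coin tosses under the law induced by `M*`. -/
def coinKernel (φ : ℕ → ℝ) (n : ℕ) : Kernel (Finset.Iic n → Bool) Bool :=
  Kernel.ofFunOfCountable fun d =>
    ENNReal.ofReal (stepProb φ (n + 1) (extendCoins _ d) true) • Measure.dirac true +
    ENNReal.ofReal (stepProb φ (n + 1) (extendCoins _ d) false) • Measure.dirac false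

lemma coinKernel_singleton (φ : ℕ → ℝ) (n : ℕ) (d : Finset.Iic n → Bool) (b : Bool) :
    coinKernel φ n d {b} = ENNReal.ofReal (stepProb φ (n + 1) (extendCoins _ d) b) := by
  change (ENNReal.ofReal (stepProb φ (n + 1) (extendCoins _ d) true) • Measure.dirac true +
    ENNReal.ofReal (stepProb φ (n + 1) (extendCoins _ d) false) • Measure.dirac false :
      Measure Bool) {b} = _
  cases b <;> simp

lemma isMarkovKernel_coinKernel {φ : ℕ → ℝ} (hφ_nonneg : ∀ k, 0 ≤ φ k) (hφ : Summable φ) (n : ℕ) :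
    IsMarkovKernel (coinKernel φ n) := by
  refine ⟨fun d => ⟨?_⟩⟩
  change (ENNReal.ofReal (stepProb φ (n + 1) (extendCoins _ d) true) • Measure.dirac true +
    ENNReal.ofReal (stepProb φ (n + 1) (extendCoins _ d) false) • Measure.dirac false :
      Measure Bool) Set.univ = 1
  simp only [Measure.coe_add, Measure.coe_smul, Pi.add_apply, Pi.smul_apply, measure_univ,
    smul_eq_mul, mul_one]
  rw [← ENNReal.ofReal_add (stepProb_nonneg hφ_nonneg _ _ _) (stepProb_nonneg hφ_nonneg _ _ _),
    stepProb_add hφ, ENNReal.ofReal_one]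

/-- The first coin stays fair under the new law, which makes `coinLaw` the right initial law for the
trajectory measure. -/
lemma Mstar_one {φ : ℕ → ℝ} (hφ_sum : HasSum φ 1) {ω : Path} (h : X 0 ω = 0) :
    Mstar φ 1 ω = 1 := by
  have h1 : (X 1 ω).natAbs = 1 := by
    rcases X_succ_cases 0 ω with h1 | h1 <;> simp [h1, h]
  have h2 : X 1 ω ≠ 0 := by intro h2; simp [h2] at h1
  have h3 : φ 0 + tailSum φ 1 = 1 := by
    rw [← tailSum_zero hφ_sum, tailSum_eq hφ_sum.summable 0]
  rw [Mstar_eq, Rstar_succ, Sstar_succ, Sstar_zero, Rstar_zero, Sstar_zero, zero_add, if_neg h2,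
    h1, h]
  simp [h3]

lemma exists_isInducedBy {φ : ℕ → ℝ} (hφ_nonneg : ∀ k, 0 ≤ φ k) (hφ_sum : HasSum φ 1) :
    ∃ Q : Measure Path, IsProbabilityMeasure Q ∧ IsInducedBy φ Q := by
  classical
  have hφ := hφ_sum.summable
  have hK := isMarkovKernel_coinKernel hφ_nonneg hφ
  set ν : Measure (ℕ → Bool) := Kernel.trajMeasure (X := fun _ => Bool) coinLaw (coinKernel φ)
    with hν
  -- Telescoping product of the step probabilities. The coins `0, …, n` determine the path up to
  -- time `n + 1`, hence the index of `M*`.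
  have hcyl : ∀ (n : ℕ) (d : Finset.Iic n → Bool), ν.map (Preorder.frestrictLe n) {d} =
      ENNReal.ofReal (2⁻¹ ^ (n + 1) * Mstar φ (n + 1) (pathOfCoins (extendCoins _ d))) := by
    intro n
    induction n with
    | zero =>
      intro d
      have h1 : ν.map (Preorder.frestrictLe 0) =
          coinLaw.map (MeasurableEquiv.piUnique fun _ : Finset.Iic 0 => Bool).symm := by
        rw [hν, Kernel.trajMeasure, Measure.map_comp _ _ (by fun_prop), Kernel.traj_map_frestrictLe,
          Kernel.partialTraj_self, Measure.id_comp]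
      rw [h1, Measure.map_apply (MeasurableEquiv.measurable _) (measurableSet_singleton _)]
      have h2 : (MeasurableEquiv.piUnique fun _ : Finset.Iic 0 => Bool).symm ⁻¹' {d} =
          {d default} := by
        ext b
        simp only [Set.mem_preimage, Set.mem_singleton_iff]
        exact (MeasurableEquiv.piUnique fun _ : Finset.Iic 0 => Bool).symm_apply_eq
      rw [h2, coinLaw_singleton, Mstar_one hφ_sum (by simp [X_pathOfCoins])]
      simp
    | succ n ih =>
      intro d
      have h := Kernel.map_frestrictLe_trajMeasure_compProd_eq_map_trajMeasure
        (X := fun _ => Bool) (μ₀ := coinLaw) (κ := coinKernel φ) (a := n)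
      have h2 := congrArg (fun m => m ({Preorder.frestrictLe₂ (π := fun _ => Bool) n.le_succ d} ×ˢ
        {d ⟨n + 1, by simp⟩})) h
      rw [Measure.compProd_apply_prod (measurableSet_singleton _) (measurableSet_singleton _),
        lintegral_singleton, coinKernel_singleton, ← hν, ih, Measure.map_apply (by fun_prop)
          ((measurableSet_singleton _).prod (measurableSet_singleton _)),
        ← ENNReal.ofReal_mul (stepProb_nonneg hφ_nonneg _ _ _)] at h2
      rw [Measure.map_apply (by fun_prop) (measurableSet_singleton _)]
      have hset : Preorder.frestrictLe (π := fun _ => Bool) (n + 1) ⁻¹' {d} =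
          (fun x : ℕ → Bool => (Preorder.frestrictLe (π := fun _ => Bool) n x, x (n + 1))) ⁻¹'
            ({Preorder.frestrictLe₂ (π := fun _ => Bool) n.le_succ d} ×ˢ
              {d ⟨n + 1, by simp⟩}) := by
        ext x
        simp only [Set.mem_preimage, Set.mem_singleton_iff, Set.mem_prod]
        constructor
        · rintro rfl
          exact ⟨rfl, rfl⟩
        · rintro ⟨h1, h2⟩
          funext ⟨i, hi⟩
          rcases (Finset.mem_Iic.1 hi).lt_or_eq with hlt | rfl
          · exact congrFun h1 ⟨i, Finset.mem_Iic.2 (Nat.lt_succ_iff.1 hlt)⟩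
          · exact h2
      have hext : Function.update (extendCoins (Finset.Iic n)
          (Preorder.frestrictLe₂ (π := fun _ => Bool) n.le_succ d)) (n + 1) (d ⟨n + 1, by simp⟩) =
          extendCoins (Finset.Iic (n + 1)) d := by
        funext i
        rcases lt_trichotomy i (n + 1) with hi | rfl | hi
        · rw [Function.update_of_ne hi.ne, extendCoins, extendCoins,
            dif_pos (Finset.mem_Iic.2 (Nat.lt_succ_iff.1 hi)), dif_pos (Finset.mem_Iic.2 hi.le)]
          rfl
        · rw [Function.update_self, extendCoins, dif_pos (by simp)]
        · rw [Function.update_of_ne hi.ne', extendCoins, extendCoins,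
            dif_neg (by simp; omega), dif_neg (by simp; omega)]
      rw [hset, ← h2, mul_comm, mul_assoc, Mstar_mul_stepProb hφ_nonneg hφ, hext, ← mul_assoc,
        ← pow_succ]
  refine ⟨ν.map pathOfCoins,
    Measure.isProbabilityMeasure_map measurable_pathOfCoins.aemeasurable, fun n Λ hΛ => ?_⟩
  have hm := canonFiltration.le n Λ hΛ
  have hs : Finset.range (n + 1) ⊆ Finset.Iic n := fun i hi => by
    simpa [Nat.lt_succ_iff] using hi
  -- `Λ ∈ ℱ_n` is evaluated with `M*_{n+1}` to match the cylinders on `Finset.Iic n`; the martingale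
  -- property allows it.
  rw [← setIntegral_Mstar_succ hφ hΛ, ← integral_indicator hm,
    ((dependsUpTo_Mstar φ (n + 1)).indicator
      (canonFiltration.mono n.le_succ Λ hΛ)).integral_eq_sum hs]
  have hpre : pathOfCoins ⁻¹' Λ = Preorder.frestrictLe (π := fun _ => Bool) n ⁻¹'
      {d | pathOfCoins (extendCoins _ d) ∈ Λ} := by
    ext c
    have h := (measurableSet_canonFiltration_iff.1 hΛ).mono n.le_succ
    exact (h.pathOfCoins_eq hs c).symm.to_iff
  rw [measureReal_def, Measure.map_apply measurable_pathOfCoins hm, hpre,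
    ← Measure.map_apply (by fun_prop) (Set.to_countable _).measurableSet, ← measureReal_def]
  have hfin : {d | pathOfCoins (extendCoins (Finset.Iic n) d) ∈ Λ} =
      ((Finset.univ.filter fun d => pathOfCoins (extendCoins (Finset.Iic n) d) ∈ Λ :
        Finset (Finset.Iic n → Bool)) : Set _) := by ext; simp
  rw [hfin, ← sum_measureReal_singleton, Finset.sum_filter]
  refine Finset.sum_congr rfl fun d _ => ?_
  rw [Set.indicator_apply, measureReal_def, hcyl, ENNReal.toReal_ofReal
    (mul_nonneg (by positivity) (Mstar_nonneg hφ_nonneg _ _))]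
  split_ifs <;> simp

lemma generateFrom_canonFiltration :
    (Subtype.instMeasurableSpace : MeasurableSpace Path) =
      MeasurableSpace.generateFrom {Λ | ∃ n, MeasurableSet[canonFiltration n] Λ} := by
  refine le_antisymm ?_ (MeasurableSpace.generateFrom_le fun Λ ⟨n, h⟩ => canonFiltration.le n Λ h)
  have h : ∀ n, Measurable[MeasurableSpace.generateFrom
      {Λ | ∃ n, MeasurableSet[canonFiltration n] Λ}] (X n) := fun n s _ =>
    MeasurableSpace.measurableSet_generateFrom ⟨n, measurableSet_canonFiltration_iff.2
      ((dependsUpTo_X le_rfl).comp (· ∈ s))⟩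
  have hv : Measurable[MeasurableSpace.generateFrom
      {Λ | ∃ n, MeasurableSet[canonFiltration n] Λ}] (Subtype.val : Path → ℕ → ℤ) :=
    (@measurable_pi_iff _ _ _ (MeasurableSpace.generateFrom
      {Λ | ∃ n, MeasurableSet[canonFiltration n] Λ}) _ _).2 h
  exact hv.comap_le

lemma isPiSystem_canonFiltration :
    IsPiSystem {Λ : Set Path | ∃ n, MeasurableSet[canonFiltration n] Λ} := by
  rintro Λ ⟨n, h⟩ Λ' ⟨m, h'⟩ -
  exact ⟨max n m, (canonFiltration.mono (le_max_left n m) Λ h).inter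
    (canonFiltration.mono (le_max_right n m) Λ' h')⟩

lemma IsInducedBy.unique {φ : ℕ → ℝ} {Q Q' : Measure Path} [IsProbabilityMeasure Q]
    [IsProbabilityMeasure Q'] (h : IsInducedBy φ Q) (h' : IsInducedBy φ Q') : Q = Q' := by
  refine ext_of_generate_finite _ generateFrom_canonFiltration isPiSystem_canonFiltration ?_
    (by simp)
  rintro Λ ⟨n, hΛ⟩
  rw [← measureReal_eq_measureReal_iff, h n Λ hΛ, h' n Λ hΛ]

/-! ### Paths without zeros after a given time -/

/-- The paths without zeros in `(N, m]`. -/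
def noZeroBetween (N m : ℕ) : Set Path := {ω | ∀ j, N < j → j ≤ m → X j ω ≠ 0}

/-- The paths without zeros after time `N`. -/
def noZeroAfter (N : ℕ) : Set Path := {ω | ∀ j, N < j → X j ω ≠ 0}

lemma measurableSet_noZeroBetween (N m : ℕ) :
    MeasurableSet[canonFiltration m] (noZeroBetween N m) := by
  refine measurableSet_canonFiltration_iff.2 fun ω ω' h => ?_
  simp only [noZeroBetween, Set.mem_ofPred_eq, eq_iff_iff]
  exact forall₃_congr fun _ _ hj => by rw [h _ hj]

lemma noZeroBetween_self (N : ℕ) : noZeroBetween N N = Set.univ :=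
  Set.eq_univ_of_forall fun _ _ h1 h2 => absurd h1 (not_lt.2 h2)

lemma noZeroBetween_succ {N m : ℕ} (h : N ≤ m) :
    noZeroBetween N (m + 1) = noZeroBetween N m ∩ {ω | X (m + 1) ω ≠ 0} := by
  ext ω
  constructor
  · exact fun hω => ⟨fun j h1 h2 => hω j h1 (h2.trans m.le_succ),
      hω (m + 1) (Nat.lt_succ_of_le h) le_rfl⟩
  · rintro ⟨h1, h2⟩ j hj hj'
    rcases hj'.lt_or_eq with hlt | rfl
    · exact h1 j hj (Nat.lt_succ_iff.1 hlt)
    · exact h2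

lemma noZeroAfter_eq_iInter (N : ℕ) : noZeroAfter N = ⋂ m, noZeroBetween N m := by
  ext ω
  simp only [noZeroAfter, noZeroBetween, Set.mem_ofPred_eq, Set.mem_iInter]
  exact ⟨fun h m j hj _ => h j hj, fun h j hj => h j j hj le_rfl⟩

lemma measurableSet_noZeroAfter (N : ℕ) : MeasurableSet (noZeroAfter N) := by
  rw [noZeroAfter_eq_iInter]
  exact MeasurableSet.iInter fun m => canonFiltration.le m _ (measurableSet_noZeroBetween N m)

lemma Rstar_eq_of_noZeroBetween {N m : ℕ} (h : N ≤ m) {ω : Path} (hω : ω ∈ noZeroBetween N m) :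
    Rstar m ω = Rstar N ω := by
  induction m, h using Nat.le_induction with
  | base => rfl
  | succ m h ih =>
    rw [noZeroBetween_succ h] at hω
    rw [Rstar_succ, if_neg hω.2, ih hω.1]

lemma natAbs_X_le {ω : Path} (h : X 0 ω = 0) (n : ℕ) : (X n ω).natAbs ≤ n := by
  induction n with
  | zero => simp [h]
  | succ n ih => rcases X_succ_cases n ω with h1 | h1 <;> omega

lemma Sstar_le {ω : Path} (h : X 0 ω = 0) (n : ℕ) : Sstar n ω ≤ n :=
  Finset.sup_le fun k hk =>
    (natAbs_X_le h k).trans (Nat.lt_succ_iff.1 (Finset.mem_range.1 hk))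

/-- Without zeros in `(N, m]`, the maximum at the last zero is frozen at a value at most `N`, an
event whose probability is already known to vanish. -/
lemma tendsto_noZeroBetween (N : ℕ) :
    Tendsto (fun m => walkLaw.real (noZeroBetween N m)) atTop (𝓝 0) := by
  refine tendsto_of_tendsto_of_tendsto_of_le_of_le' tendsto_const_nhds
    (tendsto_measureReal_Rstar_le N) (Eventually.of_forall fun m => measureReal_nonneg) ?_
  filter_upwards [eventually_ge_atTop N] with m hm
  refine ENNReal.toReal_mono (measure_ne_top _ _) (measure_mono_ae ?_)
  filter_upwards [ae_X_zero] with ω h0 hω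
  exact (Rstar_eq_of_noZeroBetween hm hω).trans_le ((Rstar_le_Sstar N ω).trans (Sstar_le h0 N))

/-- The harmonic function of the walk killed when it returns to zero. -/
def absOrOne (n : ℕ) (ω : Path) : ℝ := max |(X n ω : ℝ)| 1

lemma dependsUpTo_φ_absOrOne (φ : ℕ → ℝ) (n : ℕ) :
    DependsUpTo n fun ω => φ (Rstar n ω) * absOrOne n ω := fun ω ω' h => by
  simp only [absOrOne, dependsUpTo_X le_rfl ω ω' h, dependsUpTo_Rstar n ω ω' h]

lemma absOrOne_of_ne {n : ℕ} {ω : Path} (h : X n ω ≠ 0) : absOrOne n ω = |(X n ω : ℝ)| := by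
  refine max_eq_left ?_
  exact_mod_cast Int.one_le_abs h

/-- `|x|` is harmonic off `0` and vanishes on the killed paths; at `0` the walk moves to `±1`, which
dictates the value `1` there. -/
lemma absOrOne_step (f : ℕ → ℝ) (n : ℕ) (ω : Path) :
    (if X (n + 1) ω = 0 then 0 else f (Rstar (n + 1) ω) * absOrOne (n + 1) ω) +
      (if X (n + 1) (flip n ω) = 0 then 0
        else f (Rstar (n + 1) (flip n ω)) * absOrOne (n + 1) (flip n ω)) =
      2 * (f (Rstar n ω) * absOrOne n ω) := by
  have key : ∀ ω', Rstar n ω' = Rstar n ω → (if X (n + 1) ω' = 0 then 0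
      else f (Rstar (n + 1) ω') * absOrOne (n + 1) ω') =
        f (Rstar n ω) * (X (n + 1) ω').natAbs := fun ω' h => by
    split_ifs with h0
    · simp [h0]
    · rw [Rstar_succ, if_neg h0, absOrOne_of_ne h0, h, abs_X_eq]
  rw [key ω rfl, key _ ((dependsUpTo_Rstar n).flip ω), absOrOne, abs_X_eq]
  rcases natAbs_X_succ n ω with ⟨h0, h1, h2⟩ | ⟨y, h0, h12⟩
  · rw [h0, h1, h2]; norm_num; ring
  · have hm : max (((y + 1 : ℕ) : ℝ)) 1 = y + 1 := by
      push_cast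
      exact max_eq_left (by linarith [(Nat.cast_nonneg y : (0 : ℝ) ≤ y)])
    rcases h12 with ⟨h1, h2⟩ | ⟨h1, h2⟩ <;> rw [h0, h1, h2, hm] <;> push_cast <;> ring

lemma setIntegral_noZeroBetween (φ : ℕ → ℝ) {N m : ℕ} (h : N ≤ m) {Λ : Set Path}
    (hΛ : MeasurableSet[canonFiltration N] Λ) :
    ∫ ω in Λ ∩ noZeroBetween N m, φ (Rstar m ω) * absOrOne m ω ∂walkLaw =
      ∫ ω in Λ, φ (Rstar N ω) * absOrOne N ω ∂walkLaw := by
  induction m, h using Nat.le_induction with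
  | base => rw [noZeroBetween_self, Set.inter_univ]
  | succ m h ih =>
    have hm : MeasurableSet[canonFiltration m] (Λ ∩ noZeroBetween N m) :=
      (canonFiltration.mono h Λ hΛ).inter (measurableSet_noZeroBetween N m)
    have hd : DependsUpTo (m + 1) fun ω =>
        if X (m + 1) ω = 0 then 0 else φ (Rstar (m + 1) ω) * absOrOne (m + 1) ω :=
      fun ω ω' hω => by
        simp only [dependsUpTo_X le_rfl ω ω' hω, dependsUpTo_φ_absOrOne φ (m + 1) ω ω' hω]
    rw [← ih, ← setIntegral_step hm hd fun ω _ => absOrOne_step φ m ω, noZeroBetween_succ h,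
      ← Set.inter_assoc]
    have hX : MeasurableSet {ω | X (m + 1) ω ≠ 0} :=
      (measurable_X (m + 1) (measurableSet_singleton 0)).compl
    rw [← setIntegral_indicator hX]
    congr 1
    funext ω
    by_cases h0 : X (m + 1) ω = 0 <;> simp [h0]

/-! ### The induced probability: absence of zeros after a given time -/

/-- The constant comes from `φ(s)(s - |x|) ≤ s² φ(s)`, which is at most the second moment, and from
a tail sum at most `1`. -/
lemma Mstar_rest_bound {φ : ℕ → ℝ} (hφ_nonneg : ∀ k, 0 ≤ φ k) (hφ_sum : HasSum φ 1)
    (hφ_sq : Summable fun k : ℕ => (k : ℝ) ^ 2 * φ k) :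
    ∃ C, ∀ n ω, φ (Rstar n ω) * |(X n ω : ℝ)| ≤ Mstar φ n ω ∧
      Mstar φ n ω ≤ φ (Rstar n ω) * |(X n ω : ℝ)| + C := by
  refine ⟨(∑' k : ℕ, (k : ℝ) ^ 2 * φ k) + 1, fun n ω => ?_⟩
  have hx := abs_X_le_Sstar n ω
  have h1 := mul_nonneg (hφ_nonneg (Sstar n ω)) (sub_nonneg.2 hx)
  have h2 := tailSum_nonneg hφ_nonneg (Sstar n ω)
  have h3 : tailSum φ (Sstar n ω) ≤ 1 := by
    have hs : Summable fun k => φ (Sstar n ω + k) := by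
      simpa only [add_comm] using (summable_nat_add_iff (Sstar n ω)).2 hφ_sum.summable
    rw [← hφ_sum.tsum_eq]
    exact Summable.tsum_le_tsum_of_inj (fun k => Sstar n ω + k) (add_right_injective _)
      (fun c _ => hφ_nonneg c) (fun _ => le_rfl) hs hφ_sum.summable
  have h4 : φ (Sstar n ω) * ((Sstar n ω : ℝ) - |(X n ω : ℝ)|) ≤
      ∑' k : ℕ, (k : ℝ) ^ 2 * φ k := by
    refine le_trans ?_ (hφ_sq.le_tsum (Sstar n ω) fun k _ => mul_nonneg (sq_nonneg _) (hφ_nonneg k))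
    rw [mul_comm]
    refine mul_le_mul_of_nonneg_right ?_ (hφ_nonneg _)
    have : (Sstar n ω : ℝ) ≤ (Sstar n ω : ℝ) ^ 2 := by exact_mod_cast Nat.le_self_pow two_ne_zero _
    linarith [abs_nonneg (X n ω : ℝ)]
  change φ (Rstar n ω) * |(X n ω : ℝ)| ≤ φ (Rstar n ω) * |(X n ω : ℝ)| + _ + _ ∧
    φ (Rstar n ω) * |(X n ω : ℝ)| + _ + _ ≤ _
  constructor <;> linarith

/-- On paths without zeros in `(N, m]`, the unbounded part of `M*_m` has an integral independent of
`m`, and the bounded remainder contributes at most `C ℙ(no zero in (N, m])`, which tends to `0`. -/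
lemma measureReal_noZeroAfter {φ : ℕ → ℝ} (hφ_nonneg : ∀ k, 0 ≤ φ k) (hφ_sum : HasSum φ 1)
    (hφ_sq : Summable fun k : ℕ => (k : ℝ) ^ 2 * φ k) {Q : Measure Path} [IsProbabilityMeasure Q]
    (hQ : IsInducedBy φ Q) {N : ℕ} {Λ : Set Path} (hΛ : MeasurableSet[canonFiltration N] Λ) :
    Q.real (Λ ∩ noZeroAfter N) = ∫ ω in Λ, φ (Rstar N ω) * absOrOne N ω ∂walkLaw := by
  obtain ⟨C, hC⟩ := Mstar_rest_bound hφ_nonneg hφ_sum hφ_sq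
  have hΛm := canonFiltration.le N Λ hΛ
  have hmeas : ∀ m, MeasurableSet (Λ ∩ noZeroBetween N m) := fun m =>
    hΛm.inter (canonFiltration.le m _ (measurableSet_noZeroBetween N m))
  have hlim : Tendsto (fun m => Q.real (Λ ∩ noZeroBetween N m)) atTop
      (𝓝 (Q.real (Λ ∩ noZeroAfter N))) := by
    rw [noZeroAfter_eq_iInter, Set.inter_iInter]
    refine (ENNReal.tendsto_toReal (measure_ne_top _ _)).comp
      (tendsto_measure_iInter_atTop (fun m => (hmeas m).nullMeasurableSet) ?_
        ⟨0, measure_ne_top _ _⟩)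
    exact fun m m' h ω hω => ⟨hω.1, fun j h1 h2 => hω.2 j h1 (h2.trans h)⟩
  refine tendsto_nhds_unique hlim ?_
  set I := ∫ ω in Λ, φ (Rstar N ω) * absOrOne N ω ∂walkLaw with hI
  have hup : Tendsto (fun m => I + C * walkLaw.real (noZeroBetween N m)) atTop (𝓝 I) := by
    simpa using ((tendsto_noZeroBetween N).const_mul C).const_add I
  -- The two inequalities at an arbitrary path force the sign of `C`.
  have hC0 : 0 ≤ C := by
    have := hC 0 (pathOfCoins fun _ => true); linarith [this.1, this.2]
  have main : ∀ m, N < m → I ≤ Q.real (Λ ∩ noZeroBetween N m) ∧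
      Q.real (Λ ∩ noZeroBetween N m) ≤ I + C * walkLaw.real (noZeroBetween N m) := by
    intro m hm
    have hF : MeasurableSet[canonFiltration m] (Λ ∩ noZeroBetween N m) :=
      (canonFiltration.mono hm.le Λ hΛ).inter (measurableSet_noZeroBetween N m)
    have h1 : I = ∫ ω in Λ ∩ noZeroBetween N m, φ (Rstar m ω) * |(X m ω : ℝ)| ∂walkLaw := by
      rw [hI, ← setIntegral_noZeroBetween φ hm.le hΛ]
      exact setIntegral_congr_fun (hmeas m) fun ω hω => by
        simp only [absOrOne_of_ne (hω.2 m hm le_rfl)]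
    have hi1 : Integrable (fun ω => φ (Rstar m ω) * |(X m ω : ℝ)|) walkLaw :=
      ((dependsUpTo_Rstar m).comp₂ (dependsUpTo_abs_X m) fun r x => φ r * x).integrable
    have hi2 := (dependsUpTo_Mstar φ m).integrable
    rw [hQ m _ hF, h1]
    refine ⟨setIntegral_mono hi1.integrableOn hi2.integrableOn fun ω => (hC m ω).1, ?_⟩
    calc ∫ ω in Λ ∩ noZeroBetween N m, Mstar φ m ω ∂walkLaw
        ≤ ∫ ω in Λ ∩ noZeroBetween N m, (φ (Rstar m ω) * |(X m ω : ℝ)| + C) ∂walkLaw :=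
          setIntegral_mono hi2.integrableOn (hi1.add (integrable_const C)).integrableOn
            fun ω => (hC m ω).2
      _ = (∫ ω in Λ ∩ noZeroBetween N m, φ (Rstar m ω) * |(X m ω : ℝ)| ∂walkLaw) +
            C * walkLaw.real (Λ ∩ noZeroBetween N m) := by
          rw [integral_add hi1.integrableOn (integrable_const C)]
          simp [mul_comm]
      _ ≤ _ := by
          have := mul_le_mul_of_nonneg_left
            (measureReal_mono (μ := walkLaw) (Set.inter_subset_right (s := Λ)
              (t := noZeroBetween N m))) hC0
          linarith
  refine tendsto_of_tendsto_of_tendsto_of_le_of_le' tendsto_const_nhds hup ?_ ?_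
  · filter_upwards [eventually_gt_atTop N] with m hm using (main m hm).1
  · filter_upwards [eventually_gt_atTop N] with m hm using (main m hm).2

/-- The paths whose last zero is `n`. -/
def lastZeroAt (n : ℕ) : Set Path := {ω | X n ω = 0} ∩ noZeroAfter n

lemma measurableSet_lastZeroAt (n : ℕ) : MeasurableSet (lastZeroAt n) :=
  (measurable_X n (measurableSet_singleton 0)).inter (measurableSet_noZeroAfter n)

lemma measure_inter_lastZeroAt {φ : ℕ → ℝ} (hφ_nonneg : ∀ k, 0 ≤ φ k) (hφ_sum : HasSum φ 1)
    (hφ_sq : Summable fun k : ℕ => (k : ℝ) ^ 2 * φ k) {Q : Measure Path} [IsProbabilityMeasure Q]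
    (hQ : IsInducedBy φ Q) {n k : ℕ} {Λ : Set Path} (hΛ : MeasurableSet[canonFiltration n] Λ)
    (hk : ∀ ω ∈ Λ, Sstar n ω = k) :
    Q (Λ ∩ lastZeroAt n) = ENNReal.ofReal (φ k) * walkLaw (Λ ∩ {ω | X n ω = 0}) := by
  have hX : MeasurableSet[canonFiltration n] {ω | X n ω = 0} :=
    ((dependsUpTo_X le_rfl).comp (· = 0)).measurableSet_canonFiltration
  have h := measureReal_noZeroAfter hφ_nonneg hφ_sum hφ_sq hQ (hΛ.inter hX)
  rw [lastZeroAt, ← Set.inter_assoc, ← ofReal_measureReal, h,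
    setIntegral_congr_fun (g := fun _ => φ k) (canonFiltration.le n _ (hΛ.inter hX)),
    setIntegral_const, smul_eq_mul, mul_comm, ENNReal.ofReal_mul (hφ_nonneg k),
    ofReal_measureReal]
  rintro ω ⟨h1, h2⟩
  have h2' : X n ω = 0 := h2
  simp only [Rstar_eq_Sstar h2', hk ω h1, absOrOne, h2']
  simp

/-! ### The number of zeros and the maximum at a zero, for the random walk -/

/-- The walk is, at time `n`, at its `a`-th zero, and has remained in `[-k, k]`. -/
def confinedZero (a k n : ℕ) : Set Path :=
  {ω | X n ω = 0 ∧ zeroCount n ω = a ∧ Sstar n ω ≤ k}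

/-- The weight of the excursions that follow the `a`-th zero. -/
def excursionWeight (a k n : ℕ) (ω : Path) : ℝ :=
  if X n ω ≠ 0 ∧ zeroCount n ω = a ∧ Sstar n ω ≤ k then 1 - |(X n ω : ℝ)| / (k + 1) else 0

lemma dependsUpTo_confinedZero (a k n : ℕ) : DependsUpTo n fun ω => ω ∈ confinedZero a k n :=
  fun ω ω' h => by
    simp only [confinedZero, Set.mem_ofPred_eq, dependsUpTo_X le_rfl ω ω' h,
      dependsUpTo_zeroCount n ω ω' h, dependsUpTo_Sstar n ω ω' h]

lemma dependsUpTo_excursionWeight (a k n : ℕ) : DependsUpTo n (excursionWeight a k n) :=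
  fun ω ω' h => by
    simp only [excursionWeight, dependsUpTo_X le_rfl ω ω' h,
      dependsUpTo_zeroCount n ω ω' h, dependsUpTo_Sstar n ω ω' h]

lemma measurableSet_confinedZero (a k n : ℕ) : MeasurableSet (confinedZero a k n) :=
  canonFiltration.le n _ (measurableSet_canonFiltration_iff.2 (dependsUpTo_confinedZero a k n))

/-- Gambler's ruin: `1 - |x|/(k+1)` is the probability of reaching `0` before `±(k+1)`. A new
excursion starts from `±1` and so has weight `k/(k+1)`; a completed one is converted into the
indicator of the next zero. -/
lemma excursionWeight_step (a k n : ℕ) (ω : Path) :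
    (excursionWeight a k (n + 1) ω + (confinedZero (a + 1) k (n + 1)).indicator 1 ω) +
      (excursionWeight a k (n + 1) (flip n ω)
        + (confinedZero (a + 1) k (n + 1)).indicator 1 (flip n ω)) =
    2 * (excursionWeight a k n ω
      + (k : ℝ) / (k + 1) * (confinedZero a k n).indicator 1 ω) := by
  classical
  have hk : (k : ℝ) + 1 ≠ 0 := by positivity
  have hxs := natAbs_X_le_Sstar n ω
  -- the value one step later, as a function of the new position
  have key : ∀ ω', zeroCount n ω' = zeroCount n ω → Sstar n ω' = Sstar n ω →
      (X (n + 1) ω').natAbs ≤ k + 1 →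
      excursionWeight a k (n + 1) ω' + (confinedZero (a + 1) k (n + 1)).indicator 1 ω' =
        if zeroCount n ω = a ∧ Sstar n ω ≤ k then
          1 - ((X (n + 1) ω').natAbs : ℝ) / (k + 1) else 0 := by
    intro ω' hc hs hx
    unfold excursionWeight
    rw [Set.indicator_apply]
    simp only [confinedZero, Set.mem_ofPred_eq, zeroCount_succ, Sstar_succ, hc, hs, abs_X_eq]
    by_cases h0 : X (n + 1) ω' = 0
    · simp [h0]
    · simp only [h0, ne_eq, not_false_eq_true, true_and, if_false, add_zero, false_and]
      by_cases hcond : zeroCount n ω = a ∧ Sstar n ω ≤ k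
      · rw [if_pos hcond]
        by_cases hx' : (X (n + 1) ω').natAbs ≤ k
        · rw [if_pos ⟨hcond.1, max_le hcond.2 hx'⟩]
        -- The exit through `±(k+1)` is cut off by the definition, in agreement with the affine
        -- formula, which is `0` there.
        · have : (X (n + 1) ω').natAbs = k + 1 := by omega
          rw [if_neg fun h => hx' ((le_max_right _ _).trans h.2), this]
          push_cast
          rw [div_self hk, sub_self]
      · rw [if_neg hcond, if_neg fun h => hcond ⟨h.1, (le_max_left _ _).trans h.2⟩]
  by_cases hcond : zeroCount n ω = a ∧ Sstar n ω ≤ k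
  · have hb : (X (n + 1) ω).natAbs ≤ k + 1 ∧ (X (n + 1) (flip n ω)).natAbs ≤ k + 1 := by
      rcases natAbs_X_succ n ω with h | ⟨y, h⟩ <;> omega
    rw [key ω rfl rfl hb.1, key _ ((dependsUpTo_zeroCount n).flip ω) ((dependsUpTo_Sstar n).flip ω)
      hb.2, if_pos hcond]
    unfold excursionWeight
    rw [Set.indicator_apply]
    simp only [confinedZero, Set.mem_ofPred_eq, hcond, and_true, abs_X_eq]
    rcases natAbs_X_succ n ω with ⟨h0, h1, h2⟩ | ⟨y, h0, h12⟩
    · rw [h1, h2]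
      simp only [h0, ne_eq, not_true_eq_false, if_false, if_true, Pi.one_apply]
      field_simp
      push_cast
      ring
    · have hx0 : X n ω ≠ 0 := by intro h; simp [h] at h0
      rw [h0]
      simp only [hx0, ne_eq, not_false_eq_true, if_true, if_false]
      rcases h12 with ⟨h1, h2⟩ | ⟨h1, h2⟩ <;> rw [h1, h2] <;> field_simp <;> push_cast <;> ring
  · have hz : ∀ ω', zeroCount n ω' = zeroCount n ω → Sstar n ω' = Sstar n ω →
        excursionWeight a k (n + 1) ω' + (confinedZero (a + 1) k (n + 1)).indicator 1 ω' = 0 := by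
      intro ω' hc hs
      unfold excursionWeight
      rw [Set.indicator_apply]
      simp only [confinedZero, Set.mem_ofPred_eq, zeroCount_succ, Sstar_succ, hc, hs]
      by_cases h0 : X (n + 1) ω' = 0
      · simpa [h0] using fun h1 h2 => hcond ⟨h1, h2⟩
      · simp only [h0, ne_eq, not_false_eq_true, true_and, if_false, add_zero, false_and]
        rw [if_neg fun h => hcond ⟨h.1, (le_max_left _ _).trans h.2⟩]
    rw [hz ω rfl rfl, hz _ ((dependsUpTo_zeroCount n).flip ω) ((dependsUpTo_Sstar n).flip ω)]
    have hnot : ω ∉ confinedZero a k n := fun h => hcond h.2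
    rw [Set.indicator_of_notMem hnot, excursionWeight, if_neg fun h => hcond h.2]
    simp

lemma integral_excursionWeight_succ (a k n : ℕ) :
    (∫ ω, excursionWeight a k (n + 1) ω ∂walkLaw) + walkLaw.real (confinedZero (a + 1) k (n + 1)) =
      (∫ ω, excursionWeight a k n ω ∂walkLaw) +
        (k : ℝ) / (k + 1) * walkLaw.real (confinedZero a k n) := by
  have hi : ∀ a n, Integrable ((confinedZero a k n).indicator (1 : Path → ℝ)) walkLaw :=
    fun a n => (integrable_indicator_iff (measurableSet_confinedZero a k n)).2
      (integrable_const 1).integrableOn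
  have hw := fun n => (dependsUpTo_excursionWeight a k n).integrable
  have hd : DependsUpTo (n + 1) fun ω => excursionWeight a k (n + 1) ω +
      (confinedZero (a + 1) k (n + 1)).indicator (1 : Path → ℝ) ω :=
    (dependsUpTo_excursionWeight a k (n + 1)).comp₂
      (((dependsUpTo_const (n + 1) (1 : ℝ))).indicator
        (measurableSet_canonFiltration_iff.2 (dependsUpTo_confinedZero (a + 1) k (n + 1))))
      (· + ·)
  have h := setIntegral_step (n := n) (Λ := Set.univ) MeasurableSet.univ hd
    fun ω _ => excursionWeight_step a k n ω
  rw [setIntegral_univ, setIntegral_univ, integral_add (hw _) (hi _ _),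
    integral_add (hw _) ((hi _ _).const_mul _), integral_const_mul,
    integral_indicator_one (measurableSet_confinedZero _ _ _),
    integral_indicator_one (measurableSet_confinedZero _ _ _)] at h
  exact h

lemma excursionWeight_nonneg (a k n : ℕ) (ω : Path) : 0 ≤ excursionWeight a k n ω := by
  unfold excursionWeight
  split_ifs with h
  · rw [sub_nonneg]
    refine div_le_one_of_le₀ ((abs_X_le_Sstar n ω).trans ?_) (by positivity)
    exact_mod_cast h.2.2.trans k.le_succ
  · exact le_rfl

lemma tendsto_integral_excursionWeight (a k : ℕ) :
    Tendsto (fun n => ∫ ω, excursionWeight a k n ω ∂walkLaw) atTop (𝓝 0) := by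
  refine tendsto_of_tendsto_of_tendsto_of_le_of_le tendsto_const_nhds
    (tendsto_measureReal_Rstar_le k) (fun n => integral_nonneg (excursionWeight_nonneg a k n))
    fun n => ?_
  rw [← integral_indicator_one (measurableSet_Rstar_le n k)]
  refine integral_mono (dependsUpTo_excursionWeight a k n).integrable
    ((integrable_indicator_iff (measurableSet_Rstar_le n k)).2 (integrable_const 1).integrableOn)
    fun ω => ?_
  unfold excursionWeight
  split_ifs with h
  · rw [Set.indicator_of_mem (show ω ∈ {ω | Rstar n ω ≤ k} from
      (Rstar_le_Sstar n ω).trans h.2.2)]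
    exact sub_le_self _ (by positivity)
  · exact Set.indicator_nonneg (fun _ _ => zero_le_one) _

lemma zeroCount_pos {n : ℕ} {ω : Path} (h : X n ω = 0) : 0 < zeroCount n ω := by
  cases n with
  | zero => rw [zeroCount_zero, if_pos h]; exact one_pos
  | succ n => rw [zeroCount_succ, if_pos h]; exact Nat.succ_pos _

lemma zeroCount_succ_of_zero {n : ℕ} {ω : Path} (h0 : X 0 ω = 0) (h : X (n + 1) ω = 0) :
    2 ≤ zeroCount (n + 1) ω := by
  rw [zeroCount_succ, if_pos h]
  have h1 := zeroCount_mono ω (Nat.zero_le n)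
  have h2 := zeroCount_pos h0
  simp only at h1
  omega

/-- The sum over `n` is `ℙ(S*_{τ_{a+1}} ≤ k)`: each of the first `a` excursions stays in `[-k, k]`
with probability `k/(k+1)`. The induction on `a` telescopes the one-step identity over time. -/
lemma hasSum_confinedZero (a k : ℕ) :
    HasSum (fun n => walkLaw.real (confinedZero (a + 1) k n)) (((k : ℝ) / (k + 1)) ^ a) := by
  induction a with
  | zero =>
    have h0 : walkLaw.real (confinedZero 1 k 0) = 1 := by
      rw [measureReal_def, (prob_compl_eq_zero_iff (measurableSet_confinedZero 1 k 0)).1]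
      · simp
      · refine ae_iff.1 ?_
        filter_upwards [ae_X_zero] with ω hω
        refine ⟨hω, ?_, ?_⟩
        · rw [zeroCount_zero, if_pos hω]
        · simp [Sstar_zero, hω]
    have hs : ∀ n ≠ 0, walkLaw.real (confinedZero (0 + 1) k n) = 0 := by
      intro n hn
      obtain ⟨n, rfl⟩ := Nat.exists_eq_succ_of_ne_zero hn
      rw [measureReal_def, measure_eq_zero_iff_ae_notMem.2, ENNReal.toReal_zero]
      filter_upwards [ae_X_zero] with ω hω h
      have h1 : 2 ≤ zeroCount (n + 1) ω := zeroCount_succ_of_zero hω h.1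
      have h2 : zeroCount (n + 1) ω = 1 := h.2.1
      omega
    simpa [h0] using hasSum_single 0 hs
  | succ a ih =>
    have hshift : walkLaw.real (confinedZero (a + 1 + 1) k 0) = 0 := by
      have : confinedZero (a + 1 + 1) k 0 = ∅ := by
        refine Set.eq_empty_of_forall_notMem fun ω h => ?_
        have := h.2.1
        rw [zeroCount_zero] at this
        split_ifs at this; all_goals omega
      rw [this, measureReal_empty]
    have hD0 : ∫ ω, excursionWeight (a + 1) k 0 ω ∂walkLaw = 0 := by
      refine integral_eq_zero_of_ae ?_
      filter_upwards [ae_X_zero] with ω hω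
      simp [excursionWeight, hω]
    -- What is missing at time `M` is the weight of the unfinished excursion, which tends to `0`.
    have hsum : ∀ M, ∑ n ∈ Finset.range M, walkLaw.real (confinedZero (a + 1 + 1) k (n + 1)) =
        (k : ℝ) / (k + 1) * ∑ n ∈ Finset.range M, walkLaw.real (confinedZero (a + 1) k n) -
          ∫ ω, excursionWeight (a + 1) k M ω ∂walkLaw := by
      intro M
      induction M with
      | zero => simp [hD0]
      | succ M ihM =>
        have := integral_excursionWeight_succ (a + 1) k M
        rw [Finset.sum_range_succ, Finset.sum_range_succ, ihM]
        linarith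
    have hlim : HasSum (fun n => walkLaw.real (confinedZero (a + 1 + 1) k (n + 1)))
        (((k : ℝ) / (k + 1)) ^ (a + 1)) := by
      rw [hasSum_iff_tendsto_nat_of_nonneg fun _ => measureReal_nonneg]
      simp only [hsum]
      have := (ih.tendsto_sum_nat.const_mul ((k : ℝ) / (k + 1))).sub
        (tendsto_integral_excursionWeight (a + 1) k)
      rwa [sub_zero, ← pow_succ'] at this
    rw [← hasSum_nat_add_iff' 1]
    simpa [hshift] using hlim

/-- The walk is, at time `n`, at its `a`-th zero, and the maximum of its absolute value is `k`. -/
def zeroAt (a k n : ℕ) : Set Path := {ω | X n ω = 0 ∧ zeroCount n ω = a ∧ Sstar n ω = k}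

lemma measurableSet_zeroAt (a k n : ℕ) : MeasurableSet (zeroAt a k n) := by
  refine canonFiltration.le n _ (measurableSet_canonFiltration_iff.2 fun ω ω' h => ?_)
  simp only [zeroAt, Set.mem_ofPred_eq, dependsUpTo_X le_rfl ω ω' h,
    dependsUpTo_zeroCount n ω ω' h, dependsUpTo_Sstar n ω ω' h]

lemma hasSum_zeroAt (φ : ℕ → ℝ) (a k : ℕ) :
    HasSum (fun n => φ k * walkLaw.real (zeroAt a k n)) (jointLaw φ a k) := by
  cases a with
  | zero =>
    have h : ∀ n, zeroAt 0 k n = ∅ := fun n =>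
      Set.eq_empty_of_forall_notMem fun ω h => (zeroCount_pos h.1).ne' h.2.1
    simp [h, jointLaw, hasSum_zero]
  | succ a =>
    cases k with
    | zero =>
      have h : ∀ n, zeroAt (a + 1) 0 n = confinedZero (a + 1) 0 n := fun n => by
        ext ω; simp [zeroAt, confinedZero]
      have := (hasSum_confinedZero a 0).mul_left (φ 0)
      simp only [h]
      have e : jointLaw φ (a + 1) 0 = φ 0 * (((0 : ℕ) : ℝ) / ((0 : ℕ) + 1)) ^ a := by
        rcases Nat.eq_zero_or_pos a with rfl | ha
        · simp [jointLaw]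
        · simp [jointLaw, ha.ne']
      rwa [e]
    | succ k =>
      have h : ∀ n, walkLaw.real (zeroAt (a + 1) (k + 1) n) =
          walkLaw.real (confinedZero (a + 1) (k + 1) n) -
            walkLaw.real (confinedZero (a + 1) k n) := fun n => by
        have hu : confinedZero (a + 1) (k + 1) n =
            confinedZero (a + 1) k n ∪ zeroAt (a + 1) (k + 1) n := by
          ext ω
          simp only [confinedZero, zeroAt, Set.mem_union, Set.mem_ofPred_eq, Nat.le_succ_iff]
          tauto
        rw [hu, measureReal_union (Set.disjoint_left.2 fun ω h1 h2 => ?_)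
          (measurableSet_zeroAt _ _ _)]
        · ring
        · have h3 := h1.2.2
          have h4 := h2.2.2
          omega
      simp only [h]
      have e : jointLaw φ (a + 1) (k + 1) = φ (k + 1) *
          ((((k + 1 : ℕ) : ℝ) / (((k + 1 : ℕ) : ℝ) + 1)) ^ a - ((k : ℝ) / (k + 1)) ^ a) := by
        rcases Nat.eq_zero_or_pos a with rfl | ha
        · simp [jointLaw]
        · have hk1 : 1 - 1 / (((k + 1 : ℕ) : ℝ) + 1) =
              ((k + 1 : ℕ) : ℝ) / (((k + 1 : ℕ) : ℝ) + 1) := by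
            push_cast; field_simp; ring
          have hk2 : 1 - 1 / ((k + 1 : ℕ) : ℝ) = (k : ℝ) / ((k : ℝ) + 1) := by
            push_cast; field_simp; ring
          rw [jointLaw, if_neg (by omega), if_pos ⟨by omega, by omega⟩, hk1, hk2,
            Nat.add_sub_cancel]
          ring
      rw [e]
      exact ((hasSum_confinedZero a (k + 1)).sub (hasSum_confinedZero a k)).mul_left (φ (k + 1))

/-- For `k > 0` the two geometric series have sums `k + 1` and `k`. -/
lemma hasSum_jointLaw (φ : ℕ → ℝ) (k : ℕ) : HasSum (fun a => jointLaw φ a k) (φ k) := by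
  cases k with
  | zero =>
    have h := hasSum_single (f := fun a => jointLaw φ a 0) 1 fun a ha => by simp [jointLaw, ha]
    simpa [jointLaw] using h
  | succ k =>
    rw [← hasSum_nat_add_iff' 1]
    have e0 : jointLaw φ 0 (k + 1) = 0 := by simp [jointLaw]
    have h1 : HasSum (fun a => (1 - 1 / (((k + 1 : ℕ) : ℝ) + 1)) ^ a)
        (1 - (1 - 1 / (((k + 1 : ℕ) : ℝ) + 1)))⁻¹ :=
      hasSum_geometric_of_lt_one
        (sub_nonneg.2 (div_le_one_of_le₀ (by push_cast; linarith [(Nat.cast_nonneg k : (0:ℝ) ≤ k)])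
          (by positivity)))
        (sub_lt_self _ (by positivity))
    have h2 : HasSum (fun a => (1 - 1 / ((k + 1 : ℕ) : ℝ)) ^ a)
        (1 - (1 - 1 / ((k + 1 : ℕ) : ℝ)))⁻¹ :=
      hasSum_geometric_of_lt_one
        (sub_nonneg.2 (div_le_one_of_le₀ (by push_cast; linarith [(Nat.cast_nonneg k : (0:ℝ) ≤ k)])
          (by positivity)))
        (sub_lt_self _ (by positivity))
    have h3 := (h1.sub h2).mul_right (φ (k + 1))
    have e1 : ∀ a, ((1 - 1 / (((k + 1 : ℕ) : ℝ) + 1)) ^ a - (1 - 1 / ((k + 1 : ℕ) : ℝ)) ^ a) *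
        φ (k + 1) = jointLaw φ (a + 1) (k + 1) := fun a => by
      rcases Nat.eq_zero_or_pos a with rfl | ha
      · simp [jointLaw]
      · rw [jointLaw, if_neg (by omega), if_pos ⟨by omega, by omega⟩, Nat.add_sub_cancel]
    have e2 : ((1 - (1 - 1 / (((k + 1 : ℕ) : ℝ) + 1)))⁻¹ - (1 - (1 - 1 / ((k + 1 : ℕ) : ℝ)))⁻¹) *
        φ (k + 1) = φ (k + 1) := by
      rw [sub_sub_cancel, sub_sub_cancel, one_div, one_div, inv_inv, inv_inv]
      ring
    simp only [e1, e2] at h3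
    rwa [Finset.sum_range_one, e0, sub_zero]

lemma jointLaw_nonneg {φ : ℕ → ℝ} (hφ_nonneg : ∀ k, 0 ≤ φ k) (a k : ℕ) : 0 ≤ jointLaw φ a k :=
  (hasSum_zeroAt φ a k).nonneg fun _ => mul_nonneg (hφ_nonneg k) measureReal_nonneg

/-! ### The last zero is finite under the induced probability -/

lemma measure_eq_tsum_inter_fiber {Ω ι : Type*} [MeasurableSpace Ω] [Countable ι] (μ : Measure Ω)
    {E : Set Ω} (hE : MeasurableSet E) (f : Ω → ι) (hf : ∀ i, MeasurableSet (f ⁻¹' {i})) :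
    μ E = ∑' i, μ (E ∩ f ⁻¹' {i}) := by
  rw [← measure_iUnion (fun i j hij => ?_) fun i => hE.inter (hf i), ← Set.inter_iUnion]
  · congr 1
    ext ω
    simp
  · exact Set.disjoint_left.2 fun ω h1 h2 => hij (h1.2.symm.trans h2.2)

lemma pairwise_disjoint_lastZeroAt : Pairwise (Function.onFun Disjoint lastZeroAt) :=
  fun m n hmn => Set.disjoint_left.2 fun _ h1 h2 => by
    rcases lt_or_gt_of_ne hmn with h | h
    · exact h1.2 n h h2.1
    · exact h2.2 m h h1.1

lemma measure_zeroAt_inter_lastZeroAt {φ : ℕ → ℝ} (hφ_nonneg : ∀ k, 0 ≤ φ k)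
    (hφ_sum : HasSum φ 1) (hφ_sq : Summable fun k : ℕ => (k : ℝ) ^ 2 * φ k) {Q : Measure Path}
    [IsProbabilityMeasure Q] (hQ : IsInducedBy φ Q) (a k n : ℕ) :
    Q (lastZeroAt n ∩ {ω | zeroCount n ω = a ∧ Sstar n ω = k}) =
      ENNReal.ofReal (φ k * walkLaw.real (zeroAt a k n)) := by
  have hΛ : MeasurableSet[canonFiltration n] {ω | zeroCount n ω = a ∧ Sstar n ω = k} :=
    ((dependsUpTo_zeroCount n).comp₂ (dependsUpTo_Sstar n)
      fun c s => c = a ∧ s = k).measurableSet_canonFiltration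
  rw [Set.inter_comm, measure_inter_lastZeroAt hφ_nonneg hφ_sum hφ_sq hQ hΛ fun ω h => h.2,
    ENNReal.ofReal_mul (hφ_nonneg k), ofReal_measureReal]
  congr 2
  ext ω
  simp only [zeroAt, Set.mem_inter_iff, Set.mem_ofPred_eq]
  tauto

/-- The disjoint events `{g = n}`, split according to the number of zeros and the maximum, have
total mass `∑ φ(k) = 1`. -/
lemma ae_exists_lastZeroAt {φ : ℕ → ℝ} (hφ_nonneg : ∀ k, 0 ≤ φ k) (hφ_sum : HasSum φ 1)
    (hφ_sq : Summable fun k : ℕ => (k : ℝ) ^ 2 * φ k) {Q : Measure Path} [IsProbabilityMeasure Q]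
    (hQ : IsInducedBy φ Q) : ∀ᵐ ω ∂Q, ∃ n, ω ∈ lastZeroAt n := by
  have hm : ∀ n (p : ℕ × ℕ), MeasurableSet ((fun ω => (Sstar n ω, zeroCount n ω)) ⁻¹' {p}) :=
    fun n p => ((dependsUpTo_Sstar n).comp₂ (dependsUpTo_zeroCount n) Prod.mk).measurable
      (measurableSet_singleton p)
  have h1 : Q (⋃ n, lastZeroAt n) = 1 := by
    rw [measure_iUnion pairwise_disjoint_lastZeroAt measurableSet_lastZeroAt]
    have h2 : ∀ n, Q (lastZeroAt n) =
        ∑' p : ℕ × ℕ, ENNReal.ofReal (φ p.1 * walkLaw.real (zeroAt p.2 p.1 n)) := fun n => by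
      rw [measure_eq_tsum_inter_fiber Q (measurableSet_lastZeroAt n) _ (hm n)]
      refine tsum_congr fun p => ?_
      rw [← measure_zeroAt_inter_lastZeroAt hφ_nonneg hφ_sum hφ_sq hQ]
      congr 2
      ext ω
      simp only [Set.mem_preimage, Set.mem_singleton_iff, Prod.ext_iff, Set.mem_ofPred_eq]
      tauto
    simp only [h2]
    rw [ENNReal.tsum_comm, ENNReal.tsum_prod
      (f := fun k a => ∑' n, ENNReal.ofReal (φ k * walkLaw.real (zeroAt a k n)))]
    have h3 : ∀ k a, ∑' n, ENNReal.ofReal (φ k * walkLaw.real (zeroAt a k n)) =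
        ENNReal.ofReal (jointLaw φ a k) := fun k a => by
      rw [← (hasSum_zeroAt φ a k).tsum_eq, ENNReal.ofReal_tsum_of_nonneg
        (fun n => mul_nonneg (hφ_nonneg k) measureReal_nonneg) (hasSum_zeroAt φ a k).summable]
    have h4 : ∀ k, ∑' a, ENNReal.ofReal (jointLaw φ a k) = ENNReal.ofReal (φ k) := fun k => by
      rw [← (hasSum_jointLaw φ k).tsum_eq, ENNReal.ofReal_tsum_of_nonneg
        (fun a => jointLaw_nonneg hφ_nonneg a k) (hasSum_jointLaw φ k).summable]
    simp only [h3, h4]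
    rw [← ENNReal.ofReal_tsum_of_nonneg hφ_nonneg hφ_sum.summable, hφ_sum.tsum_eq,
      ENNReal.ofReal_one]
  have h2 := (prob_compl_eq_zero_iff (MeasurableSet.iUnion measurableSet_lastZeroAt)).2 h1
  filter_upwards [measure_eq_zero_iff_ae_notMem.1 h2] with ω hω
  simpa using hω

/-- Summation over the value of the last zero. -/
lemma measure_eq_tsum_lastZeroAt {φ : ℕ → ℝ} (hφ_nonneg : ∀ k, 0 ≤ φ k) (hφ_sum : HasSum φ 1)
    (hφ_sq : Summable fun k : ℕ => (k : ℝ) ^ 2 * φ k) {Q : Measure Path} [IsProbabilityMeasure Q]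
    (hQ : IsInducedBy φ Q) {E : Set Path} {E' : ℕ → Set Path} (hE' : ∀ n, MeasurableSet (E' n))
    (h : ∀ n, ∀ ω ∈ lastZeroAt n, (ω ∈ E ↔ ω ∈ E' n)) :
    Q E = ∑' n, Q (E' n ∩ lastZeroAt n) := by
  rw [← measure_iUnion (pairwise_disjoint_lastZeroAt.mono fun i j hij =>
    hij.mono Set.inter_subset_right Set.inter_subset_right)
    fun n => (hE' n).inter (measurableSet_lastZeroAt n)]
  refine measure_congr ?_
  filter_upwards [ae_exists_lastZeroAt hφ_nonneg hφ_sum hφ_sq hQ] with ω ⟨n, hn⟩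
  refine propext (Iff.trans (?_ : ω ∈ E ↔ ω ∈ ⋃ n, E' n ∩ lastZeroAt n) Iff.rfl)
  rw [Set.mem_iUnion]
  exact ⟨fun hω => ⟨n, (h n ω hn).1 hω, hn⟩, fun ⟨m, hm, hm'⟩ => (h m ω hm').2 hm⟩

/-! ### The last zero and its measurability -/

lemma lastZero_eq {n : ℕ} {ω : Path} (h : ω ∈ lastZeroAt n) : lastZero ω = n := by
  refine le_antisymm (iSup₂_le fun k hk => ?_) (le_iSup₂ (f := fun (k : ℕ) _ => (k : ℕ∞)) n h.1)
  by_contra hn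
  exact h.2 k (by exact_mod_cast not_le.1 hn) hk

lemma g_eq {n : ℕ} {ω : Path} (h : ω ∈ lastZeroAt n) : g ω = n := by
  rw [g, lastZero_eq h, ENat.toNat_natCast]

lemma postG_eq {n : ℕ} {ω : Path} (h : ω ∈ lastZeroAt n) (i : ℕ) :
    postG i ω = X (n + 1 + i) ω := by rw [postG, g_eq h]

/-- Strict inequalities turn an infimum such as `tau` into a union of events about single times. A
supremum such as `lastZero` is treated in the dual order. -/
lemma measurable_of_measurableSet_lt {Ω α : Type*} [MeasurableSpace Ω] [MeasurableSpace α]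
    [LinearOrder α] [Countable α] {f : Ω → α}
    (h : ∀ x, MeasurableSet {ω | f ω < x}) : Measurable f := by
  refine measurable_to_countable' fun x => ?_
  have : f ⁻¹' {x} = {ω | f ω < x}ᶜ ∩ ⋂ y ∈ {y | x < y}, {ω | f ω < y} := by
    ext ω
    simp only [Set.mem_preimage, Set.mem_singleton_iff, Set.mem_inter_iff, Set.mem_compl_iff,
      Set.mem_ofPred_eq, Set.mem_iInter, not_lt]
    refine ⟨fun h => ⟨h.ge, fun y hy => h ▸ hy⟩, fun ⟨h1, h2⟩ => ?_⟩
    exact le_antisymm (not_lt.1 fun hlt => lt_irrefl _ (h2 _ hlt)) h1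
  rw [this]
  exact (h x).compl.inter (MeasurableSet.biInter (Set.to_countable _) fun y _ => h y)

lemma measurable_lastZero : Measurable lastZero := by
  have : Countable ℕ∞ᵒᵈ := inferInstanceAs (Countable ℕ∞)
  refine measurable_of_measurableSet_lt (α := ℕ∞ᵒᵈ) (f := fun ω => OrderDual.toDual (lastZero ω))
    fun x => ?_
  have : {ω | OrderDual.toDual (lastZero ω) < x} =
      ⋃ (k : ℕ) (_ : OrderDual.ofDual x < k), {ω | X k ω = 0} := by
    ext ω
    simp only [Set.mem_ofPred_eq, Set.mem_iUnion]
    change OrderDual.ofDual x < lastZero ω ↔ _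
    simp only [lastZero, lt_iSup_iff, exists_prop, Set.mem_ofPred_eq, and_comm]
  rw [this]
  exact MeasurableSet.iUnion fun k => MeasurableSet.iUnion fun _ =>
    measurable_X k (measurableSet_singleton 0)

lemma measurable_tau (a : ℕ) : Measurable (tau a) := by
  refine measurable_of_measurableSet_lt fun x => ?_
  have : {ω | tau a ω < x} = ⋃ (k : ℕ) (_ : (k : ℕ∞) < x), {ω | zeroCount k ω = a} := by
    ext ω
    simp only [tau, iInf_lt_iff, exists_prop, Set.mem_ofPred_eq, Set.mem_iUnion, and_comm]
  rw [this]
  exact MeasurableSet.iUnion fun k => MeasurableSet.iUnion fun _ =>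
    (dependsUpTo_zeroCount k).measurable (measurableSet_singleton a)

lemma measurable_g : Measurable g := (measurable_of_countable ENat.toNat).comp measurable_lastZero

lemma measurable_comp_index {Ω β : Type*} [MeasurableSpace Ω] [MeasurableSpace β]
    {F : ℕ → Ω → β} (hF : ∀ n, Measurable (F n)) {T : Ω → ℕ} (hT : Measurable T) :
    Measurable fun ω => F (T ω) ω :=
  (measurable_from_prod_countable_right (f := fun p : ℕ × Ω => F p.1 p.2) hF).comp
    (hT.prodMk measurable_id)

lemma measurable_pathUpTo {T : Path → ℕ} (hT : Measurable T) :
    Measurable fun ω => pathUpTo (T ω) ω :=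
  hT.prodMk (measurable_pi_lambda _ fun n =>
    measurable_comp_index (F := fun t ω => X (min n t) ω) (fun _ => measurable_X _) hT)

lemma measurable_postG (n : ℕ) : Measurable (postG n) :=
  measurable_comp_index (F := fun t ω => X (t + 1 + n) ω) (fun _ => measurable_X _) measurable_g

lemma dependsUpTo_pathUpTo (n : ℕ) : DependsUpTo n (pathUpTo n) := fun ω ω' h => by
  unfold pathUpTo
  congr 1
  funext m
  exact h _ (min_le_right m n)

/-! ### The path after the last zero -/

/-- The transition function of the walk conditioned to avoid zero, also from zero itself. -/
def avoidTrans (x z : ℤ) : ℝ :=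
  if |z - x| = 1 then |(z : ℝ)| / (2 * max |(x : ℝ)| 1) else 0

/-- The probability that the path after the last zero starts with `y 0, …, y m`. -/
def avoidProb : ℕ → (ℕ → ℤ) → ℝ
  | 0, y => avoidTrans 0 (y 0)
  | m + 1, y => avoidProb m y * avoidTrans (y m) (y (m + 1))

lemma avoidTrans_nonneg (x z : ℤ) : 0 ≤ avoidTrans x z := by
  unfold avoidTrans
  split_ifs <;> positivity

lemma avoidProb_nonneg (m : ℕ) (y : ℕ → ℤ) : 0 ≤ avoidProb m y := by
  induction m with
  | zero => exact avoidTrans_nonneg _ _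
  | succ m ih => exact mul_nonneg ih (avoidTrans_nonneg _ _)

/-- Of `ω` and `flip N ω`, exactly one steps to a neighbour `z` of `x`. The transition probability
is thus the ratio of the values of `max(|·|, 1)` at `z` and `x`, halved; the factor `φ(S*_g)` does
not change. -/
lemma measureReal_step_noZeroAfter {φ : ℕ → ℝ} (hφ_nonneg : ∀ k, 0 ≤ φ k) (hφ_sum : HasSum φ 1)
    (hφ_sq : Summable fun k : ℕ => (k : ℝ) ^ 2 * φ k) {Q : Measure Path} [IsProbabilityMeasure Q]
    (hQ : IsInducedBy φ Q) {N : ℕ} {Λ : Set Path} (hΛ : MeasurableSet[canonFiltration N] Λ)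
    {x : ℤ} (hx : ∀ ω ∈ Λ, X N ω = x) (z : ℤ) :
    Q.real (Λ ∩ {ω | X (N + 1) ω = z} ∩ noZeroAfter N) =
      Q.real (Λ ∩ noZeroAfter N) * avoidTrans x z := by
  by_cases hz0 : z = 0
  · have : Λ ∩ {ω | X (N + 1) ω = z} ∩ noZeroAfter N = ∅ :=
      Set.eq_empty_of_forall_notMem fun ω h => h.2 (N + 1) N.lt_succ_self (h.1.2.trans hz0)
    rw [this, measureReal_empty, avoidTrans, hz0]
    simp
  by_cases hzx : |z - x| = 1
  swap
  · have : Λ ∩ {ω | X (N + 1) ω = z} ∩ noZeroAfter N = ∅ :=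
      Set.eq_empty_of_forall_notMem fun ω h => hzx (by
        have h1 : X (N + 1) ω = z := h.1.2
        rw [← h1, ← hx ω h.1.1]
        exact ω.2 N)
    rw [this, measureReal_empty, avoidTrans, if_neg hzx, mul_zero]
  -- Since `z ≠ 0`, the condition at time `N + 1` is automatic, and the central formula applies at
  -- time `N + 1`.
  have hset : Λ ∩ {ω | X (N + 1) ω = z} ∩ noZeroAfter N =
      Λ ∩ {ω | X (N + 1) ω = z} ∩ noZeroAfter (N + 1) := by
    ext ω
    refine and_congr_right fun h => ⟨fun h' j hj => h' j (N.lt_succ_self.trans hj),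
      fun h' j hj => ?_⟩
    rcases (Nat.succ_le_of_lt hj).lt_or_eq with hlt | rfl
    · exact h' j hlt
    · exact fun h0 => hz0 (h.2.symm.trans h0)
  have hX : MeasurableSet[canonFiltration (N + 1)] {ω | X (N + 1) ω = z} :=
    ((dependsUpTo_X le_rfl).comp (· = z)).measurableSet_canonFiltration
  have hΛ' := (canonFiltration.mono N.le_succ Λ hΛ).inter hX
  rw [hset, measureReal_noZeroAfter hφ_nonneg hφ_sum hφ_sq hQ hΛ',
    measureReal_noZeroAfter hφ_nonneg hφ_sum hφ_sq hQ hΛ,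
    ← setIntegral_indicator (canonFiltration.le _ _ hX),
    setIntegral_step (Y := fun ω => φ (Rstar N ω) * absOrOne N ω * avoidTrans x z) hΛ
      ((dependsUpTo_φ_absOrOne φ (N + 1)).indicator hX), integral_mul_const]
  intro ω hω
  have hxω := hx ω hω
  have hval : ∀ ω', Rstar N ω' = Rstar N ω → X (N + 1) ω' = z →
      φ (Rstar (N + 1) ω') * absOrOne (N + 1) ω' = φ (Rstar N ω) * |(z : ℝ)| := by
    intro ω' hr h
    have h0 : X (N + 1) ω' ≠ 0 := h ▸ hz0
    rw [Rstar_succ, if_neg h0, absOrOne_of_ne h0, hr, h]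
  have hpos : max |(x : ℝ)| 1 ≠ 0 := (lt_max_of_lt_right one_pos).ne'
  have hrhs : 2 * (φ (Rstar N ω) * absOrOne N ω * avoidTrans x z) = φ (Rstar N ω) * |(z : ℝ)| := by
    rw [absOrOne, hxω, avoidTrans, if_pos hzx]
    field_simp
  rw [hrhs]
  have hflip := X_succ_flip N ω
  rw [hxω] at hflip
  have hsteps := X_succ_cases N ω
  rw [hxω] at hsteps
  have hz' : z = x + 1 ∨ z = x - 1 := by
    rcases (abs_eq zero_le_one).1 hzx with h | h <;> omega
  by_cases h : X (N + 1) ω = z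
  · have h' : X (N + 1) (flip N ω) ≠ z := by omega
    rw [Set.indicator_of_mem (show ω ∈ {ω | X (N + 1) ω = z} from h),
      Set.indicator_of_notMem (show flip N ω ∉ {ω | X (N + 1) ω = z} from h'), hval ω rfl h, add_zero]
  · have h' : X (N + 1) (flip N ω) = z := by omega
    rw [Set.indicator_of_notMem (show ω ∉ {ω | X (N + 1) ω = z} from h),
      Set.indicator_of_mem (show flip N ω ∈ {ω | X (N + 1) ω = z} from h'),
      hval _ ((dependsUpTo_Rstar N).flip ω) h', zero_add]

lemma measureReal_lastZeroAt_cylinder {φ : ℕ → ℝ} (hφ_nonneg : ∀ k, 0 ≤ φ k) (hφ_sum : HasSum φ 1)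
    (hφ_sq : Summable fun k : ℕ => (k : ℝ) ^ 2 * φ k) {Q : Measure Path} [IsProbabilityMeasure Q]
    (hQ : IsInducedBy φ Q) {n : ℕ} {Λ : Set Path} (hΛ : MeasurableSet[canonFiltration n] Λ)
    (m : ℕ) (y : ℕ → ℤ) :
    Q.real (Λ ∩ {ω | ∀ i ≤ m, X (n + 1 + i) ω = y i} ∩ lastZeroAt n) =
      Q.real (Λ ∩ lastZeroAt n) * avoidProb m y := by
  have hX : MeasurableSet[canonFiltration n] (Λ ∩ {ω | X n ω = 0}) :=
    hΛ.inter ((dependsUpTo_X le_rfl).comp (· = 0)).measurableSet_canonFiltration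
  have e1 : Λ ∩ lastZeroAt n = Λ ∩ {ω | X n ω = 0} ∩ noZeroAfter n := by
    rw [lastZeroAt, Set.inter_assoc]
  have e2 : ∀ C : Set Path, Λ ∩ C ∩ lastZeroAt n = Λ ∩ {ω | X n ω = 0} ∩ C ∩ noZeroAfter n := by
    intro C
    ext ω
    simp only [lastZeroAt, Set.mem_inter_iff]
    tauto
  rw [e1, e2]
  induction m with
  | zero =>
    rw [avoidProb, ← measureReal_step_noZeroAfter hφ_nonneg hφ_sum hφ_sq hQ hX fun ω h => h.2]
    congr 3
    ext ω
    simp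
  | succ m ih =>
    rw [avoidProb, ← mul_assoc, ← ih]
    set C : Set Path := {ω | ∀ i ≤ m, X (n + 1 + i) ω = y i} with hC
    have hC' : {ω | ∀ i ≤ m + 1, X (n + 1 + i) ω = y i} =
        C ∩ {ω | X (n + 1 + m + 1) ω = y (m + 1)} := by
      ext ω
      simp only [hC, Set.mem_ofPred_eq, Set.mem_inter_iff, Nat.le_succ_iff]
      constructor
      · exact fun h => ⟨fun i hi => h i (Or.inl hi), h (m + 1) (Or.inr rfl)⟩
      · rintro ⟨h1, h2⟩ i (hi | rfl)
        · exact h1 i hi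
        · exact h2
    rw [hC', ← Set.inter_assoc]
    by_cases hy : ∀ i ≤ m, y i ≠ 0
    · have hnz : ∀ E : Set Path, E ⊆ C → E ∩ noZeroAfter n = E ∩ noZeroAfter (n + 1 + m) := by
        intro E hE
        ext ω
        refine and_congr_right fun hω => ⟨fun h j hj => h j (by omega), fun h j hj => ?_⟩
        by_cases hjm : n + 1 + m < j
        · exact h j hjm
        · have := hE hω (j - (n + 1)) (by omega)
          rw [show n + 1 + (j - (n + 1)) = j by omega] at this
          rw [this]
          exact hy _ (by omega)
      have hCm : MeasurableSet[canonFiltration (n + 1 + m)] C :=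
        measurableSet_canonFiltration_iff.2 fun ω ω' h => by
          simp only [hC, Set.mem_ofPred_eq, eq_iff_iff]
          exact forall₂_congr fun i hi => by rw [h _ (by omega)]
      rw [hnz _ fun ω h => h.1.2, hnz _ fun ω h => h.2,
        measureReal_step_noZeroAfter hφ_nonneg hφ_sum hφ_sq hQ
          ((canonFiltration.mono (by omega) _ hX).inter hCm) fun ω h => h.2 m le_rfl]
    -- A prescribed zero contradicts the absence of zeros, so both events are empty.
    · push Not at hy
      obtain ⟨i, hi, hi0⟩ := hy
      have h0 : Λ ∩ {ω | X n ω = 0} ∩ C ∩ noZeroAfter n = ∅ :=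
        Set.eq_empty_of_forall_notMem fun ω h =>
          h.2 (n + 1 + i) (by omega) ((h.1.2 i hi).trans hi0)
      have h1 : Λ ∩ {ω | X n ω = 0} ∩ C ∩ {ω | X (n + 1 + m + 1) ω = y (m + 1)} ∩
          noZeroAfter n = ∅ :=
        Set.eq_empty_of_forall_notMem fun ω h =>
          h.2 (n + 1 + i) (by omega) ((h.1.1.2 i hi).trans hi0)
      rw [h0, h1, measureReal_empty, zero_mul]

/-- The factor for the path after `g` is the same for every value of `g`, so it comes out of the
sum. `U` may be any set, because the path up to a fixed `n` is a functional of finitely many steps.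
-/
lemma measure_pathUpTo_inter_postG {φ : ℕ → ℝ} (hφ_nonneg : ∀ k, 0 ≤ φ k) (hφ_sum : HasSum φ 1)
    (hφ_sq : Summable fun k : ℕ => (k : ℝ) ^ 2 * φ k) {Q : Measure Path} [IsProbabilityMeasure Q]
    (hQ : IsInducedBy φ Q) {U : Set (ℕ × (ℕ → ℤ))} (m : ℕ) (y : ℕ → ℤ) :
    Q ((fun ω => pathUpTo (g ω) ω) ⁻¹' U ∩ {ω | ∀ i ≤ m, postG i ω = y i}) =
      Q ((fun ω => pathUpTo (g ω) ω) ⁻¹' U) * ENNReal.ofReal (avoidProb m y) := by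
  have hF : ∀ n, MeasurableSet[canonFiltration n] {ω | pathUpTo n ω ∈ U} := fun n =>
    ((dependsUpTo_pathUpTo n).comp (· ∈ U)).measurableSet_canonFiltration
  have hF' : ∀ n, MeasurableSet {ω | pathUpTo n ω ∈ U} := fun n => canonFiltration.le n _ (hF n)
  have hC : ∀ n, MeasurableSet {ω | ∀ i ≤ m, X (n + 1 + i) ω = y i} := fun n => by
    simp only [Set.ofPred_forall]
    exact MeasurableSet.iInter fun i => MeasurableSet.iInter fun _ =>
      measurable_X _ (measurableSet_singleton _)
  have h1 := measure_eq_tsum_lastZeroAt hφ_nonneg hφ_sum hφ_sq hQ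
    (E := (fun ω => pathUpTo (g ω) ω) ⁻¹' U) hF' fun n ω hω => by
      simp only [Set.mem_preimage, Set.mem_ofPred_eq, g_eq hω]
  have h2 := measure_eq_tsum_lastZeroAt hφ_nonneg hφ_sum hφ_sq hQ
    (E := (fun ω => pathUpTo (g ω) ω) ⁻¹' U ∩ {ω | ∀ i ≤ m, postG i ω = y i})
    (fun n => (hF' n).inter (hC n)) fun n ω hω => by
      simp only [Set.mem_inter_iff, Set.mem_preimage, Set.mem_ofPred_eq, g_eq hω, postG_eq hω]
  rw [h1, h2, ← ENNReal.tsum_mul_right]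
  refine tsum_congr fun n => ?_
  rw [← ofReal_measureReal, measureReal_lastZeroAt_cylinder hφ_nonneg hφ_sum hφ_sq hQ (hF n),
    ENNReal.ofReal_mul measureReal_nonneg, ofReal_measureReal]

lemma measure_postG_cylinder {φ : ℕ → ℝ} (hφ_nonneg : ∀ k, 0 ≤ φ k) (hφ_sum : HasSum φ 1)
    (hφ_sq : Summable fun k : ℕ => (k : ℝ) ^ 2 * φ k) {Q : Measure Path} [IsProbabilityMeasure Q]
    (hQ : IsInducedBy φ Q) (m : ℕ) (y : ℕ → ℤ) :
    Q {ω | ∀ i ≤ m, postG i ω = y i} = ENNReal.ofReal (avoidProb m y) := by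
  simpa using measure_pathUpTo_inter_postG hφ_nonneg hφ_sum hφ_sq hQ (U := Set.univ) m y

/-- Finite-dimensional laws on a countable space are determined by points, and a projective limit of
finite measures is unique. -/
lemma ext_of_cylinders {μ ν : Measure (ℕ → ℤ)} [IsFiniteMeasure μ]
    (h : ∀ (m : ℕ) (y : ℕ → ℤ), μ {z | ∀ i ≤ m, z i = y i} = ν {z | ∀ i ≤ m, z i = y i}) :
    μ = ν := by
  have hle : ∀ m, μ.map (Preorder.frestrictLe (π := fun _ => ℤ) m) =
      ν.map (Preorder.frestrictLe (π := fun _ => ℤ) m) := fun m => by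
    refine Measure.ext_of_singleton fun d => ?_
    rw [Measure.map_apply (by fun_prop) (measurableSet_singleton d),
      Measure.map_apply (by fun_prop) (measurableSet_singleton d)]
    convert h m (fun i => if hi : i ∈ Finset.Iic m then d ⟨i, hi⟩ else 0) using 2 <;>
    · ext z
      simp only [Set.mem_preimage, Set.mem_singleton_iff, Set.mem_ofPred_eq]
      constructor
      · rintro rfl i hi
        rw [dif_pos (Finset.mem_Iic.2 hi)]
        rfl
      · intro hz
        funext ⟨i, hi⟩
        have := hz i (Finset.mem_Iic.1 hi)
        rwa [dif_pos hi] at this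
  have hproj : ∀ I : Finset ℕ, μ.map (I.restrict (π := fun _ => ℤ)) = ν.map I.restrict := by
    intro I
    have hI : I ⊆ Finset.Iic (I.sup id) := fun i hi => Finset.mem_Iic.2 (Finset.le_sup (f := id) hi)
    have e : I.restrict (π := fun _ => ℤ) =
        Finset.restrict₂ (π := fun _ => ℤ) hI ∘ Preorder.frestrictLe (π := fun _ => ℤ) _ := rfl
    rw [e, ← Measure.map_map (by fun_prop) (by fun_prop), hle, Measure.map_map (by fun_prop)
      (by fun_prop)]
  exact IsProjectiveLimit.unique (P := fun I : Finset ℕ => μ.map (I.restrict (π := fun _ => ℤ)))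
    (fun _ => rfl) fun I => (hproj I).symm

lemma indepFun_pathUpTo_postG {φ : ℕ → ℝ} (hφ_nonneg : ∀ k, 0 ≤ φ k) (hφ_sum : HasSum φ 1)
    (hφ_sq : Summable fun k : ℕ => (k : ℝ) ^ 2 * φ k) {Q : Measure Path} [IsProbabilityMeasure Q]
    (hQ : IsInducedBy φ Q) :
    IndepFun (fun ω => pathUpTo (g ω) ω) (fun ω n => postG n ω) Q := by
  have hpost : Measurable fun (ω : Path) n => postG n ω := measurable_pi_lambda _ measurable_postG
  rw [indepFun_iff_measure_inter_preimage_eq_mul]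
  intro U V hU hV
  have hUm := measurable_pathUpTo measurable_g hU
  set E := (fun ω => pathUpTo (g ω) ω) ⁻¹' U
  have hC : ∀ m (y : ℕ → ℤ), MeasurableSet {z : ℕ → ℤ | ∀ i ≤ m, z i = y i} := fun m y => by
    simp only [Set.ofPred_forall]
    exact MeasurableSet.iInter fun i => MeasurableSet.iInter fun _ =>
      measurable_pi_apply i (measurableSet_singleton _)
  -- Independence from the event `E` is an equality of two measures on sequences, so it can be
  -- tested on cylinders.
  have key : (Q.restrict E).map (fun (ω : Path) n => postG n ω) =
      Q E • Q.map fun (ω : Path) n => postG n ω := by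
    refine ext_of_cylinders fun m y => ?_
    rw [Measure.map_apply hpost (hC m y), Measure.restrict_apply (hpost (hC m y)),
      Measure.smul_apply, Measure.map_apply hpost (hC m y), smul_eq_mul, Set.inter_comm]
    have e : (fun (ω : Path) n => postG n ω) ⁻¹' {z | ∀ i ≤ m, z i = y i} =
      {ω | ∀ i ≤ m, postG i ω = y i} := rfl
    rw [e, measure_postG_cylinder hφ_nonneg hφ_sum hφ_sq hQ,
      measure_pathUpTo_inter_postG hφ_nonneg hφ_sum hφ_sq hQ]
  have := congrArg (fun μ => μ V) key
  rwa [Measure.map_apply hpost hV, Measure.restrict_apply (hpost hV), Measure.smul_apply,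
    Measure.map_apply hpost hV, smul_eq_mul, Set.inter_comm] at this

/-! ### The law of the number of zeros and of the maximum at the last zero -/

lemma measure_zeroCount_Sstar_g {φ : ℕ → ℝ} (hφ_nonneg : ∀ k, 0 ≤ φ k) (hφ_sum : HasSum φ 1)
    (hφ_sq : Summable fun k : ℕ => (k : ℝ) ^ 2 * φ k) {Q : Measure Path} [IsProbabilityMeasure Q]
    (hQ : IsInducedBy φ Q) (a k : ℕ) :
    Q {ω | zeroCount (g ω) ω = a ∧ Sstar (g ω) ω = k} = ENNReal.ofReal (jointLaw φ a k) := by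
  have hm : ∀ n, MeasurableSet {ω | zeroCount n ω = a ∧ Sstar n ω = k} := fun n =>
    canonFiltration.le n _ ((dependsUpTo_zeroCount n).comp₂ (dependsUpTo_Sstar n)
      fun c s => c = a ∧ s = k).measurableSet_canonFiltration
  rw [measure_eq_tsum_lastZeroAt hφ_nonneg hφ_sum hφ_sq hQ hm fun n ω hω => by
      simp only [Set.mem_ofPred_eq, g_eq hω],
    ← (hasSum_zeroAt φ a k).tsum_eq, ENNReal.ofReal_tsum_of_nonneg
      (fun n => mul_nonneg (hφ_nonneg k) measureReal_nonneg) (hasSum_zeroAt φ a k).summable]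
  refine tsum_congr fun n => ?_
  rw [Set.inter_comm, measure_zeroAt_inter_lastZeroAt hφ_nonneg hφ_sum hφ_sq hQ]

lemma measurable_Sstar_g : Measurable fun ω => Sstar (g ω) ω :=
  measurable_comp_index (fun n => (dependsUpTo_Sstar n).measurable) measurable_g

lemma measurable_zeroCount_g : Measurable fun ω => zeroCount (g ω) ω :=
  measurable_comp_index (fun n => (dependsUpTo_zeroCount n).measurable) measurable_g

lemma measure_Sstar_g {φ : ℕ → ℝ} (hφ_nonneg : ∀ k, 0 ≤ φ k) (hφ_sum : HasSum φ 1)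
    (hφ_sq : Summable fun k : ℕ => (k : ℝ) ^ 2 * φ k) {Q : Measure Path} [IsProbabilityMeasure Q]
    (hQ : IsInducedBy φ Q) (k : ℕ) :
    Q {ω | Sstar (g ω) ω = k} = ENNReal.ofReal (φ k) := by
  have hS : MeasurableSet {ω | Sstar (g ω) ω = k} :=
    measurable_Sstar_g (measurableSet_singleton k)
  rw [measure_eq_tsum_inter_fiber Q hS _ fun a =>
      measurable_zeroCount_g (measurableSet_singleton a),
    ← (hasSum_jointLaw φ k).tsum_eq, ENNReal.ofReal_tsum_of_nonneg
        (fun a => jointLaw_nonneg hφ_nonneg a k) (hasSum_jointLaw φ k).summable]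
  refine tsum_congr fun a => ?_
  rw [← measure_zeroCount_Sstar_g hφ_nonneg hφ_sum hφ_sq hQ, Set.inter_comm]
  rfl

/-! ### The maximum is infinite -/

/-- On `{S*_n ≤ K}` the density `M*_n` is at most `K + C`, while the `ℙ`-probability of this event
tends to `0`. -/
lemma ae_SstarInfty {φ : ℕ → ℝ} (hφ_nonneg : ∀ k, 0 ≤ φ k) (hφ_sum : HasSum φ 1)
    (hφ_sq : Summable fun k : ℕ => (k : ℝ) ^ 2 * φ k) {Q : Measure Path} [IsProbabilityMeasure Q]
    (hQ : IsInducedBy φ Q) : ∀ᵐ ω ∂Q, SstarInfty ω = ⊤ := by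
  obtain ⟨C, hC⟩ := Mstar_rest_bound hφ_nonneg hφ_sum hφ_sq
  have hφ1 : ∀ k, φ k ≤ 1 := fun k =>
    hφ_sum.tsum_eq ▸ hφ_sum.summable.le_tsum k fun j _ => hφ_nonneg j
  have hC0 : 0 ≤ C := by
    have := hC 0 (pathOfCoins fun _ => true); linarith [this.1, this.2]
  have hbound : ∀ K n : ℕ, Q.real {ω | Sstar n ω ≤ K} ≤
      (K + C) * walkLaw.real {ω | Rstar n ω ≤ K} := fun K n => by
    have hF : MeasurableSet[canonFiltration n] {ω | Sstar n ω ≤ K} :=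
      ((dependsUpTo_Sstar n).comp (· ≤ K)).measurableSet_canonFiltration
    rw [hQ n _ hF]
    calc ∫ ω in {ω | Sstar n ω ≤ K}, Mstar φ n ω ∂walkLaw
        ≤ ∫ ω in {ω | Sstar n ω ≤ K}, (K + C) ∂walkLaw := by
          refine setIntegral_mono_on (dependsUpTo_Mstar φ n).integrable.integrableOn
            (integrable_const _).integrableOn (canonFiltration.le n _ hF) fun ω hω => ?_
          have h1 : φ (Rstar n ω) * |(X n ω : ℝ)| ≤ 1 * K :=
            mul_le_mul (hφ1 _) ((abs_X_le_Sstar n ω).trans (by exact_mod_cast hω))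
              (abs_nonneg _) zero_le_one
          linarith [(hC n ω).2]
      _ = (K + C) * walkLaw.real {ω | Sstar n ω ≤ K} := by simp [mul_comm]
      _ ≤ _ := mul_le_mul_of_nonneg_left
          (measureReal_mono fun ω h => (Rstar_le_Sstar n ω).trans h) (by positivity)
  have hzero : ∀ K : ℕ, Q {ω | ∀ n, Sstar n ω ≤ K} = 0 := fun K => by
    have h1 : ∀ n, Q.real {ω | ∀ n, Sstar n ω ≤ K} ≤
        (K + C) * walkLaw.real {ω | Rstar n ω ≤ K} := fun n =>
      (measureReal_mono (Set.ofPred_subset_ofPred.2 fun ω h => h n)).trans (hbound K n)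
    have h2 := (tendsto_measureReal_Rstar_le K).const_mul ((K : ℝ) + C)
    rw [mul_zero] at h2
    have h3 := ge_of_tendsto' h2 h1
    exact (measureReal_eq_zero_iff (measure_ne_top _ _)).1 (le_antisymm h3 measureReal_nonneg)
  filter_upwards [ae_all_iff.2 fun K => measure_eq_zero_iff_ae_notMem.1 (hzero K)] with ω hω
  by_contra hne
  obtain ⟨K, hK⟩ := ENat.ne_top_iff_exists.1 hne
  refine hω K fun n => ?_
  have : (Sstar n ω : ℕ∞) ≤ K := by
    rw [hK]
    exact le_iSup (fun n => (Sstar n ω : ℕ∞)) n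
  exact_mod_cast this

/-! ### The martingale is not uniformly integrable -/

lemma Rstar_le_of_lastZeroAt {m : ℕ} {ω : Path} (h : ω ∈ lastZeroAt m) (n : ℕ) :
    Rstar n ω ≤ Sstar (g ω) ω := by
  rw [g_eq h]
  refine Sstar_mono ω (Finset.sup_le fun k hk => ?_)
  by_contra hlt
  exact h.2 k (not_le.1 hlt) (Finset.mem_filter.1 hk).2

/-- The events `{S*_{g_n} ≤ K}` become `ℙ`-small, yet they contain `{S*_g ≤ K}` almost surely under
`Q*`, so `M*_n` keeps mass above `1/2` on them. -/
lemma not_uniformIntegrable_Mstar {φ : ℕ → ℝ} (hφ_nonneg : ∀ k, 0 ≤ φ k) (hφ_sum : HasSum φ 1)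
    (hφ_sq : Summable fun k : ℕ => (k : ℝ) ^ 2 * φ k) :
    ¬ UniformIntegrable (Mstar φ) 1 walkLaw := by
  rintro ⟨-, hUI, -⟩
  obtain ⟨Q, hQp, hQ⟩ := exists_isInducedBy hφ_nonneg hφ_sum
  have hfin := ae_exists_lastZeroAt hφ_nonneg hφ_sum hφ_sq hQ
  obtain ⟨K, hK⟩ : ∃ K : ℕ, 1 / 2 < Q.real {ω | Sstar (g ω) ω ≤ K} := by
    have h1 := tendsto_measure_iUnion_atTop (μ := Q) (s := fun K : ℕ => {ω | Sstar (g ω) ω ≤ K})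
      fun K K' h ω hω => le_trans hω h
    have h2 : ⋃ K : ℕ, {ω | Sstar (g ω) ω ≤ K} = Set.univ :=
      Set.eq_univ_of_forall fun ω => Set.mem_iUnion.2 ⟨Sstar (g ω) ω, le_refl (Sstar (g ω) ω)⟩
    rw [h2, measure_univ] at h1
    have h3 := (ENNReal.tendsto_toReal ENNReal.one_ne_top).comp h1
    exact (h3.eventually_const_lt (u := 1 / 2) (by norm_num)).exists
  obtain ⟨δ, hδ, hUI⟩ := hUI (ε := 1 / 4) (by norm_num)
  obtain ⟨n, hn⟩ := ((tendsto_measureReal_Rstar_le K).eventually_lt_const hδ).exists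
  have hF : MeasurableSet[canonFiltration n] {ω | Rstar n ω ≤ K} :=
    ((dependsUpTo_Rstar n).comp (· ≤ K)).measurableSet_canonFiltration
  have hm := measurableSet_Rstar_le n K
  have h1 := hUI n _ hm (by rw [← ofReal_measureReal]; exact ENNReal.ofReal_le_ofReal hn.le)
  have h2 : ENNReal.ofReal (Q.real {ω | Rstar n ω ≤ K}) ≤
      eLpNorm ({ω | Rstar n ω ≤ K}.indicator (Mstar φ n)) 1 walkLaw := by
    rw [hQ n _ hF, ← integral_indicator hm, eLpNorm_one_eq_lintegral_enorm]
    refine le_trans ?_ (enorm_integral_le_lintegral_enorm _)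
    rw [← Real.enorm_of_nonneg]
    exact integral_nonneg fun ω => Set.indicator_nonneg (fun ω _ => Mstar_nonneg hφ_nonneg n ω) ω
  have h3 : Q.real {ω | Sstar (g ω) ω ≤ K} ≤ Q.real {ω | Rstar n ω ≤ K} := by
    refine ENNReal.toReal_mono (measure_ne_top _ _) (measure_mono_ae ?_)
    filter_upwards [hfin] with ω ⟨m, hω⟩ h
    exact (Rstar_le_of_lastZeroAt hω n).trans h
  have h4 := (ENNReal.ofReal_le_ofReal_iff (by norm_num)).1 (h2.trans h1)
  linarith

/-! ### The sign of the path after the last zero, and the Bessel-star walk -/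

lemma postG_ne_zero {n : ℕ} {ω : Path} (h : ω ∈ lastZeroAt n) (i : ℕ) : postG i ω ≠ 0 := by
  rw [postG_eq h]
  exact h.2 _ (by omega)

lemma postG_zero_cases {n : ℕ} {ω : Path} (h : ω ∈ lastZeroAt n) :
    postG 0 ω = 1 ∨ postG 0 ω = -1 := by
  rw [postG_eq h, add_zero]
  have h0 : X n ω = 0 := h.1
  rcases X_succ_cases n ω with h1 | h1 <;> omega

/-- With unit steps and no zero, the sign is decided by the first step after `g`. The parameter `ε`
handles both signs at once. -/
lemma pos_mul_postG_iff {n : ℕ} {ω : Path} (h : ω ∈ lastZeroAt n) {ε : ℤ} (hε : ε = 1 ∨ ε = -1) :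
    (∀ i, 0 < ε * postG i ω) ↔ ε * postG 0 ω = 1 := by
  have h0 := postG_zero_cases h
  constructor
  · intro hp
    have := hp 0
    rcases hε with rfl | rfl <;> omega
  · intro h1 i
    induction i with
    | zero => omega
    | succ i ih =>
      have hne := postG_ne_zero h (i + 1)
      rw [postG_eq h] at ih
      rw [postG_eq h, ← add_assoc] at hne ⊢
      rcases X_succ_cases (n + 1 + i) ω with h2 | h2 <;> rcases hε with rfl | rfl <;> omega

lemma avoidTrans_mul {ε : ℤ} (hε : ε = 1 ∨ ε = -1) (x z : ℤ) :
    avoidTrans (ε * x) (ε * z) = avoidTrans x z := by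
  have h : |ε| = 1 := by rcases hε with rfl | rfl <;> rfl
  have hr : |(ε : ℝ)| = 1 := by exact_mod_cast congrArg (Int.cast (R := ℝ)) h
  unfold avoidTrans
  rw [← mul_sub, abs_mul, h, one_mul]
  push_cast
  rw [abs_mul, abs_mul, hr, one_mul, one_mul]

lemma avoidTrans_eq_besselStarTrans {x : ℤ} (hx : 1 ≤ x) (z : ℤ) :
    avoidTrans x z = besselStarTrans x z := by
  have hxr : (1 : ℝ) ≤ x := by exact_mod_cast hx
  unfold avoidTrans besselStarTrans
  rw [if_pos hx, abs_of_nonneg (by linarith : (0 : ℝ) ≤ x), max_eq_left hxr]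
  by_cases h1 : z = x + 1
  · rw [if_pos h1, if_pos (by rw [h1]; simp), h1]
    push_cast
    rw [abs_of_nonneg (by linarith)]
  · rw [if_neg h1]
    by_cases h2 : z = x - 1
    · rw [if_pos h2, if_pos (by rw [h2]; simp), h2]
      push_cast
      rw [abs_of_nonneg (by linarith)]
    · rw [if_neg h2, if_neg]
      intro h
      rcases (abs_eq zero_le_one).1 h with h | h <;> omega

lemma measureReal_postG_cylinder {φ : ℕ → ℝ} (hφ_nonneg : ∀ k, 0 ≤ φ k) (hφ_sum : HasSum φ 1)
    (hφ_sq : Summable fun k : ℕ => (k : ℝ) ^ 2 * φ k) {Q : Measure Path} [IsProbabilityMeasure Q]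
    (hQ : IsInducedBy φ Q) {ε : ℤ} (hε : ε = 1 ∨ ε = -1) (m : ℕ) (y : ℕ → ℤ) :
    Q.real {ω | ∀ i ≤ m, ε * postG i ω = y i} = avoidProb m fun i => ε * y i := by
  have h : {ω | ∀ i ≤ m, ε * postG i ω = y i} = {ω | ∀ i ≤ m, postG i ω = ε * y i} := by
    ext ω
    refine forall₂_congr fun i _ => ?_
    rcases hε with rfl | rfl <;> omega
  rw [h, measureReal_def, measure_postG_cylinder hφ_nonneg hφ_sum hφ_sq hQ,
    ENNReal.toReal_ofReal (avoidProb_nonneg _ _)]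

lemma measureReal_sign {φ : ℕ → ℝ} (hφ_nonneg : ∀ k, 0 ≤ φ k) (hφ_sum : HasSum φ 1)
    (hφ_sq : Summable fun k : ℕ => (k : ℝ) ^ 2 * φ k) {Q : Measure Path} [IsProbabilityMeasure Q]
    (hQ : IsInducedBy φ Q) {ε : ℤ} (hε : ε = 1 ∨ ε = -1) :
    Q.real {ω | ∀ i, 0 < ε * postG i ω} = 1 / 2 := by
  have h1 : {ω | ∀ i, 0 < ε * postG i ω} =ᵐ[Q] {ω | ∀ i ≤ 0, ε * postG i ω = 1} := by
    filter_upwards [ae_exists_lastZeroAt hφ_nonneg hφ_sum hφ_sq hQ] with ω ⟨n, hn⟩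
    refine propext ((pos_mul_postG_iff hn hε).trans ?_)
    exact ⟨fun h i hi => by rw [Nat.le_zero.1 hi, h], fun h => h 0 le_rfl⟩
  rw [measureReal_congr h1,
    measureReal_postG_cylinder hφ_nonneg hφ_sum hφ_sq hQ hε 0 fun _ => 1, avoidProb]
  have := avoidTrans_mul hε 0 1
  rw [mul_zero] at this
  rw [this]
  norm_num [avoidTrans]

lemma isBesselStarWalk_postG {φ : ℕ → ℝ} (hφ_nonneg : ∀ k, 0 ≤ φ k) (hφ_sum : HasSum φ 1)
    (hφ_sq : Summable fun k : ℕ => (k : ℝ) ^ 2 * φ k) {Q : Measure Path} [IsProbabilityMeasure Q]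
    (hQ : IsInducedBy φ Q) {ε : ℤ} (hε : ε = 1 ∨ ε = -1) :
    IsBesselStarWalk (fun i ω => ε * postG i ω) (cond Q {ω | ∀ i, 0 < ε * postG i ω}) 1 := by
  have hfin := ae_exists_lastZeroAt hφ_nonneg hφ_sum hφ_sq hQ
  set P : Set Path := {ω | ∀ i, 0 < ε * postG i ω} with hP
  have hPm : MeasurableSet P := by
    simp only [hP, Set.ofPred_forall]
    exact MeasurableSet.iInter fun i => measurableSet_lt measurable_const
      (measurable_const.mul (measurable_postG i))
  have hPae : ∀ᵐ ω ∂Q[|P], ω ∈ P := ae_cond_mem hPm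
  have hfin' := cond_absolutelyContinuous (s := P) hfin
  have hone : ∀ᵐ ω ∂Q[|P], ε * postG 0 ω = 1 := by
    filter_upwards [hPae, hfin'] with ω h1 ⟨n, hn⟩ using (pos_mul_postG_iff hn hε).1 h1
  refine ⟨hPae.mono fun ω h i => h i, hone, fun n y => ?_⟩
  have hcond : ∀ E, (Q[|P]).real E = (Q P)⁻¹.toReal * Q.real (P ∩ E) := fun E => by
    rw [measureReal_def, cond_apply hPm, ENNReal.toReal_mul, measureReal_def]
  rw [hcond, hcond, mul_assoc]
  congr 1
  -- A cylinder of positive mass contains a path, which forces `y 0 = 1` and `1 ≤ y n`. Then `P` is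
  -- almost surely implied by the cylinder and drops out.
  by_cases hz : Q.real (P ∩ {ω | ∀ i ≤ n, ε * postG i ω = y i}) = 0
  · rw [hz, zero_mul]
    refine le_antisymm ((measureReal_mono ?_).trans_eq hz) measureReal_nonneg
    exact fun ω h => ⟨h.1, fun i hi => h.2 i (hi.trans n.le_succ)⟩
  · have hne : (P ∩ {ω | ∀ i ≤ n, ε * postG i ω = y i} ∩ {ω | ∃ n, ω ∈ lastZeroAt n}).Nonempty := by
      by_contra hemp
      refine hz ((measureReal_eq_zero_iff (measure_ne_top _ _)).2 ?_)
      refine measure_eq_zero_iff_ae_notMem.2 (hfin.mono fun ω hω h => hemp ⟨ω, h, hω⟩)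
    obtain ⟨ω, ⟨hωP, hωy⟩, m, hm⟩ := hne
    have hy0 : y 0 = 1 := by rw [← hωy 0 (Nat.zero_le n)]; exact (pos_mul_postG_iff hm hε).1 hωP
    have hyn : 1 ≤ y n := by rw [← hωy n le_rfl]; exact hωP n
    have hdrop : ∀ m, (P ∩ {ω | ∀ i ≤ m, ε * postG i ω = y i} : Set Path) =ᵐ[Q]
        ({ω | ∀ i ≤ m, ε * postG i ω = y i} : Set Path) := fun m => by
      filter_upwards [hfin] with ω ⟨j, hj⟩
      refine propext ⟨fun h => h.2, fun h => ⟨(pos_mul_postG_iff hj hε).2 ?_, h⟩⟩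
      exact (h 0 (Nat.zero_le m)).trans hy0
    rw [measureReal_congr (hdrop _), measureReal_congr (hdrop _),
      measureReal_postG_cylinder hφ_nonneg hφ_sum hφ_sq hQ hε,
      measureReal_postG_cylinder hφ_nonneg hφ_sum hφ_sq hQ hε, avoidProb, avoidTrans_mul hε,
      avoidTrans_eq_besselStarTrans hyn]

/-! ### The path up to the last zero -/

/-- The start at `0` matters for `a = 0`: a path started elsewhere would have `τ_0 = 0` without
being at a zero. -/
lemma tau_eq_iff {a n : ℕ} {ω : Path} (h0 : X 0 ω = 0) :
    tau a ω = n ↔ X n ω = 0 ∧ zeroCount n ω = a := by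
  have hle : ∀ k, zeroCount k ω = a → tau a ω ≤ k := fun k hk =>
    iInf₂_le (f := fun (k : ℕ) _ => (k : ℕ∞)) k hk
  constructor
  · intro h
    have hlt : tau a ω < (n + 1 : ℕ) := by rw [h]; exact_mod_cast n.lt_succ_self
    simp only [tau, iInf_lt_iff, exists_prop, Set.mem_ofPred_eq] at hlt
    obtain ⟨k, hk, hkn⟩ := hlt
    have hkn' : k < n + 1 := by exact_mod_cast hkn
    have hnk : n ≤ k := by exact_mod_cast h ▸ hle k hk
    obtain rfl : k = n := by omega
    refine ⟨?_, hk⟩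
    cases k with
    | zero => exact h0
    | succ k =>
      by_contra hne
      rw [zeroCount_succ, if_neg hne, add_zero] at hk
      have : k + 1 ≤ k := by exact_mod_cast h ▸ hle k hk
      omega
  · rintro ⟨hX, hc⟩
    refine le_antisymm (hle n hc) (le_iInf₂ fun k hk => ?_)
    by_contra hlt
    have hkn : k < n := by exact_mod_cast not_le.1 hlt
    obtain ⟨n, rfl⟩ := Nat.exists_eq_succ_of_ne_zero (Nat.ne_zero_of_lt hkn)
    have h1 := zeroCount_mono ω (Nat.lt_succ_iff.1 hkn)
    rw [Nat.succ_eq_add_one, zeroCount_succ, if_pos hX] at hc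
    have hk' : zeroCount k ω = a := hk
    simp only at h1
    omega

lemma measure_tau_inter (a b : ℕ) {U : Set (ℕ × (ℕ → ℤ))} :
    walkLaw ({ω | tau a ω < ⊤ ∧ Sstar (tau a ω).toNat ω = b} ∩
      (fun ω => pathUpTo (tau a ω).toNat ω) ⁻¹' U) =
      ∑' n, walkLaw ({ω | (zeroCount n ω = a ∧ Sstar n ω = b) ∧ pathUpTo n ω ∈ U} ∩
        {ω | X n ω = 0}) := by
  have hm : ∀ n, MeasurableSet ({ω | (zeroCount n ω = a ∧ Sstar n ω = b) ∧ pathUpTo n ω ∈ U} ∩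
        {ω | X n ω = 0}) := fun n =>
    (canonFiltration.le n _ (((dependsUpTo_zeroCount n).comp₂ (dependsUpTo_Sstar n)
      fun c s => c = a ∧ s = b).comp₂ (dependsUpTo_pathUpTo n)
        fun p u => p ∧ u ∈ U).measurableSet_canonFiltration).inter
      (measurable_X n (measurableSet_singleton 0))
  -- Disjointness holds only almost surely, since it uses the identification of `τ_a` for paths
  -- started from `0`.
  rw [← measure_iUnion₀ ?_ fun n => (hm n).nullMeasurableSet]
  · refine measure_congr ?_
    filter_upwards [ae_X_zero] with ω h0
    refine propext (Iff.trans (Iff.intro ?_ ?_) Set.mem_iUnion.symm)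
    · rintro ⟨⟨h1, h2⟩, h3⟩
      obtain ⟨n, hn⟩ := ENat.ne_top_iff_exists.1 h1.ne
      have h4 : (tau a ω).toNat = n := by rw [← hn, ENat.toNat_natCast]
      have h5 := (tau_eq_iff h0).1 hn.symm
      rw [Set.mem_preimage] at h3
      rw [h4] at h2 h3
      exact ⟨n, ⟨⟨h5.2, h2⟩, h3⟩, h5.1⟩
    · rintro ⟨n, ⟨⟨h1, h2⟩, h3⟩, h4⟩
      have h5 := (tau_eq_iff h0).2 ⟨h4, h1⟩
      have h6 : (tau a ω).toNat = n := by rw [h5, ENat.toNat_natCast]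
      refine ⟨⟨h5 ▸ ENat.natCast_lt_top n, by rw [h6]; exact h2⟩, ?_⟩
      rw [Set.mem_preimage, h6]
      exact h3
  · intro m n hmn
    refine measure_mono_null (fun ω hω => ?_) (ae_iff.1 ae_X_zero)
    intro h0
    have h1 := (tau_eq_iff h0).2 ⟨hω.1.2, hω.1.1.1.1⟩
    have h2 := (tau_eq_iff h0).2 ⟨hω.2.2, hω.2.1.1.1⟩
    exact hmn (by exact_mod_cast h1.symm.trans h2)

/-- Both sides are sums over the time `n` of the `a`-th zero; when the maximum is `b`, being the
last zero contributes the constant factor `φ b`, which cancels on conditioning. -/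
lemma measure_g_inter {φ : ℕ → ℝ} (hφ_nonneg : ∀ k, 0 ≤ φ k) (hφ_sum : HasSum φ 1)
    (hφ_sq : Summable fun k : ℕ => (k : ℝ) ^ 2 * φ k) {Q : Measure Path} [IsProbabilityMeasure Q]
    (hQ : IsInducedBy φ Q) (a b : ℕ) {U : Set (ℕ × (ℕ → ℤ))} :
    Q ({ω | zeroCount (g ω) ω = a ∧ Sstar (g ω) ω = b} ∩ (fun ω => pathUpTo (g ω) ω) ⁻¹' U) =
      ENNReal.ofReal (φ b) * walkLaw ({ω | tau a ω < ⊤ ∧ Sstar (tau a ω).toNat ω = b} ∩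
        (fun ω => pathUpTo (tau a ω).toNat ω) ⁻¹' U) := by
  have hm : ∀ n, MeasurableSet[canonFiltration n]
      {ω | (zeroCount n ω = a ∧ Sstar n ω = b) ∧ pathUpTo n ω ∈ U} := fun n =>
    (((dependsUpTo_zeroCount n).comp₂ (dependsUpTo_Sstar n)
      fun c s => c = a ∧ s = b).comp₂ (dependsUpTo_pathUpTo n)
        fun p u => p ∧ u ∈ U).measurableSet_canonFiltration
  rw [measure_tau_inter, ← ENNReal.tsum_mul_left,
    measure_eq_tsum_lastZeroAt hφ_nonneg hφ_sum hφ_sq hQ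
      (fun n => canonFiltration.le n _ (hm n)) fun n ω hω => by
        simp only [Set.mem_inter_iff, Set.mem_preimage, Set.mem_ofPred_eq, g_eq hω]]
  exact tsum_congr fun n =>
    measure_inter_lastZeroAt hφ_nonneg hφ_sum hφ_sq hQ (hm n) fun ω h => h.1.2

lemma identDistrib_pathUpTo {φ : ℕ → ℝ} (hφ_nonneg : ∀ k, 0 ≤ φ k) (hφ_sum : HasSum φ 1)
    (hφ_sq : Summable fun k : ℕ => (k : ℝ) ^ 2 * φ k) {Q : Measure Path} [IsProbabilityMeasure Q]
    (hQ : IsInducedBy φ Q) {a b : ℕ}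
    (hab : Q {ω | zeroCount (g ω) ω = a ∧ Sstar (g ω) ω = b} ≠ 0) :
    IdentDistrib (fun ω => pathUpTo (g ω) ω) (fun ω => pathUpTo (tau a ω).toNat ω)
      (cond Q {ω | zeroCount (g ω) ω = a ∧ Sstar (g ω) ω = b})
      (cond walkLaw {ω | tau a ω < ⊤ ∧ Sstar (tau a ω).toNat ω = b}) := by
  have hT : Measurable fun ω => (tau a ω).toNat :=
    (measurable_of_countable ENat.toNat).comp (measurable_tau a)
  have h1 := measurable_pathUpTo measurable_g
  have h2 := measurable_pathUpTo hT
  have hA : MeasurableSet {ω | zeroCount (g ω) ω = a ∧ Sstar (g ω) ω = b} :=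
    (measurable_zeroCount_g (measurableSet_singleton a)).inter
      (measurable_Sstar_g (measurableSet_singleton b))
  have hB : MeasurableSet {ω | tau a ω < ⊤ ∧ Sstar (tau a ω).toNat ω = b} :=
    (measurable_tau a (Set.to_countable {x | x < ⊤}).measurableSet).inter
      (measurable_comp_index (fun n => (dependsUpTo_Sstar n).measurable) hT
        (measurableSet_singleton b))
  refine ⟨h1.aemeasurable, h2.aemeasurable, Measure.ext fun U hU => ?_⟩
  rw [Measure.map_apply h1 hU, Measure.map_apply h2 hU, cond_apply hA, cond_apply hB,
    measure_g_inter hφ_nonneg hφ_sum hφ_sq hQ a b]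
  have htot := measure_g_inter hφ_nonneg hφ_sum hφ_sq hQ a b (U := Set.univ)
  simp only [Set.preimage_univ, Set.inter_univ] at htot
  have hφb : ENNReal.ofReal (φ b) ≠ 0 := fun h => hab (by rw [htot, h, zero_mul])
  rw [htot, ENNReal.mul_inv (Or.inl hφb) (Or.inl ENNReal.ofReal_ne_top), mul_mul_mul_comm,
    ENNReal.inv_mul_cancel hφb ENNReal.ofReal_ne_top, one_mul]

end WalkPenalisation

end

open WalkPenalisation in
theorem mainTheorem3 (φ : ℕ → ℝ) (hφ_nonneg : ∀ k, 0 ≤ φ k) (hφ_sum : HasSum φ 1)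
    (hφ_sq : Summable fun k : ℕ => (k : ℝ) ^ 2 * φ k) :
    -- 1a: the penalisation limit
    (∀ (n : ℕ) (Λ : Set Path), MeasurableSet[canonFiltration n] Λ →
      Tendsto
        (fun p : ℕ =>
          (∫ ω in Λ, φ (Sstar (lastZeroBefore p ω) ω) ∂walkLaw) /
            ∫ ω, φ (Sstar (lastZeroBefore p ω) ω) ∂walkLaw)
        atTop (𝓝 (∫ ω in Λ, Mstar φ n ω ∂walkLaw))) ∧
    -- 1b: a positive martingale that is not uniformly integrable
    (∀ n ω, 0 ≤ Mstar φ n ω) ∧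
    Martingale (Mstar φ) canonFiltration walkLaw ∧
    ¬ UniformIntegrable (Mstar φ) 1 walkLaw ∧
    -- 2: the probability induced by the martingale exists and is unique
    (∃! Q : Measure Path, IsProbabilityMeasure Q ∧ IsInducedBy φ Q) ∧
    ∀ Q : Measure Path, IsProbabilityMeasure Q → IsInducedBy φ Q →
      -- 2a
      (∀ᵐ ω ∂Q, lastZero ω < ⊤) ∧
      (∀ᵐ ω ∂Q, SstarInfty ω = ⊤) ∧
      -- 2b: the laws of the couple and of the second component
      (∀ a k : ℕ, Q.real {ω | zeroCount (g ω) ω = a ∧ Sstar (g ω) ω = k} = jointLaw φ a k) ∧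
      (∀ k : ℕ, Q.real {ω | Sstar (g ω) ω = k} = φ k) ∧
      -- 3a: independence of the parts before and after the last zero
      IndepFun (fun ω => pathUpTo (g ω) ω) (fun ω n => postG n ω) Q ∧
      -- 3b: the part after the last zero
      Q.real {ω | ∀ n, 0 < postG n ω} = 1 / 2 ∧
      IsBesselStarWalk postG (cond Q {ω | ∀ n, 0 < postG n ω}) 1 ∧
      Q.real {ω | ∀ n, postG n ω < 0} = 1 / 2 ∧
      IsBesselStarWalk (fun n ω => -postG n ω) (cond Q {ω | ∀ n, postG n ω < 0}) 1 ∧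
      -- 3c: the part before the last zero
      (∀ a b : ℕ, Q {ω | zeroCount (g ω) ω = a ∧ Sstar (g ω) ω = b} ≠ 0 →
        IdentDistrib (fun ω => pathUpTo (g ω) ω) (fun ω => pathUpTo (tau a ω).toNat ω)
          (cond Q {ω | zeroCount (g ω) ω = a ∧ Sstar (g ω) ω = b})
          (cond walkLaw {ω | tau a ω < ⊤ ∧ Sstar (tau a ω).toNat ω = b})) := by
  have hs := hφ_sum.summable
  refine ⟨fun n Λ hΛ => penalisation_limit hφ_nonneg hφ_sum hφ_sq hΛ, Mstar_nonneg hφ_nonneg,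
    martingale_Mstar hs, not_uniformIntegrable_Mstar hφ_nonneg hφ_sum hφ_sq, ?_,
    fun Q hQp hQ => ?_⟩
  · obtain ⟨Q, hQp, hQ⟩ := exists_isInducedBy hφ_nonneg hφ_sum
    exact ⟨Q, ⟨hQp, hQ⟩, fun Q' ⟨_, hQ'⟩ => hQ'.unique hQ⟩
  · have h1 : (1 : ℤ) = 1 ∨ (1 : ℤ) = -1 := Or.inl rfl
    have h2 : (-1 : ℤ) = 1 ∨ (-1 : ℤ) = -1 := Or.inr rfl
    refine ⟨?_, ae_SstarInfty hφ_nonneg hφ_sum hφ_sq hQ, fun a k => ?_, fun k => ?_,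
      indepFun_pathUpTo_postG hφ_nonneg hφ_sum hφ_sq hQ, ?_, ?_, ?_, ?_,
      fun a b hab => identDistrib_pathUpTo hφ_nonneg hφ_sum hφ_sq hQ hab⟩
    · filter_upwards [ae_exists_lastZeroAt hφ_nonneg hφ_sum hφ_sq hQ] with ω ⟨n, hn⟩
      rw [lastZero_eq hn]
      exact ENat.natCast_lt_top n
    · rw [measureReal_def, measure_zeroCount_Sstar_g hφ_nonneg hφ_sum hφ_sq hQ,
        ENNReal.toReal_ofReal (jointLaw_nonneg hφ_nonneg a k)]
    · rw [measureReal_def, measure_Sstar_g hφ_nonneg hφ_sum hφ_sq hQ,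
        ENNReal.toReal_ofReal (hφ_nonneg k)]
    · simpa only [one_mul] using measureReal_sign hφ_nonneg hφ_sum hφ_sq hQ h1
    · simpa only [one_mul] using isBesselStarWalk_postG hφ_nonneg hφ_sum hφ_sq hQ h1
    · simpa only [neg_one_mul, neg_pos] using measureReal_sign hφ_nonneg hφ_sum hφ_sq hQ h2
    · simpa only [neg_one_mul, neg_pos] using isBesselStarWalk_postG hφ_nonneg hφ_sum hφ_sq hQ h2
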